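/- Conventions. $A,B$ are C$^*$-algebras, $M(A),M(B)$ their multiplier algebras. Hilbert C$^*$-modules are right modules with inner product linear in the first variable; $B$ is a Hilbert module over itself with $\langle b,c\rangle=c^*b$. $\mathcal L(E,F)$ is the set of adjointable maps, $\mathcal L(E)=\mathcal L(E,E)$, and $L(B,E)$ is the set of all linear maps from $B$ into $E$. The strong topology on $L(B,E)$ is that of pointwise norm convergence. A C$^*$-valued weight $\varphi$ from a C$^*$-algebra $C$ into $M(B)$ consists of a hereditary cone $\mathcal M_\varphi^+$ in $C^+$ and a linear map $\varphi:\mathcal M_\varphi=\mathrm{span}\,\mathcal M_\varphi^+\to M(B)$ such that, with $\mathcal N_\varphi=\{a\in C\mid a^*a\in\mathcal M_\varphi^+\}$, one has $\sum_{i,j=1}^n b_j^*\varphi(a_j^*a_i)b_i\ge 0$ for all $n$, $a_1,\dots,a_n\in\mathcal N_\varphi$ and $b_1,\dots,b_n\in B$. It is densely defined if $\mathcal M_\varphi$ is dense in $C$. A KSGNS-construction for $\varphi$ is a triple $(E,\Lambda,\pi)$ where $E$ is a Hilbert C$^*$-module over $B$, $\Lambda:\mathcal N_\varphi\to\mathcal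 L(B,E)$ is linear, the linear span of $\{\Lambda(a)b\mid a\in\mathcal N_\varphi,\,b\in B\}$ is dense in $E$, $\langle\Lambda(a_1)b_1,\Lambda(a_2)b_2\rangle=b_2^*\varphi(a_2^*a_1)b_1$ for all $a_1,a_2\in\mathcal N_\varphi$ and $b_1,b_2\in B$, and $\pi:C\to\mathcal L(E)$ is a $^*$-homomorphism with $\pi(x)\Lambda(a)=\Lambda(xa)$ for all $x\in C$, $a\in\mathcal N_\varphi$. Let $\varphi$ be a densely defined C$^*$-valued weight from $A$ into $M(B)$ with KSGNS-construction $(E,\Lambda,\pi)$. A completely positive linear map $\rho:A\to M(B)$ is strict if it is strictly continuous on bounded sets; it then has a unique completely positive linear extension to $M(A)$ that is strictly continuous on bounded sets, again denoted by $\rho$. Let $\mathcal F_\varphi$ be the set of strict completely positive linear maps $\rho:A\to M(B)$ for which there is $T_\rho\in\mathcal L(E)$ with $0\le T_\rho\le 1$ and $b_2^*\rho(a_2^*a_1)b_1=\langle T_\rho\Lambda(a_1)b_1,\Lambda(a_2)b_2\rangle$ for all $a_1,a_2\in\mathcal N_\varphi$, $b_1,b_2\in B$. Put $\mathcal G_\varphi=\{\lambda\rho\mid\lambda\in[0,1[,\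 \rho\in\mathcal F_\varphi\}$, ordered by $\rho_1\le\rho_2$ if and only if $\rho_2-\rho_1$ is completely positive (it is directed). The weight $\varphi$ is lower semi-continuous if $\mathcal M_\varphi^+$ is the set of all $x\in A^+$ for which the net $(\rho(x))_{\rho\in\mathcal G_\varphi}$ is strictly convergent in $M(B)$, and this net converges strictly to $\varphi(x)$ for every $x\in\mathcal M_\varphi^+$. Proposition. Let $\varphi$ be a densely defined lower semi-continuous C$^*$-valued weight from $A$ into $M(B)$ with KSGNS-construction $(E,\Lambda,\pi)$. Then: (i) There is a unique C$^*$-valued weight $\overline\varphi$ from $M(A)$ into $M(B)$ such that $$\mathcal M_{\overline\varphi}^+=\{x\in M(A)^+\mid \text{the net }(b^*\rho(x)b)_{\rho\in\mathcal G_\varphi}\text{ is convergent for every }b\in B\}$$ and such that $(\rho(x))_{\rho\in\mathcal G_\varphi}$ converges strictly to $\overline\varphi(x)$ for every $x\in\mathcal M_{\overline\varphi}$. It extends $\varphi$. Write $\overline{\mathcal N}_\varphi=\mathcal N_{\overline\varphi}$. (ii) The $^*$-homomorphism $\pi$ has a unique extension to a $^*$-homomorphism $\overline\pi:M(A)\to\mathcal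 L(E)$. (iii) The closure of (the graph of) $\Lambda$ in $M(A)\times L(B,E)$, with respect to the strict topology on $M(A)$ and the strong topology on $L(B,E)$, is the graph of a linear map $\overline\Lambda$ whose domain is exactly $\overline{\mathcal N}_\varphi$ and which takes values in $\mathcal L(B,E)$. Moreover 1. $\overline\pi(x)\overline\Lambda(a)=\overline\Lambda(xa)$ for every $x\in M(A)$ and $a\in\overline{\mathcal N}_\varphi$; 2. $\langle\overline\Lambda(a_1)b_1,\overline\Lambda(a_2)b_2\rangle=b_2^*\,\overline\varphi(a_2^*a_1)\,b_1$ for every $a_1,a_2\in\overline{\mathcal N}_\varphi$ and $b_1,b_2\in B$. Consequently, $(E,\overline\Lambda,\overline\pi)$ is a KSGNS-construction for $\overline\varphi$. -/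

import Mathlib

open Filter Topology
open scoped MultiplierAlgebra

set_option linter.unusedSectionVars false

noncomputable section

namespace CStarWeights

/-! ### The multiplier algebra: order, strict topology

`𝓜(ℂ, A)` is Mathlib's C⋆-algebra of double centralizers `m = (m.fst, m.snd)`; `m.fst b` is the
product `m b` and `m.snd b` is the product `b m` (both in `A`). -/

section Multiplier

variable (A : Type*) [NonUnitalCStarAlgebra A]

/-- The usual order of the C⋆-algebra `M(A)` (positive elements: selfadjoint with nonnegative
spectrum, equivalently of the form `y⋆ y`). -/
instance multiplierPartialOrder : PartialOrder 𝓜(ℂ, A) := CStarAlgebra.spectralOrder _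

instance multiplierStarOrderedRing : StarOrderedRing 𝓜(ℂ, A) :=
  CStarAlgebra.spectralOrderedRing _

/-- The strict topology on `M(A)`: the coarsest one for which all the maps `m ↦ m b`, `m ↦ b m`
with `b ∈ A` are continuous into the norm topology of `A`. -/
@[reducible] def strictTopology : TopologicalSpace 𝓜(ℂ, A) :=
  TopologicalSpace.induced
    (fun m : 𝓜(ℂ, A) => ((fun b => m.fst b, fun b => m.snd b) : (A → A) × (A → A))) inferInstance

/-- The strict topology on `A ⊆ M(A)`. -/
@[reducible] def strictTopologyOn : TopologicalSpace A :=
  TopologicalSpace.induced (fun a : A => (a : 𝓜(ℂ, A))) (strictTopology A)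

variable {A}

/-- `f i → m` strictly along `l`. -/
def StrictTendsto {ι : Type*} (f : ι → 𝓜(ℂ, A)) (l : Filter ι) (m : 𝓜(ℂ, A)) : Prop :=
  Tendsto f l (@nhds _ (strictTopology A) m)

theorem strictTendsto_iff {ι : Type*} {f : ι → 𝓜(ℂ, A)} {l : Filter ι} {m : 𝓜(ℂ, A)} :
    StrictTendsto f l m ↔ ∀ b : A,
      Tendsto (fun i => (f i).fst b) l (𝓝 (m.fst b)) ∧
      Tendsto (fun i => (f i).snd b) l (𝓝 (m.snd b)) := by
  unfold StrictTendsto strictTopology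
  rw [nhds_induced, tendsto_comap_iff, nhds_prod_eq, tendsto_prod_iff', tendsto_pi_nhds,
    tendsto_pi_nhds]
  exact forall_and.symm

end Multiplier

/-! ### Hilbert C⋆-modules and adjointable maps

Mathlib's `CStarModule B E` is a left Hilbert `B`-module. A right Hilbert `B`-module is a left
Hilbert module over the opposite algebra, so it is a complete `CStarModule Bᵐᵒᵖ E`; the right
multiplication `x b` is `MulOpposite.op b • x`. -/

section Module

variable {B : Type*} [NonUnitalCStarAlgebra B] [PartialOrder B] [StarOrderedRing B]

/-- The `B`-valued inner product of a right Hilbert `B`-module, linear in the first variable. -/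
def ip (B : Type*) [NonUnitalCStarAlgebra B] [PartialOrder B]
    {E : Type*} [NormedAddCommGroup E] [NormedSpace ℂ E] [SMul Bᵐᵒᵖ E] [CStarModule Bᵐᵒᵖ E]
    (x y : E) : B :=
  MulOpposite.unop (inner Bᵐᵒᵖ y x)

/-- `B` as a right Hilbert module over itself: `⟨x, y⟩ = y⋆ x` (see `ip_self`). -/
instance selfModule : CStarModule Bᵐᵒᵖ B where
  inner x y := MulOpposite.op (star x * y)
  inner_add_right {x y z} := by simp [mul_add]
  inner_self_nonneg {x} := star_mul_self_nonneg x
  inner_self {x} := by simp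
  inner_op_smul_right {a x y} := by
    apply MulOpposite.unop_injective
    simp [mul_assoc]
  inner_smul_right_complex {z x y} := by
    rw [mul_smul_comm, MulOpposite.op_smul]
  star_inner x y := by simp [← MulOpposite.op_star]
  norm_eq_sqrt_norm_inner_self x := by
    rw [MulOpposite.norm_op, CStarRing.norm_star_mul_self, Real.sqrt_mul_self (norm_nonneg x)]

theorem ip_self (x y : B) : ip B x y = star y * x := rfl

variable {E : Type*} [NormedAddCommGroup E] [NormedSpace ℂ E] [SMul Bᵐᵒᵖ E] [CStarModule Bᵐᵒᵖ E]
variable {F : Type*} [NormedAddCommGroup F] [NormedSpace ℂ F] [SMul Bᵐᵒᵖ F] [CStarModule Bᵐᵒᵖ F]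

theorem ip_op_smul_left (b : B) (x y : E) :
    ip B (MulOpposite.op b • x) y = ip B x y * b := by
  simp [ip]

theorem ip_add_left (x y z : E) : ip B (x + y) z = ip B x z + ip B y z := by
  simp [ip]

theorem ip_add_right (x y z : E) : ip B x (y + z) = ip B x y + ip B x z := by
  simp [ip]

theorem ip_smul_left (c : ℂ) (x y : E) : ip B (c • x) y = c • ip B x y := by
  simp [ip]

theorem ip_smul_right (c : ℂ) (x y : E) : ip B x (c • y) = star c • ip B x y := by
  simp [ip]

variable (B E F) in
/-- `𝓛(E, F)`: the linear maps `t : E → F` that have an adjoint. -/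
def Adj : Submodule ℂ (E →ₗ[ℂ] F) where
  carrier := {t | ∃ s : F → E, ∀ x y, ip B (t x) y = ip B x (s y)}
  add_mem' := by
    rintro t t' ⟨s, hs⟩ ⟨s', hs'⟩
    exact ⟨fun y => s y + s' y, fun x y => by
      rw [LinearMap.add_apply, ip_add_left, ip_add_right, hs, hs']⟩
  zero_mem' := ⟨fun _ => 0, fun x y => by simp [ip]⟩
  smul_mem' := by
    rintro c t ⟨s, hs⟩
    exact ⟨fun y => star c • s y, fun x y => by
      rw [LinearMap.smul_apply, ip_smul_left, ip_smul_right, hs, star_star]⟩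

/-- Positivity of an adjointable operator, `T ∈ 𝓛(E)⁺`: as for operators on Hilbert spaces, `⟨T v, v⟩ ≥ 0`
for every `v`. -/
def IsPos (T : Adj B E E) : Prop := ∀ v : E, 0 ≤ ip B (T.1 v) v

/-- `T ≤ 1` in `𝓛(E)`, i.e. `1 - T` is positive. -/
def LeOne (T : Adj B E E) : Prop := ∀ v : E, ip B (T.1 v) v ≤ ip B v v

variable (B E) in
/-- A ⋆-homomorphism `π : C → 𝓛(E)`: an algebra homomorphism such that each `π c` is adjointable
with adjoint `π c⋆`. -/
structure StarRep (C : Type*) [NonUnitalCStarAlgebra C] where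
  toHom : C →ₙₐ[ℂ] Module.End ℂ E
  adjoint : ∀ (c : C) (v w : E), ip B (toHom c v) w = ip B v (toHom (star c) w)

variable (B E) in
/-- The topology of pointwise norm convergence on the space `L(B, E)` of all linear maps. -/
@[reducible] def strongTopology : TopologicalSpace (B →ₗ[ℂ] E) :=
  TopologicalSpace.induced (fun t : B →ₗ[ℂ] E => (fun b => t b : B → E)) inferInstance

/-- Closure in `M(A) × L(B, E)` for the product of the strict and the strong topology. -/
def strictStrongClosure {A : Type*} [NonUnitalCStarAlgebra A]
    (S : Set (𝓜(ℂ, A) × (B →ₗ[ℂ] E))) : Set (𝓜(ℂ, A) × (B →ₗ[ℂ] E)) :=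
  @closure _ (@instTopologicalSpaceProd _ _ (strictTopology A) (strongTopology B E)) S

end Module

/-! ### C⋆-valued weights -/

section Weight

/-- A hereditary cone in `C⁺`. -/
structure HereditaryCone (C : Type*) [NonUnitalCStarAlgebra C] [PartialOrder C] where
  carrier : Set C
  nonneg : ∀ x ∈ carrier, 0 ≤ x
  zero_mem : 0 ∈ carrier
  add_mem : ∀ x ∈ carrier, ∀ y ∈ carrier, x + y ∈ carrier
  smul_mem : ∀ (r : ℝ), 0 ≤ r → ∀ x ∈ carrier, r • x ∈ carrier
  hereditary : ∀ x ∈ carrier, ∀ y, 0 ≤ y → y ≤ x → y ∈ carrier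

namespace HereditaryCone

variable {C : Type*} [NonUnitalCStarAlgebra C] [PartialOrder C] [StarOrderedRing C]
  (P : HereditaryCone C)

theorem star_add_mul_add_mem {x y : C} (hx : star x * x ∈ P.carrier)
    (hy : star y * y ∈ P.carrier) : star (x + y) * (x + y) ∈ P.carrier := by
  refine P.hereditary _ (P.add_mem _ (P.smul_mem 2 (by norm_num) _ hx) _
    (P.smul_mem 2 (by norm_num) _ hy)) _ (star_mul_self_nonneg _) ?_
  have h : (2 : ℝ) • (star x * x) + (2 : ℝ) • (star y * y) - star (x + y) * (x + y)
      = star (x - y) * (x - y) := by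
    simp only [star_add, star_sub, add_mul, mul_add, sub_mul, mul_sub, two_smul]
    abel
  rw [← sub_nonneg, h]
  exact star_mul_self_nonneg _

theorem star_smul_mul_smul_mem (c : ℂ) {x : C} (hx : star x * x ∈ P.carrier) :
    star (c • x) * (c • x) ∈ P.carrier := by
  have h : star (c • x) * (c • x) = (‖c‖ ^ 2 : ℝ) • (star x * x) := by
    rw [star_smul, smul_mul_smul_comm, ← Complex.coe_smul]
    congr 1
    simpa using Complex.conj_mul' c
  rw [h]
  exact P.smul_mem _ (by positivity) _ hx

/-- `N = {a | a⋆ a ∈ P}`. -/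
def N : Submodule ℂ C where
  carrier := {a | star a * a ∈ P.carrier}
  add_mem' hx hy := P.star_add_mul_add_mem hx hy
  zero_mem' := by simpa using P.zero_mem
  smul_mem' c _ hx := P.star_smul_mul_smul_mem c hx

/-- `M = span P`. -/
def M : Submodule ℂ C := Submodule.span ℂ P.carrier

/-- `N` is a left ideal. -/
theorem mul_mem (x : C) {a : C} (ha : a ∈ P.N) : x * a ∈ P.N := by
  have h := CStarAlgebra.star_left_conjugate_le_norm_smul (a := a) (b := star x * x)
  refine P.hereditary _ (P.smul_mem ‖star x * x‖ (norm_nonneg _) _ ha) _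
    (star_mul_self_nonneg _) ?_
  simpa [mul_assoc] using h

/-- `N⋆ N ⊆ M`, by polarization. -/
theorem star_mul_mem {x y : C} (hx : x ∈ P.N) (hy : y ∈ P.N) : star y * x ∈ P.M := by
  have key : ∀ c : ℂ, star (x + c • y) * (x + c • y) ∈ P.M := fun c =>
    Submodule.subset_span (P.N.add_mem hx (P.N.smul_mem c hy))
  have h : star y * x = (4⁻¹ : ℂ) • (star (x + (1 : ℂ) • y) * (x + (1 : ℂ) • y)
      - star (x + (-1 : ℂ) • y) * (x + (-1 : ℂ) • y)
      + Complex.I • (star (x + Complex.I • y) * (x + Complex.I • y))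
      - Complex.I • (star (x + (-Complex.I) • y) * (x + (-Complex.I) • y))) := by
    have e : ∀ c : ℂ, star (x + c • y) * (x + c • y) = star x * x + c • (star x * y)
        + star c • (star y * x) + (star c * c) • (star y * y) := fun c => by
      simp only [star_add, star_smul, add_mul, mul_add, smul_mul_assoc, mul_smul_comm]
      rw [smul_add, smul_smul, mul_comm c]
      abel
    simp only [e]
    match_scalars <;> simp <;> ring_nf
  rw [h]
  exact P.M.smul_mem _ (P.M.sub_mem (P.M.add_mem (P.M.sub_mem (key _) (key _))
    (P.M.smul_mem _ (key _))) (P.M.smul_mem _ (key _)))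

end HereditaryCone

/-- A C⋆-valued weight `φ` from `C` into `M(B)`. Here `φ.cone` is `M_φ⁺`, `φ.cone.N` is `N_φ` and
`φ.cone.M = span M_φ⁺` is the domain `M_φ`. -/
structure CStarValuedWeight (C B : Type*) [NonUnitalCStarAlgebra C] [PartialOrder C]
    [StarOrderedRing C] [NonUnitalCStarAlgebra B] [PartialOrder B] where
  cone : HereditaryCone C
  toFun : cone.M →ₗ[ℂ] 𝓜(ℂ, B)
  completelyPositive : ∀ (n : ℕ) (a : Fin n → cone.N) (b : Fin n → B),
    0 ≤ ∑ i, ∑ j,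
      star (b j) * (toFun ⟨star (a j : C) * a i, cone.star_mul_mem (a i).2 (a j).2⟩).fst (b i)

variable {C : Type*} [NonUnitalCStarAlgebra C] [PartialOrder C] [StarOrderedRing C]
variable {A : Type*} [NonUnitalCStarAlgebra A] [PartialOrder A] [StarOrderedRing A]
variable {B : Type*} [NonUnitalCStarAlgebra B] [PartialOrder B] [StarOrderedRing B]
variable {E : Type*} [NormedAddCommGroup E] [NormedSpace ℂ E] [SMul Bᵐᵒᵖ E] [CStarModule Bᵐᵒᵖ E]

/-- `φ(a₂⋆ a₁)` for `a₁, a₂ ∈ N_φ`. -/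
def CStarValuedWeight.sesq (φ : CStarValuedWeight C B) (a₂ a₁ : φ.cone.N) : 𝓜(ℂ, B) :=
  φ.toFun ⟨star (a₂ : C) * a₁, φ.cone.star_mul_mem a₁.2 a₂.2⟩

/-- `φ` is densely defined. -/
def CStarValuedWeight.IsDenselyDefined (φ : CStarValuedWeight C B) : Prop :=
  Dense (φ.cone.M : Set C)

/-- `(E, Λ, π)` is a KSGNS-construction for `φ`. -/
structure IsKSGNS (φ : CStarValuedWeight C B) (Λ : φ.cone.N →ₗ[ℂ] Adj B B E)
    (π : StarRep B E C) : Prop where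
  dense : Dense (Submodule.span ℂ {v : E | ∃ (a : φ.cone.N) (b : B), v = (Λ a).1 b} : Set E)
  inner_eq : ∀ (a₁ a₂ : φ.cone.N) (b₁ b₂ : B),
    ip B ((Λ a₁).1 b₁) ((Λ a₂).1 b₂) = star b₂ * (φ.sesq a₂ a₁).fst b₁
  rep_apply : ∀ (x : C) (a : φ.cone.N) (b : B),
    π.toHom x ((Λ a).1 b) = (Λ ⟨x * a, φ.cone.mul_mem x a.2⟩).1 b

/-! ### Strict completely positive maps -/

/-- Complete positivity of a linear map `ρ : C → M(B)`:
`∑ᵢⱼ bⱼ⋆ ρ(aⱼ⋆ aᵢ) bᵢ ≥ 0` for all finite families `aᵢ ∈ C`, `bᵢ ∈ B`. -/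
def IsCP (ρ : C →ₗ[ℂ] 𝓜(ℂ, B)) : Prop :=
  ∀ (n : ℕ) (a : Fin n → C) (b : Fin n → B),
    0 ≤ ∑ i, ∑ j, star (b j) * (ρ (star (a j) * a i)).fst (b i)

/-- `ρ : A → M(B)` is strict: strictly continuous on bounded sets. -/
def IsStrict (ρ : A →ₗ[ℂ] 𝓜(ℂ, B)) : Prop :=
  ∀ S : Set A, Bornology.IsBounded S →
    @ContinuousOn _ _ (strictTopologyOn A) (strictTopology B) (fun a => ρ a) S

/-- `ρ' : M(A) → M(B)` is a completely positive extension of `ρ : A → M(B)` that is strictly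
continuous on bounded sets. -/
structure IsStrictExtension (ρ : A →ₗ[ℂ] 𝓜(ℂ, B)) (ρ' : 𝓜(ℂ, A) →ₗ[ℂ] 𝓜(ℂ, B)) : Prop where
  extends_eq : ∀ a : A, ρ' (a : 𝓜(ℂ, A)) = ρ a
  isCP : IsCP ρ'
  continuousOn : ∀ S : Set 𝓜(ℂ, A), Bornology.IsBounded S →
    @ContinuousOn _ _ (strictTopology A) (strictTopology B) (fun x => ρ' x) S

open Classical in
/-- The extension to `M(A)` of a strict completely positive map `ρ : A → M(B)`, which is unique;
the value `0` is a default for maps without an extension. -/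
def strictExtension (ρ : A →ₗ[ℂ] 𝓜(ℂ, B)) : 𝓜(ℂ, A) →ₗ[ℂ] 𝓜(ℂ, B) :=
  if h : ∃ ρ' : 𝓜(ℂ, A) →ₗ[ℂ] 𝓜(ℂ, B), IsStrictExtension ρ ρ' then h.choose else 0

/-! ### The sets `𝓗`, `𝓕`, `𝓖` and lower semi-continuity -/

section Nets

variable {N : Submodule ℂ A} (Λ : N →ₗ[ℂ] Adj B B E)

/-- `T ∈ 𝓛(E)⁺` satisfies `b₂⋆ ρ(a₂⋆ a₁) b₁ = ⟨T Λ(a₁) b₁, Λ(a₂) b₂⟩`. -/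
def Implements (ρ : A →ₗ[ℂ] 𝓜(ℂ, B)) (T : Adj B E E) : Prop :=
  IsPos T ∧ ∀ (a₁ a₂ : N) (b₁ b₂ : B),
    star b₂ * (ρ (star (a₂ : A) * a₁)).fst b₁ = ip B (T.1 ((Λ a₁).1 b₁)) ((Λ a₂).1 b₂)

/-- `𝓗`: the strict completely positive maps implemented by some `T = T_ρ ∈ 𝓛(E)⁺`. -/
def setH : Set (A →ₗ[ℂ] 𝓜(ℂ, B)) :=
  {ρ | IsCP ρ ∧ IsStrict ρ ∧ ∃ T : Adj B E E, Implements Λ ρ T}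

/-- `𝓕 = {ρ ∈ 𝓗 | T_ρ ≤ 1}`. -/
def setF : Set (A →ₗ[ℂ] 𝓜(ℂ, B)) :=
  {ρ | ρ ∈ setH Λ ∧ ∃ T : Adj B E E, Implements Λ ρ T ∧ LeOne T}

/-- `𝓖 = {c ρ | c ∈ [0, 1), ρ ∈ 𝓕}`, as a type. -/
def GType : Type _ :=
  {ρ : A →ₗ[ℂ] 𝓜(ℂ, B) // ∃ c : ℝ, 0 ≤ c ∧ c < 1 ∧ ∃ σ ∈ setF Λ, ρ = (c : ℂ) • σ}

/-- `ρ₁ ≤ ρ₂` in `𝓖` when `ρ₂ - ρ₁` is completely positive. -/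
instance GType.instPreorder : Preorder (GType Λ) where
  le ρ₁ ρ₂ := IsCP (ρ₂.1 - ρ₁.1)
  le_refl ρ n a b := by simp
  le_trans ρ₁ ρ₂ ρ₃ h₁₂ h₂₃ n a b := by
    have h := add_nonneg (h₁₂ n a b) (h₂₃ n a b)
    simp only [LinearMap.sub_apply, DoubleCentralizer.sub_fst, sub_apply,
      mul_sub, ← Finset.sum_add_distrib] at h ⊢
    convert h using 4
    abel

end Nets

/-- Lower semi-continuity of a weight `φ` with KSGNS-construction `(E, Λ, π)`: `M_φ⁺` consists of
the `x ∈ A⁺` for which the net `(ρ(x))_{ρ ∈ 𝓖}` is strictly convergent in `M(B)`, and `φ(x)` is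
its strict limit. -/
structure IsLowerSemicontinuous (φ : CStarValuedWeight A B) (Λ : φ.cone.N →ₗ[ℂ] Adj B B E) :
    Prop where
  mem_iff : ∀ x : A, x ∈ φ.cone.carrier ↔
    0 ≤ x ∧ ∃ m : 𝓜(ℂ, B), StrictTendsto (fun ρ : GType Λ => ρ.1 x) atTop m
  tendsto : ∀ x : φ.cone.M, (x : A) ∈ φ.cone.carrier →
    StrictTendsto (fun ρ : GType Λ => ρ.1 (x : A)) atTop (φ.toFun x)

/-- `ψ` is the extension `φ̄` of `φ` to `M(A)` that is defined by strict limits over `𝓖`. -/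
structure IsMultiplierExtension {φ : CStarValuedWeight A B} (Λ : φ.cone.N →ₗ[ℂ] Adj B B E)
    (ψ : CStarValuedWeight 𝓜(ℂ, A) B) : Prop where
  mem_iff : ∀ x : 𝓜(ℂ, A), x ∈ ψ.cone.carrier ↔
    0 ≤ x ∧ ∀ b : B, ∃ y : B,
      Tendsto (fun ρ : GType Λ => star b * (strictExtension ρ.1 x).fst b) atTop (𝓝 y)
  tendsto : ∀ x : ψ.cone.M,
    StrictTendsto (fun ρ : GType Λ => strictExtension ρ.1 (x : 𝓜(ℂ, A))) atTop (ψ.toFun x)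

/-- The graph of `Λ : N_φ → 𝓛(B, E)` in `M(A) × L(B, E)`, for a weight `φ` on `A`. -/
def graphInMultiplier {φ : CStarValuedWeight A B} (Λ : φ.cone.N →ₗ[ℂ] Adj B B E) :
    Set (𝓜(ℂ, A) × (B →ₗ[ℂ] E)) :=
  {p | ∃ a : φ.cone.N, p = (((a : A) : 𝓜(ℂ, A)), (Λ a).1)}

/-- The graph of `Λ : N_ψ → 𝓛(B, E)` in `C × L(B, E)`, for a weight `ψ` on `C`. -/
def graph {ψ : CStarValuedWeight C B} (Λ : ψ.cone.N →ₗ[ℂ] Adj B B E) :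
    Set (C × (B →ₗ[ℂ] E)) :=
  {p | ∃ a : ψ.cone.N, p = ((a : C), (Λ a).1)}

end Weight

end CStarWeights

end

namespace CStarWeights

/-! ### Inner products and adjointable maps -/

section InnerProduct

variable {B : Type*} [NonUnitalCStarAlgebra B] [PartialOrder B] [StarOrderedRing B]
variable {E : Type*} [NormedAddCommGroup E] [NormedSpace ℂ E] [SMul Bᵐᵒᵖ E] [CStarModule Bᵐᵒᵖ E]
variable {F : Type*} [NormedAddCommGroup F] [NormedSpace ℂ F] [SMul Bᵐᵒᵖ F] [CStarModule Bᵐᵒᵖ F]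

/-! Each `g` in 𝓖 is implemented by an operator T_g with 0 ≤ T_g ≤ 1, and T_g commutes with π(A).
The algebra A need not have a unit, but strictness of `g` produces the vectors that T_g^{1/2} Λ(1) b
would be. Since ‖T_g^{1/2} Λ(a) b‖² = ‖b⋆ g(a⋆a) b‖, the vectors T_g^{1/2} Λ(f_i) b are Cauchy along
a bounded net in N_φ that tends strictly to 1. Their limit v_g b satisfies π(a) v_g b = T_g^{1/2}
Λ(a) b (`exists_sqrt_vector`).

Two facts make the net usable. It is directed (`GType.exists_ge`), by functional calculus with s ↦ s
(1 + s)⁻¹. Lower semi-continuity forces T_g → 1 strongly (`tendsto_op`). Hence π is nondegenerate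
(`dense_repRange`) and has a unique extension π̄ to M(A). Moreover v_g is then adjointable and `g` =
v_g⋆ π(·) v_g (`exists_vec`), so the strict extension of `g` is v_g⋆ π̄(·) v_g.

For x = y⋆y in the cone of φ̄, convergence of all the nets b⋆ g(x) b bounds the maps π̄(y) v_g
pointwise. Banach–Steinhaus bounds them uniformly, and a bounded increasing net whose forms b⋆ g(x)
b converge is strictly convergent (`exists_strictTendsto_of_mem_barCone`). This defines φ̄.

The vector Λ̄(a) b is characterized by T_g^{1/2} Λ̄(a) b = π̄(a) v_g b for all `g`; it is unique
because T_g → 1 (`eq_of_sqrt_op_apply`). It exists as the limit of Λ(ea) b along the approximate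
unit, because (ea)⋆(ea) ≤ a⋆a makes T_g Λ(ea) b close to Λ(ea) b uniformly in e
(`exists_barLambda_apply`). Linearity, adjointability, the module property and the inner product
formula are read off from the characterization. So is closedness of the graph, since the
characterization survives strict-strong limits (`graph_eq_strictStrongClosure`). -/

theorem star_ip (x y : E) : star (ip B x y) = ip B y x := by
  simp [ip, ← MulOpposite.unop_star]

theorem ip_self_nonneg (x : E) : 0 ≤ ip B x x :=
  MulOpposite.unop_nonneg.2 CStarModule.inner_self_nonneg

theorem ip_self_eq_zero {x : E} : ip B x x = 0 ↔ x = 0 := by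
  simp [ip, CStarModule.inner_self]

theorem ip_sub_left (x y z : E) : ip B (x - y) z = ip B x z - ip B y z := by
  simp [ip]

theorem ip_sub_right (x y z : E) : ip B x (y - z) = ip B x y - ip B x z := by
  simp [ip]

@[simp] theorem ip_zero_left (x : E) : ip B 0 x = 0 := by
  simp [ip]

@[simp] theorem ip_zero_right (x : E) : ip B x 0 = 0 := by
  simp [ip]

theorem ip_sum_left {ι : Type*} (s : Finset ι) (f : ι → E) (y : E) :
    ip B (∑ i ∈ s, f i) y = ∑ i ∈ s, ip B (f i) y := by
  simp [ip]

theorem ip_sum_right {ι : Type*} (s : Finset ι) (f : ι → E) (y : E) :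
    ip B y (∑ i ∈ s, f i) = ∑ i ∈ s, ip B y (f i) := by
  simp [ip]

variable (B) in
theorem norm_ip_le (x y : E) : ‖ip B x y‖ ≤ ‖x‖ * ‖y‖ := by
  rw [mul_comm]
  exact CStarModule.norm_inner_le (A := Bᵐᵒᵖ) E

variable (B) in
theorem norm_sq_eq_norm_ip (x : E) : ‖x‖ ^ 2 = ‖ip B x x‖ :=
  CStarModule.norm_sq_eq Bᵐᵒᵖ

variable (B) in
theorem continuous_ip : Continuous (fun p : E × E => ip B p.1 p.2) :=
  MulOpposite.continuous_unop.comp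
    ((CStarModule.continuous_inner (A := Bᵐᵒᵖ) (E := E)).comp continuous_swap)

variable (B) in
theorem tendsto_ip {ι : Type*} {l : Filter ι} {f g : ι → E} {x y : E} (hf : Tendsto f l (𝓝 x))
    (hg : Tendsto g l (𝓝 y)) : Tendsto (fun i => ip B (f i) (g i)) l (𝓝 (ip B x y)) :=
  ((continuous_ip B).tendsto (x, y)).comp (hf.prodMk_nhds hg)

/-- The vectors on which two given vectors have the same inner product form a closed subspace. -/
theorem ip_eq_of_dense {S : Set E} (hS : Dense (Submodule.span ℂ S : Set E)) {x x' : E}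
    (h : ∀ y ∈ S, ip B x y = ip B x' y) (y : E) : ip B x y = ip B x' y := by
  have h1 : ∀ y ∈ Submodule.span ℂ S, ip B x y = ip B x' y := by
    intro y hy
    induction hy using Submodule.span_induction with
    | mem y hy => exact h y hy
    | zero => simp
    | add y z _ _ hy hz => rw [ip_add_right, ip_add_right, hy, hz]
    | smul c y _ hy => rw [ip_smul_right, ip_smul_right, hy]
  have hc : ∀ x : E, Continuous (fun y => ip B x y) := fun x =>
    (continuous_ip B).comp (by fun_prop : Continuous fun y => (x, y))
  exact congrFun (Continuous.ext_on hS (hc x) (hc x') h1) y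

theorem eq_of_forall_ip {x x' : E} (h : ∀ y, ip B x y = ip B x' y) : x = x' := by
  rw [← sub_eq_zero, ← ip_self_eq_zero (B := B), ip_sub_left, h, sub_self]

variable (B) in
theorem eq_of_dense {S : Set E} (hS : Dense (Submodule.span ℂ S : Set E)) {x x' : E}
    (h : ∀ y ∈ S, ip B x y = ip B x' y) : x = x' :=
  eq_of_forall_ip (ip_eq_of_dense hS h)

/-- A linear map with an adjoint on a dense subspace is continuous. -/
theorem continuous_of_adjoint_on_dense [CompleteSpace E] [CompleteSpace F] (t : E →ₗ[ℂ] F)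
    {S : Set F} (hS : Dense (Submodule.span ℂ S : Set F))
    (h : ∀ y ∈ S, ∃ z, ∀ x, ip B (t x) y = ip B x z) : Continuous t := by
  refine t.continuous_of_seq_closed_graph fun u x y hu hy => eq_of_dense B hS fun w hw => ?_
  obtain ⟨z, hz⟩ := h w hw
  refine tendsto_nhds_unique (tendsto_ip B hy tendsto_const_nhds) ?_
  simp only [Function.comp_apply, hz]
  exact tendsto_ip B hu tendsto_const_nhds

/-- A linear map with an adjoint on a dense subspace is adjointable. -/
theorem mem_Adj_of_dense [CompleteSpace E] [CompleteSpace F] (t : E →ₗ[ℂ] F)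
    {S : Set F} (hS : Dense (Submodule.span ℂ S : Set F))
    (h : ∀ y ∈ S, ∃ z, ∀ x, ip B (t x) y = ip B x z) : t ∈ Adj B E F := by
  let T : E →L[ℂ] F := ⟨t, continuous_of_adjoint_on_dense t hS h⟩
  let K : Submodule ℂ F :=
    { carrier := {y | ∃ z, ∀ x, ip B (T x) y = ip B x z}
      add_mem' := by
        rintro y y' ⟨z, hz⟩ ⟨z', hz'⟩
        exact ⟨z + z', fun x => by rw [ip_add_right, ip_add_right, hz, hz']⟩
      zero_mem' := ⟨0, fun x => by simp⟩
      smul_mem' := by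
        rintro c y ⟨z, hz⟩
        exact ⟨c • z, fun x => by rw [ip_smul_right, ip_smul_right, hz]⟩ }
  have hK : Submodule.span ℂ S ≤ K := Submodule.span_le.2 h
  have hKd : Dense (K : Set F) := hS.mono hK
  -- Taking x = z gives ‖z‖² ≤ ‖T‖ ‖z‖ ‖y‖. With this bound the adjoint vectors of a convergent
  -- sequence are Cauchy, so `K` is closed.
  have bound : ∀ y z, (∀ x, ip B (T x) y = ip B x z) → ‖z‖ ≤ ‖T‖ * ‖y‖ := by
    intro y z hz
    have h1 : ‖z‖ * ‖z‖ ≤ (‖T‖ * ‖y‖) * ‖z‖ := by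
      rw [← sq, norm_sq_eq_norm_ip B, ← hz]
      refine (norm_ip_le B _ _).trans ?_
      calc ‖T z‖ * ‖y‖ ≤ (‖T‖ * ‖z‖) * ‖y‖ := by gcongr; exact T.le_opNorm z
        _ = _ := by ring
    rcases (norm_nonneg z).eq_or_lt with h0 | h0
    · rw [← h0]; positivity
    · exact le_of_mul_le_mul_right h1 h0
  have hKc : ∀ y, y ∈ K := by
    intro y
    obtain ⟨u, hu, huy⟩ := mem_closure_iff_seq_limit.1 (hKd y)
    choose z hz using hu
    have hc : CauchySeq z := by
      have huc : CauchySeq fun n => (‖T‖ : ℝ) • u n := by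
        exact (huy.const_smul (‖T‖ : ℝ)).cauchySeq
      rw [Metric.cauchySeq_iff] at huc ⊢
      intro ε hε
      obtain ⟨N, hN⟩ := huc ε hε
      refine ⟨N, fun m hm n hn => lt_of_le_of_lt ?_ (hN m hm n hn)⟩
      rw [dist_eq_norm, dist_eq_norm, ← smul_sub, norm_smul, norm_norm]
      exact bound _ _ fun x => by rw [ip_sub_right, ip_sub_right, hz, hz]
    obtain ⟨w, hw⟩ := cauchySeq_tendsto_of_complete hc
    refine ⟨w, fun x => tendsto_nhds_unique (tendsto_ip B tendsto_const_nhds huy) ?_⟩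
    simp only [hz]
    exact tendsto_ip B tendsto_const_nhds hw
  choose s hs using hKc
  exact ⟨s, fun x y => hs y x⟩

theorem continuous_of_mem_Adj [CompleteSpace E] [CompleteSpace F] (t : Adj B E F) :
    Continuous t.1 := by
  obtain ⟨s, hs⟩ := t.2
  refine continuous_of_adjoint_on_dense (B := B) (S := Set.univ) t.1 ?_ fun y _ =>
    ⟨s y, fun x => hs x y⟩
  simp

/-- The adjoint of an adjointable map. -/
noncomputable def adjoint (t : Adj B E F) : Adj B F E :=
  have h := t.2.choose_spec
  ⟨{ toFun := t.2.choose
     map_add' := fun x y => eq_of_forall_ip (B := B) fun z => by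
      rw [← star_ip, ← h, ip_add_right, ip_add_left, star_add, star_ip, star_ip, ← star_ip z,
        ← star_ip z (t.2.choose y), ← h, ← h, star_ip, star_ip]
     map_smul' := fun c x => eq_of_forall_ip (B := B) fun z => by
      rw [← star_ip, ← h, ip_smul_right, RingHom.id_apply, ip_smul_left, star_smul, star_star,
        ← star_ip z, ← h] }, t.1, fun x y => by
      have := congrArg star (h y x)
      rw [star_ip, star_ip] at this
      exact this.symm⟩

theorem ip_adjoint_right (t : Adj B E F) (x : E) (y : F) :
    ip B x ((adjoint t).1 y) = ip B (t.1 x) y :=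
  (t.2.choose_spec x y).symm

theorem ip_adjoint_left (t : Adj B E F) (x : E) (y : F) :
    ip B ((adjoint t).1 y) x = ip B y (t.1 x) := by
  rw [← star_ip, ip_adjoint_right, star_ip]

end InnerProduct

/-! ### The C⋆-algebra of adjointable operators -/

section Op

variable (B : Type*) [NonUnitalCStarAlgebra B] [PartialOrder B] [StarOrderedRing B]
variable (E : Type*) [NormedAddCommGroup E] [NormedSpace ℂ E] [SMul Bᵐᵒᵖ E] [CStarModule Bᵐᵒᵖ E]

/-- The bounded adjointable operators, as a subalgebra of the algebra of bounded operators. -/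
def opSubalgebra : Subalgebra ℂ (E →L[ℂ] E) where
  carrier := {t | ∃ s : E →L[ℂ] E, ∀ x y, ip B (t x) y = ip B x (s y)}
  mul_mem' := by
    rintro t t' ⟨s, hs⟩ ⟨s', hs'⟩
    exact ⟨s' * s, fun x y => by simp [hs, hs']⟩
  add_mem' := by
    rintro t t' ⟨s, hs⟩ ⟨s', hs'⟩
    exact ⟨s + s', fun x y => by simp [hs, hs', ip_add_left, ip_add_right]⟩
  algebraMap_mem' c := ⟨star c • 1, fun x y => by
    simp [Algebra.algebraMap_eq_smul_one, ip_smul_left, ip_smul_right]⟩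

/-- The algebra `𝓛(E)`. -/
abbrev Op : Type _ := opSubalgebra B E

variable {B E}

/-- The chosen adjoint is the only one, since the inner product is definite; `Op.star_eq` identifies
it. -/
noncomputable instance : Star (Op B E) where
  star t := ⟨t.2.choose, t.1, fun x y => by
    have := congrArg star (t.2.choose_spec y x)
    rw [star_ip, star_ip] at this
    exact this.symm⟩

theorem Op.ip_star_right (t : Op B E) (x y : E) :
    ip B x ((star t).1 y) = ip B (t.1 x) y :=
  (t.2.choose_spec x y).symm

theorem Op.ip_star_left (t : Op B E) (x y : E) :
    ip B ((star t).1 x) y = ip B x (t.1 y) := by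
  rw [← star_ip, ip_star_right, star_ip]

theorem Op.ext_ip {s t : Op B E} (h : ∀ x y, ip B (s.1 x) y = ip B (t.1 x) y) : s = t :=
  Subtype.ext (ContinuousLinearMap.ext fun x => eq_of_forall_ip (h x))

theorem Op.star_eq {s t : Op B E} (h : ∀ x y, ip B (t.1 x) y = ip B x (s.1 y)) : star t = s :=
  Op.ext_ip fun x y => by
    rw [Op.ip_star_left, ← star_ip, h, star_ip]

noncomputable instance : StarRing (Op B E) where
  star_involutive t := Op.star_eq fun x y => Op.ip_star_left t x y
  star_mul s t := Op.star_eq fun x y => by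
    simp [Op.ip_star_right]
  star_add s t := Op.star_eq fun x y => by
    simp [Op.ip_star_right, ip_add_left, ip_add_right]

instance : StarModule ℂ (Op B E) where
  star_smul c t := Op.star_eq fun x y => by
    simp [Op.ip_star_right, ip_smul_left, ip_smul_right]

theorem Op.norm_apply_le (t : Op B E) (x : E) : ‖t.1 x‖ ≤ ‖t‖ * ‖x‖ :=
  t.1.le_opNorm x

/-- ‖t x‖² = ‖⟨x, t⋆t x⟩‖ ≤ ‖t⋆t‖ ‖x‖² by Cauchy–Schwarz. -/
instance : CStarRing (Op B E) where
  norm_mul_self_le t := by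
    have h : ‖t‖ ≤ √‖star t * t‖ := by
      refine ContinuousLinearMap.opNorm_le_bound t.1 (Real.sqrt_nonneg _) fun x => ?_
      rw [← abs_of_nonneg (norm_nonneg (t.1 x)), ← Real.sqrt_sq_eq_abs, norm_sq_eq_norm_ip B,
        ← abs_of_nonneg (norm_nonneg x), ← Real.sqrt_sq_eq_abs,
        ← Real.sqrt_mul (norm_nonneg (star t * t))]
      refine Real.sqrt_le_sqrt ?_
      rw [← Op.ip_star_right]
      refine (norm_ip_le B _ _).trans ?_
      have := Op.norm_apply_le (star t * t) x
      calc ‖x‖ * ‖(star t).1 (t.1 x)‖ ≤ ‖x‖ * (‖star t * t‖ * ‖x‖) := by gcongr; exact this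
        _ = _ := by ring
    calc ‖t‖ * ‖t‖ ≤ √‖star t * t‖ * √‖star t * t‖ := by gcongr
      _ = _ := Real.mul_self_sqrt (norm_nonneg _)

/-- The involution is isometric, so the adjoints of a norm convergent sequence converge too, and
their limit is an adjoint of the limit. -/
instance [CompleteSpace E] : CompleteSpace (Op B E) := by
  refine IsClosed.completeSpace_coe (hs := isClosed_of_closure_subset fun t ht => ?_)
  obtain ⟨u, hu, hut⟩ := mem_closure_iff_seq_limit.1 ht
  let U : ℕ → Op B E := fun n => ⟨u n, hu n⟩
  have hc : CauchySeq fun n => (star (U n)).1 := by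
    have h := hut.cauchySeq
    rw [Metric.cauchySeq_iff] at h ⊢
    intro ε hε
    obtain ⟨N, hN⟩ := h ε hε
    refine ⟨N, fun m hm n hn => lt_of_eq_of_lt ?_ (hN m hm n hn)⟩
    rw [dist_eq_norm, dist_eq_norm]
    have h1 : ‖star (U m - U n)‖ = ‖U m - U n‖ := norm_star (U m - U n)
    rw [star_sub] at h1
    exact h1
  obtain ⟨s, hs⟩ := cauchySeq_tendsto_of_complete hc
  refine ⟨s, fun x y => ?_⟩
  have h1 := tendsto_ip B (((ContinuousLinearMap.apply ℂ E x).continuous.tendsto t).comp hut)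
    (tendsto_const_nhds (x := y))
  have h2 := tendsto_ip B (tendsto_const_nhds (x := x))
    (((ContinuousLinearMap.apply ℂ E y).continuous.tendsto s).comp hs)
  refine tendsto_nhds_unique h1 (h2.congr fun n => ?_)
  exact Op.ip_star_right (U n) x y

noncomputable instance [CompleteSpace E] : CStarAlgebra (Op B E) where

noncomputable instance [CompleteSpace E] : PartialOrder (Op B E) := CStarAlgebra.spectralOrder _

instance [CompleteSpace E] : StarOrderedRing (Op B E) := CStarAlgebra.spectralOrderedRing _

end Op

/-! ### Two facts about operator inequalities in unital C⋆-algebras -/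

section CStar

variable {R : Type*} [CStarAlgebra R] [PartialOrder R] [StarOrderedRing R]

theorem commute_sqrt {a b : R} (h : Commute a b) : Commute (CFC.sqrt a) b :=
  h.cfcₙ_nnreal _

/-- If `0 ≤ t ≤ c < 1` and `s ≥ (1 - c)⁻¹ t`, then `t ≤ 1 - (1 + s)⁻¹`. -/
theorem inv_one_add_le_one_sub {t : R} {c : ℝ} (hc : c < 1) (ht0 : 0 ≤ t)
    (ht : t ≤ algebraMap ℝ R c) {u : Rˣ} (hu : 1 + (1 - c)⁻¹ • t ≤ u) : (↑u⁻¹ : R) ≤ 1 - t := by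
  have hk : 0 < 1 - c := by linarith
  have hlow : algebraMap ℝ R (1 - c) ≤ 1 - t := by
    rw [map_sub, map_one]
    exact sub_le_sub_left ht _
  let κ : Rˣ := Units.map (algebraMap ℝ R).toMonoidHom (Units.mk0 (1 - c) hk.ne')
  have hκ : (κ : R) = algebraMap ℝ R (1 - c) := rfl
  have hκi : (↑κ⁻¹ : R) = algebraMap ℝ R (1 - c)⁻¹ := rfl
  have hκ0 : (0 : R) ≤ κ := by
    rw [hκ]; exact algebraMap_nonneg R hk.le
  have hsp : IsStrictlyPositive (κ : R) := ⟨hκ0, κ.isUnit⟩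
  obtain ⟨v, hv⟩ := CStarAlgebra.isUnit_of_le (κ : R) (hκ ▸ hlow) hsp
  have hκv : (κ : R) ≤ v := by rw [hv, hκ]; exact hlow
  have hv0 : (0 : R) ≤ v := hκ0.trans hκv
  have h1 : (↑v⁻¹ : R) ≤ algebraMap ℝ R (1 - c)⁻¹ := hκi ▸ CStarAlgebra.inv_le_inv hκ0 hκv
  have hr0 : 0 ≤ CFC.sqrt t := CFC.sqrt_nonneg t
  have hrr : CFC.sqrt t * CFC.sqrt t = t := CFC.sqrt_mul_sqrt_self t
  have hcomm : Commute (CFC.sqrt t) (v : R) := by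
    rw [hv]
    exact commute_sqrt ((Commute.one_right t).sub_right (Commute.refl t))
  -- Here v = 1 - t, so v⁻¹ = 1 + t^{1/2} v⁻¹ t^{1/2}. Conjugating v⁻¹ ≤ (1 - c)⁻¹ by t^{1/2} gives
  -- v⁻¹ ≤ 1 + (1 - c)⁻¹ t ≤ u, and inversion reverses the order.
  have h2 : (↑v⁻¹ : R) ≤ u := by
    refine le_trans ?_ hu
    have h3 : (↑v⁻¹ : R) = 1 + CFC.sqrt t * ↑v⁻¹ * CFC.sqrt t := by
      have h4 : Commute (CFC.sqrt t) (↑v⁻¹ : R) := hcomm.units_inv_right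
      rw [mul_assoc, ← h4.eq, ← mul_assoc, hrr]
      have h5 : t = 1 - v := by rw [hv]; abel
      rw [h5, sub_mul, one_mul, Units.mul_inv]
      abel
    rw [h3]
    gcongr
    have h6 := star_left_conjugate_le_conjugate h1 (CFC.sqrt t)
    rw [(IsSelfAdjoint.of_nonneg hr0).star_eq] at h6
    refine h6.trans (le_of_eq ?_)
    rw [← Algebra.commutes, mul_assoc, hrr, Algebra.smul_def]
  have h7 := CStarAlgebra.inv_le_inv (CFC.inv_nonneg_of_nonneg v hv0) h2
  rwa [inv_inv, hv] at h7

/-- For positive `s` there is an inverse `q` of `1 + s`, and `0 ≤ 1 - q ≤ c < 1`. -/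
theorem exists_inv_one_add {s : R} (hs : 0 ≤ s) : ∃ u : Rˣ, (u : R) = 1 + s ∧
    (↑u⁻¹ : R) ≤ 1 ∧ ∃ c : ℝ, 0 < c ∧ c < 1 ∧ 1 - (↑u⁻¹ : R) ≤ algebraMap ℝ R c := by
  have h1 : (1 : R) ≤ 1 + s := le_add_of_nonneg_right hs
  obtain ⟨u, hu⟩ := CStarAlgebra.isUnit_of_le (1 : R) h1 ⟨zero_le_one, isUnit_one⟩
  have hu0 : (0 : R) ≤ u := by rw [hu]; exact zero_le_one.trans h1
  refine ⟨u, hu, (CStarAlgebra.inv_le_one_iff_one_le hu0).2 (by rw [← Units.val_le_val, Units.val_one, hu]; exact h1), ?_⟩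
  -- From 1 + s ≤ m follows u⁻¹ ≥ m⁻¹, whence the constant 1 - m⁻¹. The summand 2 in place of 1
  -- keeps it positive when s = 0; it is divided by later.
  set m : ℝ := 2 + ‖s‖ with hm
  have hm0 : 0 < m := by positivity
  have hm2 : 2 ≤ m := by rw [hm]; linarith [norm_nonneg s]
  refine ⟨1 - m⁻¹, ?_, ?_, ?_⟩
  · rw [sub_pos]; exact inv_lt_one_of_one_lt₀ (by linarith)
  · have := inv_pos.2 hm0; linarith
  · let κ : Rˣ := Units.map (algebraMap ℝ R).toMonoidHom (Units.mk0 m hm0.ne')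
    have hκ : (κ : R) = algebraMap ℝ R m := rfl
    have hκi : (↑κ⁻¹ : R) = algebraMap ℝ R m⁻¹ := rfl
    have hle : (u : R) ≤ κ := by
      rw [hu, hκ, hm, map_add]
      refine add_le_add ?_ (IsSelfAdjoint.le_algebraMap_norm_self (.of_nonneg hs))
      rw [← map_one (algebraMap ℝ R)]
      exact algebraMap_mono R (by norm_num)
    have h0 : (0 : R) ≤ u := by rw [hu]; exact zero_le_one.trans h1
    rw [map_sub, map_one]
    exact sub_le_sub_left (hκi ▸ CStarAlgebra.inv_le_inv h0 hle) _

end CStar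

/-! ### Positivity in `𝓛(E)` -/

section Op

variable {B : Type*} [NonUnitalCStarAlgebra B] [PartialOrder B] [StarOrderedRing B]
variable {E : Type*} [NormedAddCommGroup E] [NormedSpace ℂ E] [SMul Bᵐᵒᵖ E] [CStarModule Bᵐᵒᵖ E]

/-- Polarization: x + y gives ⟨ty, x⟩ = -⟨tx, y⟩, and x + iy then gives -2i ⟨tx, y⟩ = 0. -/
theorem Op.eq_zero_of_ip_self {t : Op B E} (h : ∀ x, ip B (t.1 x) x = 0) : t = 0 := by
  refine Op.ext_ip fun x y => ?_
  have h1 := h (x + y)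
  have h2 := h (x + Complex.I • y)
  simp only [map_add, map_smul, ip_add_left, ip_add_right, ip_smul_left, ip_smul_right, h,
    smul_zero, zero_add, add_zero] at h1 h2
  have h3 : ip B (t.1 y) x = - ip B (t.1 x) y := by
    rw [eq_neg_iff_add_eq_zero, add_comm]
    first | exact h1 | rw [add_comm]; exact h1
  rw [h3] at h2
  have h4 : (-2 * Complex.I) • ip B (t.1 x) y = 0 := by
    rw [← h2]
    simp only [RCLike.star_def, Complex.conj_I]
    module
  have h5 : (-2 * Complex.I) ≠ 0 := by simp
  simpa [h5] using h4

variable [CompleteSpace E]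

theorem Op.ip_nonneg {t : Op B E} (ht : 0 ≤ t) (x : E) : 0 ≤ ip B (t.1 x) x := by
  obtain ⟨s, rfl⟩ := CStarAlgebra.nonneg_iff_eq_star_mul_self.1 ht
  have : ip B ((star s * s).1 x) x = ip B (s.1 x) (s.1 x) := Op.ip_star_left s _ _
  rw [this]
  exact ip_self_nonneg _

theorem Op.isSelfAdjoint_of_ip_nonneg {t : Op B E} (ht : ∀ x, 0 ≤ ip B (t.1 x) x) :
    IsSelfAdjoint t := by
  have : star t - t = 0 := Op.eq_zero_of_ip_self fun x => by
    have h1 : ip B ((star t - t).1 x) x = ip B ((star t).1 x) x - ip B (t.1 x) x :=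
      ip_sub_left _ _ _
    rw [h1, Op.ip_star_left, ← star_ip, (IsSelfAdjoint.of_nonneg (ht x)).star_eq, sub_self]
  exact sub_eq_zero.1 this

/-- With n the negative part of t one has n t n = -n³. The hypothesis at the vectors n x gives n³ ≤
0, so n³ = 0 and n = 0. -/
theorem Op.nonneg_of_ip_nonneg {t : Op B E} (ht : ∀ x, 0 ≤ ip B (t.1 x) x) : 0 ≤ t := by
  have hsa := Op.isSelfAdjoint_of_ip_nonneg ht
  set n := t⁻ with hn
  have hn0 : 0 ≤ n := CFC.negPart_nonneg t
  have hnsa : star n = n := (IsSelfAdjoint.of_nonneg hn0).star_eq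
  have htn : n * t * n = -(n * n * n) := by
    conv_lhs => rw [← CFC.posPart_sub_negPart t hsa]
    rw [mul_sub, CFC.negPart_mul_posPart, ← hn]
    simp
  have hcube : 0 ≤ n * n * n := by
    have := star_left_conjugate_nonneg hn0 n
    rwa [hnsa] at this
  have hz : n * n * n = 0 := Op.eq_zero_of_ip_self fun x => by
    refine le_antisymm ?_ (Op.ip_nonneg hcube x)
    have h1 : ip B ((n * t * n).1 x) x = ip B (t.1 (n.1 x)) (n.1 x) := by
      have := Op.ip_star_left n (t.1 (n.1 x)) x
      rw [hnsa] at this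
      exact this
    have h2 : ip B ((n * t * n).1 x) x = - ip B ((n * n * n).1 x) x := by
      rw [htn]
      have h3 : (-(n * n * n)).1 x = 0 - (n * n * n).1 x := by simp
      rw [h3, ip_sub_left, ip_zero_left, zero_sub]
    have h3 := ht (n.1 x)
    rw [← h1, h2] at h3
    exact neg_nonneg.1 h3
  have hn2 : n * n = 0 := by
    rw [← CStarRing.star_mul_self_eq_zero_iff, star_mul, hnsa, ← mul_assoc, hz, zero_mul]
  have hn1 : n = 0 := by
    rw [← CStarRing.star_mul_self_eq_zero_iff, hnsa, hn2]
  rw [← CFC.posPart_sub_negPart t hsa, ← hn, hn1, sub_zero]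
  exact CFC.posPart_nonneg t

theorem Op.le_iff {s t : Op B E} : s ≤ t ↔ ∀ x, ip B (s.1 x) x ≤ ip B (t.1 x) x := by
  have h : ∀ x, ip B ((t - s).1 x) x = ip B (t.1 x) x - ip B (s.1 x) x := fun x =>
    ip_sub_left _ _ _
  rw [← sub_nonneg]
  refine ⟨fun hst x => ?_, fun hst => Op.nonneg_of_ip_nonneg fun x => ?_⟩
  · rw [← sub_nonneg, ← h]
    exact Op.ip_nonneg hst x
  · rw [h, sub_nonneg]
    exact hst x

theorem Op.ip_sqrt_apply {t : Op B E} (ht : 0 ≤ t) (x y : E) :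
    ip B ((CFC.sqrt t).1 x) ((CFC.sqrt t).1 y) = ip B (t.1 x) y := by
  have h := Op.ip_star_left (CFC.sqrt t) ((CFC.sqrt t).1 x) y
  rw [(IsSelfAdjoint.of_nonneg (CFC.sqrt_nonneg t)).star_eq] at h
  rw [← h]
  have h2 : (CFC.sqrt t * CFC.sqrt t).1 x = t.1 x := by rw [CFC.sqrt_mul_sqrt_self t ht]
  rw [← h2]
  rfl

/-- Write t x = t^{1/2} (t^{1/2} x). For bounded nets of positive operators this upgrades
convergence to 0 of the quadratic forms to convergence in norm. -/
theorem Op.norm_apply_sq_le {t : Op B E} (ht : 0 ≤ t) (x : E) :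
    ‖t.1 x‖ ^ 2 ≤ ‖t‖ * ‖ip B (t.1 x) x‖ := by
  have hr : ‖CFC.sqrt t‖ ^ 2 = ‖t‖ := by
    rw [sq, ← CStarRing.norm_star_mul_self,
      (IsSelfAdjoint.of_nonneg (CFC.sqrt_nonneg t)).star_eq, CFC.sqrt_mul_sqrt_self t ht]
  have h2 : (CFC.sqrt t).1 ((CFC.sqrt t).1 x) = t.1 x := by
    conv_rhs => rw [← CFC.sqrt_mul_sqrt_self t ht]
    rfl
  rw [← Op.ip_sqrt_apply ht, ← norm_sq_eq_norm_ip, ← h2, ← hr, ← mul_pow]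
  gcongr
  exact Op.norm_apply_le _ _

/-- An element of `𝓛(E)` as a bounded operator. -/
noncomputable def toOp (t : Adj B E E) : Op B E :=
  ⟨⟨t.1, continuous_of_mem_Adj t⟩, ⟨(adjoint t).1, continuous_of_mem_Adj (adjoint t)⟩,
    fun x y => (ip_adjoint_right t x y).symm⟩

/-- A bounded adjointable operator as an element of `𝓛(E)`. -/
noncomputable def ofOp (t : Op B E) : Adj B E E :=
  ⟨t.1.toLinearMap, (star t).1, fun x y => (Op.ip_star_right t x y).symm⟩

/-- A ⋆-homomorphism into `𝓛(E)`, as a homomorphism of C⋆-algebras. -/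
noncomputable def StarRep.hom {C : Type*} [NonUnitalCStarAlgebra C] (π : StarRep B E C) :
    C →⋆ₙₐ[ℂ] Op B E where
  toFun c := toOp ⟨π.toHom c, π.toHom (star c), π.adjoint c⟩
  map_smul' c x := Subtype.ext (ContinuousLinearMap.ext fun v => by simp [toOp])
  map_zero' := Subtype.ext (ContinuousLinearMap.ext fun v => by simp [toOp])
  map_add' x y := Subtype.ext (ContinuousLinearMap.ext fun v => by simp [toOp])
  map_mul' x y := Subtype.ext (ContinuousLinearMap.ext fun v => by simp [toOp])
  map_star' x := (Op.star_eq fun v w => π.adjoint x v w).symm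

@[simp] theorem StarRep.hom_apply {C : Type*} [NonUnitalCStarAlgebra C] (π : StarRep B E C)
    (c : C) (v : E) : (π.hom c).1 v = π.toHom c v := rfl

theorem StarRep.norm_apply_le {C : Type*} [NonUnitalCStarAlgebra C] (π : StarRep B E C)
    (c : C) (v : E) : ‖π.toHom c v‖ ≤ ‖c‖ * ‖v‖ := by
  refine (Op.norm_apply_le (π.hom c) v).trans ?_
  gcongr
  exact NonUnitalStarAlgHom.norm_apply_le π.hom c

theorem StarRep.mul_apply {C : Type*} [NonUnitalCStarAlgebra C] (π : StarRep B E C)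
    (c d : C) (v : E) : π.toHom (c * d) v = π.toHom c (π.toHom d v) := by
  rw [map_mul]; rfl

theorem StarRep.continuous_apply {C : Type*} [NonUnitalCStarAlgebra C] (π : StarRep B E C)
    (v : E) : Continuous fun c => π.toHom c v := by
  have h : Continuous (LinearMap.applyₗ v ∘ₗ
      ({ toFun := π.toHom, map_add' := map_add _, map_smul' := map_smul _ } :
        C →ₗ[ℂ] Module.End ℂ E)) :=
    AddMonoidHomClass.continuous_of_bound _ ‖v‖ fun c => by
      rw [mul_comm]
      exact π.norm_apply_le c v
  exact h

end Op

/-! ### The strict topology -/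

/-- Continuity on bounded sets, in terms of filters. -/
theorem continuousOn_bounded_iff {X Y : Type*} [SeminormedAddCommGroup X] (tX : TopologicalSpace X)
    (tY : TopologicalSpace Y) (f : X → Y) :
    (∀ S : Set X, Bornology.IsBounded S → @ContinuousOn X Y tX tY f S) ↔
      ∀ (l : Filter X) (a : X) (C : ℝ), (∀ᶠ x in l, ‖x‖ ≤ C) → l ≤ @nhds X tX a →
        Tendsto f l (@nhds Y tY (f a)) := by
  constructor
  · intro h l a C hC hl
    have hS : Bornology.IsBounded {x : X | ‖x‖ ≤ max C ‖a‖} :=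
      isBounded_iff_forall_norm_le.2 ⟨_, fun x hx => hx⟩
    refine Tendsto.mono_left (h _ hS a (le_max_right C ‖a‖)) ?_
    rw [@nhdsWithin.eq_1]
    exact le_inf hl (le_principal_iff.2 (hC.mono fun x hx => hx.trans (le_max_left _ _)))
  · intro h S hS a ha
    obtain ⟨C, hC⟩ := isBounded_iff_forall_norm_le.1 hS
    refine h _ a C ?_ (@nhdsWithin_le_nhds X tX a S)
    filter_upwards [@self_mem_nhdsWithin X tX a S] with x hx using hC x hx

section Multiplier

variable {A : Type*} [NonUnitalCStarAlgebra A]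

theorem eq_of_star_mul {x y : A} (h : ∀ d : A, star d * x = star d * y) : x = y := by
  rw [← sub_eq_zero, ← CStarRing.star_mul_self_eq_zero_iff, mul_sub, h, sub_self]

theorem mult_ext_fst {m m' : 𝓜(ℂ, A)} (h : ∀ b, m.fst b = m'.fst b) : m = m' := by
  have h1 : m.fst = m'.fst := ContinuousLinearMap.ext h
  refine DoubleCentralizer.ext ℂ A _ _ (Prod.ext h1 (ContinuousLinearMap.ext fun b => ?_))
  rw [← star_inj]
  refine eq_of_star_mul fun d => ?_
  rw [← star_mul, ← star_mul, m.central, m'.central, h]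

theorem mult_ext {m m' : 𝓜(ℂ, A)} (h : ∀ b d, star d * m.fst b = star d * m'.fst b) : m = m' :=
  mult_ext_fst fun b => eq_of_star_mul fun d => h b d

theorem mult_star_mul_fst (m : 𝓜(ℂ, A)) (b d : A) :
    star ((star m).fst d) * b = star d * m.fst b := by
  rw [DoubleCentralizer.star_fst, star_star, m.central]

theorem strictTendsto_iff_star {ι : Type*} {f : ι → 𝓜(ℂ, A)} {l : Filter ι} {m : 𝓜(ℂ, A)} :
    StrictTendsto f l m ↔ ∀ b : A,
      Tendsto (fun i => (f i).fst b) l (𝓝 (m.fst b)) ∧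
      Tendsto (fun i => (star (f i)).fst b) l (𝓝 ((star m).fst b)) := by
  rw [strictTendsto_iff]
  refine ⟨fun h b => ⟨(h b).1, ?_⟩, fun h b => ⟨(h b).1, ?_⟩⟩
  · exact ((continuous_star.tendsto _).comp (h (star b)).2)
  · have := (continuous_star.tendsto _).comp (h (star b)).2
    simpa [Function.comp_def] using this

theorem StrictTendsto.fst {ι : Type*} {f : ι → 𝓜(ℂ, A)} {l : Filter ι} {m : 𝓜(ℂ, A)}
    (h : StrictTendsto f l m) (b : A) : Tendsto (fun i => (f i).fst b) l (𝓝 (m.fst b)) :=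
  (strictTendsto_iff.1 h b).1

theorem StrictTendsto.star_mul_fst {ι : Type*} {f : ι → 𝓜(ℂ, A)} {l : Filter ι} {m : 𝓜(ℂ, A)}
    (h : StrictTendsto f l m) (d b : A) :
    Tendsto (fun i => star d * (f i).fst b) l (𝓝 (star d * m.fst b)) :=
  (h.fst b).const_mul _

theorem StrictTendsto.unique {ι : Type*} {f : ι → 𝓜(ℂ, A)} {l : Filter ι} [l.NeBot]
    {m m' : 𝓜(ℂ, A)} (h : StrictTendsto f l m) (h' : StrictTendsto f l m') : m = m' :=
  mult_ext_fst fun b => tendsto_nhds_unique (h.fst b) (h'.fst b)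

theorem StrictTendsto.add {ι : Type*} {f g : ι → 𝓜(ℂ, A)} {l : Filter ι} {m n : 𝓜(ℂ, A)}
    (h : StrictTendsto f l m) (h' : StrictTendsto g l n) :
    StrictTendsto (fun i => f i + g i) l (m + n) := by
  rw [strictTendsto_iff] at *
  exact fun b => ⟨(h b).1.add (h' b).1, (h b).2.add (h' b).2⟩

theorem StrictTendsto.sub {ι : Type*} {f g : ι → 𝓜(ℂ, A)} {l : Filter ι} {m n : 𝓜(ℂ, A)}
    (h : StrictTendsto f l m) (h' : StrictTendsto g l n) :
    StrictTendsto (fun i => f i - g i) l (m - n) := by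
  rw [strictTendsto_iff] at *
  exact fun b => ⟨(h b).1.sub (h' b).1, (h b).2.sub (h' b).2⟩

theorem StrictTendsto.const_smul {ι : Type*} {f : ι → 𝓜(ℂ, A)} {l : Filter ι} {m : 𝓜(ℂ, A)}
    (h : StrictTendsto f l m) (c : ℂ) : StrictTendsto (fun i => c • f i) l (c • m) := by
  rw [strictTendsto_iff] at *
  exact fun b => ⟨(h b).1.const_smul c, (h b).2.const_smul c⟩

theorem strictTendsto_const {ι : Type*} (l : Filter ι) (m : 𝓜(ℂ, A)) :
    StrictTendsto (fun _ : ι => m) l m := by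
  rw [strictTendsto_iff]
  exact fun b => ⟨tendsto_const_nhds, tendsto_const_nhds⟩

theorem StrictTendsto.star {ι : Type*} {f : ι → 𝓜(ℂ, A)} {l : Filter ι} {m : 𝓜(ℂ, A)}
    (h : StrictTendsto f l m) : StrictTendsto (fun i => star (f i)) l (star m) := by
  rw [strictTendsto_iff_star] at *
  exact fun b => ⟨(h b).2, by simpa using (h b).1⟩

/-! ### The embedding of a C⋆-algebra in its multiplier algebra -/

@[simp] theorem coe_fst_apply (a b : A) : (a : 𝓜(ℂ, A)).fst b = a * b := rfl

theorem coe_mul (a b : A) : ((a * b : A) : 𝓜(ℂ, A)) = a * b :=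
  map_mul (DoubleCentralizer.coeHom (𝕜 := ℂ) (A := A)) a b

theorem coe_star (a : A) : ((star a : A) : 𝓜(ℂ, A)) = star (a : 𝓜(ℂ, A)) :=
  map_star (DoubleCentralizer.coeHom (𝕜 := ℂ) (A := A)) a

theorem coe_add (a b : A) : ((a + b : A) : 𝓜(ℂ, A)) = a + b :=
  map_add (DoubleCentralizer.coeHom (𝕜 := ℂ) (A := A)) a b

theorem coe_sub (a b : A) : ((a - b : A) : 𝓜(ℂ, A)) = a - b :=
  map_sub (DoubleCentralizer.coeHom (𝕜 := ℂ) (A := A)) a b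

theorem coe_smul (c : ℂ) (a : A) : ((c • a : A) : 𝓜(ℂ, A)) = c • (a : 𝓜(ℂ, A)) :=
  map_smul (DoubleCentralizer.coeHom (𝕜 := ℂ) (A := A)) c a

theorem coe_zero : ((0 : A) : 𝓜(ℂ, A)) = 0 :=
  map_zero (DoubleCentralizer.coeHom (𝕜 := ℂ) (A := A))

theorem mul_coe (x : 𝓜(ℂ, A)) (a : A) : x * (a : 𝓜(ℂ, A)) = ((x.fst a : A) : 𝓜(ℂ, A)) :=
  mult_ext fun b d => by
    simp [← mul_assoc, ← x.central]

theorem coe_mul_mult (x : 𝓜(ℂ, A)) (a : A) : (a : 𝓜(ℂ, A)) * x = ((x.snd a : A) : 𝓜(ℂ, A)) :=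
  mult_ext fun b d => by
    simp [x.central]

theorem norm_coe_le (a : A) : ‖(a : 𝓜(ℂ, A))‖ ≤ ‖a‖ := by
  rw [← DoubleCentralizer.norm_fst]
  exact ContinuousLinearMap.opNorm_mul_apply_le ℂ A a

theorem norm_fst_apply_le (x : 𝓜(ℂ, A)) (a : A) : ‖x.fst a‖ ≤ ‖x‖ * ‖a‖ := by
  rw [← DoubleCentralizer.norm_fst]
  exact x.fst.le_opNorm a

theorem norm_snd_apply_le (x : 𝓜(ℂ, A)) (a : A) : ‖x.snd a‖ ≤ ‖x‖ * ‖a‖ := by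
  rw [← DoubleCentralizer.norm_snd]
  exact x.snd.le_opNorm a

theorem coe_nonneg [PartialOrder A] [StarOrderedRing A] {a : A} (ha : 0 ≤ a) :
    0 ≤ (a : 𝓜(ℂ, A)) := by
  obtain ⟨b, rfl⟩ := CStarAlgebra.nonneg_iff_eq_star_mul_self.1 ha
  rw [coe_mul, coe_star]
  exact star_mul_self_nonneg _

theorem strictTendsto_coe {ι : Type*} {l : Filter ι} {f : ι → A} {a : A} (h : Tendsto f l (𝓝 a)) :
    StrictTendsto (fun i => (f i : 𝓜(ℂ, A))) l (a : 𝓜(ℂ, A)) :=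
  strictTendsto_iff.2 fun b => ⟨h.mul_const b, h.const_mul b⟩

end Multiplier

/-! ### Approximate units and strict density of `A` in `M(A)`. -/

section ApproximateUnit

variable (A : Type*) [NonUnitalCStarAlgebra A] [PartialOrder A] [StarOrderedRing A]

theorem approximateUnit_eventually :
    ∀ᶠ e in CStarAlgebra.approximateUnit A, 0 ≤ e ∧ ‖e‖ ≤ 1 ∧ star e = e :=
  have h := CStarAlgebra.increasingApproximateUnit A
  h.eventually_nonneg.and (h.eventually_norm.and h.eventually_star_eq)

variable {A}

theorem tendsto_mul_approximateUnit (c : A) :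
    Tendsto (fun e => c * e) (CStarAlgebra.approximateUnit A) (𝓝 c) :=
  (CStarAlgebra.increasingApproximateUnit A).tendsto_mul_left c

theorem tendsto_approximateUnit_mul (c : A) :
    Tendsto (fun e => e * c) (CStarAlgebra.approximateUnit A) (𝓝 c) :=
  (CStarAlgebra.increasingApproximateUnit A).tendsto_mul_right c

/-- The elements x e lie in `A`, and they are bounded by ‖x‖ when ‖e‖ ≤ 1. Hence a map on `M(A)`
that is strictly continuous on bounded sets is determined by its restriction to `A`. -/
theorem strictTendsto_fst_approximateUnit (x : 𝓜(ℂ, A)) :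
    StrictTendsto (fun e : A => ((x.fst e : A) : 𝓜(ℂ, A))) (CStarAlgebra.approximateUnit A) x := by
  refine strictTendsto_iff.2 fun b => ⟨?_, ?_⟩
  · have h := (x.fst.continuous.tendsto b).comp (tendsto_approximateUnit_mul b)
    refine h.congr fun e => ?_
    rw [← mul_coe]
    rfl
  · refine (tendsto_mul_approximateUnit (x.snd b)).congr fun e => ?_
    rw [← mul_coe]
    rfl

theorem strictTendsto_snd_approximateUnit (x : 𝓜(ℂ, A)) :
    StrictTendsto (fun e : A => ((x.snd e : A) : 𝓜(ℂ, A))) (CStarAlgebra.approximateUnit A) x := by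
  refine strictTendsto_iff.2 fun b => ⟨?_, ?_⟩
  · refine (tendsto_approximateUnit_mul (x.fst b)).congr fun e => ?_
    rw [← coe_mul_mult]
    rfl
  · have h := (x.snd.continuous.tendsto b).comp (tendsto_mul_approximateUnit b)
    refine h.congr fun e => ?_
    rw [← coe_mul_mult]
    rfl

end ApproximateUnit

/-! ### Maps of the form `X ↦ w⋆ X w` -/

section Sandwich

variable {B : Type*} [NonUnitalCStarAlgebra B] [PartialOrder B] [StarOrderedRing B]
variable {E : Type*} [NormedAddCommGroup E] [NormedSpace ℂ E] [SMul Bᵐᵒᵖ E] [CStarModule Bᵐᵒᵖ E]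
variable [CompleteSpace E]

/-- The bounded map `w⋆ X w` on `B`. -/
noncomputable def sandwichFst (w : Adj B B E) (X : Op B E) : B →L[ℂ] B :=
  (⟨(adjoint w).1, continuous_of_mem_Adj (adjoint w)⟩ : E →L[ℂ] B).comp
    (X.1.comp ⟨w.1, continuous_of_mem_Adj w⟩)

theorem star_mul_sandwichFst (w : Adj B B E) (X : Op B E) (b d : B) :
    star d * sandwichFst w X b = ip B (X.1 (w.1 b)) (w.1 d) :=
  ip_adjoint_left w d (X.1 (w.1 b))

/-- The element `w⋆ X w` of `M(B)`. -/
noncomputable def sandwich (w : Adj B B E) : Op B E →ₗ[ℂ] 𝓜(ℂ, B) where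
  toFun X :=
    { fst := sandwichFst w X
      -- Right multiplication is b m = (m⋆ b⋆)⋆, where m⋆ = w⋆ X⋆ w.
      snd := (((starₗᵢ ℂ : B ≃ₗᵢ⋆[ℂ] B) : B →L⋆[ℂ] B).comp (sandwichFst w (star X))).comp
          ((starₗᵢ ℂ : B ≃ₗᵢ⋆[ℂ] B) : B →L⋆[ℂ] B)
      central := fun x y => by
        change star (sandwichFst w (star X) (star x)) * y = _
        have h1 := star_mul_sandwichFst w X y (star x)
        have h2 := star_mul_sandwichFst w (star X) (star x) (star (star y))
        rw [star_star] at h1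
        rw [h1, ← star_inj, star_mul, star_star]
        rw [star_star] at h2
        rw [h2, Op.ip_star_left, star_ip, star_star] }
  map_add' X Y := mult_ext fun b d => by
    change star d * sandwichFst w (X + Y) b = star d * (sandwichFst w X b + sandwichFst w Y b)
    rw [mul_add]
    simp only [star_mul_sandwichFst]
    exact ip_add_left _ _ _
  map_smul' c X := mult_ext fun b d => by
    change star d * sandwichFst w (c • X) b = star d * (c • sandwichFst w X b)
    rw [mul_smul_comm]
    simp only [star_mul_sandwichFst]
    exact ip_smul_left _ _ _

theorem star_mul_sandwich (w : Adj B B E) (X : Op B E) (b d : B) :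
    star d * (sandwich w X).fst b = ip B (X.1 (w.1 b)) (w.1 d) :=
  star_mul_sandwichFst w X b d

theorem star_sandwich (w : Adj B B E) (X : Op B E) :
    star (sandwich w X) = sandwich w (star X) :=
  mult_ext_fst fun b => by
    change star (star (sandwichFst w (star X) (star (star b)))) = _
    rw [star_star, star_star]
    rfl

theorem strictTendsto_sandwich {ι : Type*} {l : Filter ι} (w : Adj B B E) {f : ι → Op B E}
    {X : Op B E} (h : ∀ b, Tendsto (fun i => (f i).1 (w.1 b)) l (𝓝 (X.1 (w.1 b))))
    (h' : ∀ b, Tendsto (fun i => (star (f i)).1 (w.1 b)) l (𝓝 ((star X).1 (w.1 b)))) :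
    StrictTendsto (fun i => sandwich w (f i)) l (sandwich w X) := by
  refine strictTendsto_iff_star.2 fun b => ⟨?_, ?_⟩
  · exact ((continuous_of_mem_Adj (adjoint w)).tendsto _).comp (h b)
  · simp only [star_sandwich]
    exact ((continuous_of_mem_Adj (adjoint w)).tendsto _).comp (h' b)

end Sandwich

/-! ### Strict maps -/

section Strict

variable {A : Type*} [NonUnitalCStarAlgebra A] [PartialOrder A] [StarOrderedRing A]
variable {B : Type*} [NonUnitalCStarAlgebra B] [PartialOrder B] [StarOrderedRing B]

theorem isStrict_iff {ρ : A →ₗ[ℂ] 𝓜(ℂ, B)} : IsStrict ρ ↔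
    ∀ (l : Filter A) (a : A) (C : ℝ), (∀ᶠ x in l, ‖x‖ ≤ C) →
      StrictTendsto (fun x : A => (x : 𝓜(ℂ, A))) l a → StrictTendsto (fun x => ρ x) l (ρ a) := by
  unfold IsStrict
  rw [continuousOn_bounded_iff]
  unfold StrictTendsto strictTopologyOn
  simp only [nhds_induced (T := strictTopology A), tendsto_iff_comap (f := fun x : A => (x : 𝓜(ℂ, A)))]

theorem IsStrict.strictTendsto {ρ : A →ₗ[ℂ] 𝓜(ℂ, B)} (hρ : IsStrict ρ) {ι : Type*} {l : Filter ι}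
    {f : ι → A} {a : A} (C : ℝ) (hC : ∀ᶠ i in l, ‖f i‖ ≤ C)
    (hf : StrictTendsto (fun i => (f i : 𝓜(ℂ, A))) l a) :
    StrictTendsto (fun i => ρ (f i)) l (ρ a) :=
  isStrict_iff.1 hρ (map f l) a C hC hf

theorem IsStrict.strictTendsto_of_tendsto {ρ : A →ₗ[ℂ] 𝓜(ℂ, B)} (hρ : IsStrict ρ) {ι : Type*}
    {l : Filter ι} {f : ι → A} {a : A} (hf : Tendsto f l (𝓝 a)) :
    StrictTendsto (fun i => ρ (f i)) l (ρ a) := by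
  refine hρ.strictTendsto (‖a‖ + 1) ?_ (strictTendsto_coe hf)
  have := hf.norm.eventually (gt_mem_nhds (lt_add_one ‖a‖))
  exact this.mono fun i hi => hi.le

theorem IsStrict.continuous_fst {ρ : A →ₗ[ℂ] 𝓜(ℂ, B)} (hρ : IsStrict ρ) (b : B) :
    Continuous fun a => (ρ a).fst b :=
  continuous_iff_continuousAt.2 fun _ => (hρ.strictTendsto_of_tendsto tendsto_id).fst b

theorem IsStrict.add {ρ σ : A →ₗ[ℂ] 𝓜(ℂ, B)} (hρ : IsStrict ρ) (hσ : IsStrict σ) :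
    IsStrict (ρ + σ) :=
  isStrict_iff.2 fun l a C hC hl =>
    (isStrict_iff.1 hρ l a C hC hl).add (isStrict_iff.1 hσ l a C hC hl)

theorem IsStrict.sub {ρ σ : A →ₗ[ℂ] 𝓜(ℂ, B)} (hρ : IsStrict ρ) (hσ : IsStrict σ) :
    IsStrict (ρ - σ) :=
  isStrict_iff.2 fun l a C hC hl =>
    (isStrict_iff.1 hρ l a C hC hl).sub (isStrict_iff.1 hσ l a C hC hl)

theorem IsStrict.smul {ρ : A →ₗ[ℂ] 𝓜(ℂ, B)} (hρ : IsStrict ρ) (c : ℂ) : IsStrict (c • ρ) :=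
  isStrict_iff.2 fun l a C hC hl => (isStrict_iff.1 hρ l a C hC hl).const_smul c

theorem IsStrictExtension.strictTendsto {ρ : A →ₗ[ℂ] 𝓜(ℂ, B)} {ρ' : 𝓜(ℂ, A) →ₗ[ℂ] 𝓜(ℂ, B)}
    (h : IsStrictExtension ρ ρ') {ι : Type*} {l : Filter ι}
    {f : ι → 𝓜(ℂ, A)} {x : 𝓜(ℂ, A)} (C : ℝ) (hC : ∀ᶠ i in l, ‖f i‖ ≤ C)
    (hf : StrictTendsto f l x) : StrictTendsto (fun i => ρ' (f i)) l (ρ' x) :=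
  (continuousOn_bounded_iff _ _ _).1 h.continuousOn (map f l) x C hC hf

/-- Both maps are evaluated along the bounded net x e in `A`. Consequently the choice in
`strictExtension` is immaterial once an extension exists. -/
theorem IsStrictExtension.unique {ρ : A →ₗ[ℂ] 𝓜(ℂ, B)} {ρ' ρ'' : 𝓜(ℂ, A) →ₗ[ℂ] 𝓜(ℂ, B)}
    (h : IsStrictExtension ρ ρ') (h' : IsStrictExtension ρ ρ'') : ρ' = ρ'' := by
  ext1 x
  have hC : ∀ᶠ e in CStarAlgebra.approximateUnit A, ‖((x.fst e : A) : 𝓜(ℂ, A))‖ ≤ ‖x‖ := by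
    filter_upwards [approximateUnit_eventually A] with e he
    refine (norm_coe_le _).trans ((norm_fst_apply_le x e).trans ?_)
    exact mul_le_of_le_one_right (norm_nonneg _) he.2.1
  have h1 := h.strictTendsto ‖x‖ hC (strictTendsto_fst_approximateUnit x)
  have h2 := h'.strictTendsto ‖x‖ hC (strictTendsto_fst_approximateUnit x)
  simp only [h.extends_eq] at h1
  simp only [h'.extends_eq] at h2
  exact h1.unique h2

theorem strictExtension_eq {ρ : A →ₗ[ℂ] 𝓜(ℂ, B)} {ρ' : 𝓜(ℂ, A) →ₗ[ℂ] 𝓜(ℂ, B)}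
    (h : IsStrictExtension ρ ρ') : strictExtension ρ = ρ' := by
  have he : ∃ ρ', IsStrictExtension ρ ρ' := ⟨ρ', h⟩
  unfold strictExtension
  rw [dif_pos he]
  exact he.choose_spec.unique h

end Strict

/-! ### Strict completely positive maps implemented by positive operators -/

section Nets

variable {A : Type*} [NonUnitalCStarAlgebra A] [PartialOrder A] [StarOrderedRing A]

/-- A dense subspace contains a bounded net that converges strictly to `1`. -/
theorem exists_bounded_strict_net {N : Submodule ℂ A} (hN : Dense (N : Set A)) :
    ∃ f : A × ℕ → N,
      (∀ᶠ i in CStarAlgebra.approximateUnit A ×ˢ (atTop : Filter ℕ), ‖(f i : A)‖ ≤ 2) ∧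
      StrictTendsto (fun i => ((f i : A) : 𝓜(ℂ, A)))
        (CStarAlgebra.approximateUnit A ×ˢ (atTop : Filter ℕ)) 1 := by
  -- The net is indexed by pairs (e, n): an element of `N` within 1/(n + 1) of e. Its norm is at
  -- most 1 + 1 eventually.
  have h : ∀ i : A × ℕ, ∃ y : N, ‖(y : A) - i.1‖ ≤ 1 / ((i.2 : ℝ) + 1) := fun i => by
    obtain ⟨y, hy, hd⟩ := hN.exists_dist_lt i.1 (Nat.one_div_pos_of_nat (α := ℝ) (n := i.2))
    exact ⟨⟨y, hy⟩, by rw [← dist_eq_norm, dist_comm]; exact hd.le⟩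
  choose f hf using h
  set L := CStarAlgebra.approximateUnit A ×ˢ (atTop : Filter ℕ)
  have hz : Tendsto (fun i : A × ℕ => (f i : A) - i.1) L (𝓝 0) :=
    squeeze_zero_norm hf (tendsto_one_div_add_atTop_nhds_zero_nat.comp tendsto_snd)
  refine ⟨f, ?_, strictTendsto_iff.2 fun b => ⟨?_, ?_⟩⟩
  · filter_upwards [tendsto_fst.eventually (approximateUnit_eventually A)] with i hi
    have h1 : (1 : ℝ) / ((i.2 : ℝ) + 1) ≤ 1 := by
      rw [div_le_one (by positivity)]
      linarith [(Nat.cast_nonneg i.2 : (0 : ℝ) ≤ i.2)]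
    calc ‖(f i : A)‖ = ‖((f i : A) - i.1) + i.1‖ := by rw [sub_add_cancel]
      _ ≤ ‖(f i : A) - i.1‖ + ‖i.1‖ := norm_add_le _ _
      _ ≤ 1 + 1 := add_le_add ((hf i).trans h1) hi.2.1
      _ = 2 := by norm_num
  · have h1 := (hz.mul_const b).add ((tendsto_approximateUnit_mul b).comp
      (tendsto_fst (f := CStarAlgebra.approximateUnit A) (g := (atTop : Filter ℕ))))
    rw [zero_mul, zero_add] at h1
    refine h1.congr fun i => ?_
    simp [sub_mul]
  · have h1 := (hz.const_mul b).add ((tendsto_mul_approximateUnit b).comp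
      (tendsto_fst (f := CStarAlgebra.approximateUnit A) (g := (atTop : Filter ℕ))))
    rw [mul_zero, zero_add] at h1
    refine h1.congr fun i => ?_
    simp [mul_sub]

/-- ‖f⋆ f c‖ ≤ C ‖f c‖, which is where boundedness enters; the other half of strict convergence
follows because f⋆ f is self-adjoint. -/
theorem strictTendsto_star_mul_self_zero {ι : Type*} {l : Filter ι} {f : ι → A} (C : ℝ)
    (hC : ∀ᶠ i in l, ‖f i‖ ≤ C) (hf : StrictTendsto (fun i => ((f i : A) : 𝓜(ℂ, A))) l 0) :
    StrictTendsto (fun i => ((star (f i) * f i : A) : 𝓜(ℂ, A))) l ((0 : A) : 𝓜(ℂ, A)) := by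
  have key : ∀ c : A, Tendsto (fun i => star (f i) * f i * c) l (𝓝 0) := fun c => by
    have h1 : Tendsto (fun i => f i * c) l (𝓝 0) := hf.fst c
    have h2 : Tendsto (fun i => C * ‖f i * c‖) l (𝓝 0) := by
      simpa using (h1.norm.const_mul C)
    refine squeeze_zero_norm' ?_ h2
    filter_upwards [hC] with i hi
    rw [mul_assoc]
    refine (norm_mul_le _ _).trans ?_
    rw [norm_star]
    gcongr
  refine strictTendsto_iff_star.2 fun b => ⟨?_, ?_⟩
  · simpa using key b
  · simp only [← coe_star, star_mul, star_star]
    simpa using key b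

end Nets

section Implement

variable {A : Type*} [NonUnitalCStarAlgebra A] [PartialOrder A] [StarOrderedRing A]
variable {B : Type*} [NonUnitalCStarAlgebra B] [PartialOrder B] [StarOrderedRing B]
variable {E : Type*} [NormedAddCommGroup E] [NormedSpace ℂ E] [SMul Bᵐᵒᵖ E] [CStarModule Bᵐᵒᵖ E]
variable [CompleteSpace E]

theorem isPos_iff (T : Adj B E E) : IsPos T ↔ 0 ≤ toOp T :=
  ⟨fun h => Op.nonneg_of_ip_nonneg h, fun h => Op.ip_nonneg h⟩

theorem leOne_iff (T : Adj B E E) : LeOne T ↔ toOp T ≤ 1 :=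
  Iff.symm (Op.le_iff (s := toOp T) (t := 1))

/-- Pointwise convergence of a bounded net of operators extends from a set to its closed span. -/
theorem tendsto_op_of_mem_closure {ι : Type*} {l : Filter ι} {X : ι → Op B E} {Y : Op B E} (C : ℝ)
    (hC : ∀ᶠ i in l, ‖X i‖ ≤ C) {S : Set E}
    (h : ∀ ξ ∈ S, Tendsto (fun i => (X i).1 ξ) l (𝓝 (Y.1 ξ))) {ξ : E}
    (hξ : ξ ∈ closure (Submodule.span ℂ S : Set E)) :
    Tendsto (fun i => (X i).1 ξ) l (𝓝 (Y.1 ξ)) := by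
  have h1 : ∀ ξ ∈ Submodule.span ℂ S, Tendsto (fun i => (X i).1 ξ) l (𝓝 (Y.1 ξ)) := by
    intro ξ hξ
    induction hξ using Submodule.span_induction with
    | mem ξ hξ => exact h ξ hξ
    | zero => simp only [map_zero]; exact tendsto_const_nhds
    | add ξ η _ _ h1 h2 => simpa using h1.add h2
    | smul c ξ _ h1 => simpa using h1.const_smul c
  rw [tendsto_iff_norm_sub_tendsto_zero, Metric.tendsto_nhds]
  intro ε hε
  set D := max C 0 + ‖Y‖ + 1 with hD
  have hD0 : 0 < D := by positivity
  obtain ⟨η, hη, hd⟩ := Metric.mem_closure_iff.1 hξ (ε / (2 * D)) (by positivity)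
  have h2 := Metric.tendsto_nhds.1 (h1 η hη) (ε / 2) (by positivity)
  filter_upwards [h2, hC] with i hi hCi
  rw [Real.dist_0_eq_abs, abs_norm]
  have e : (X i).1 ξ - Y.1 ξ = ((X i).1 η - Y.1 η) + (X i).1 (ξ - η) - Y.1 (ξ - η) := by
    simp only [map_sub]; abel
  rw [dist_eq_norm] at hi hd
  rw [e]
  calc _ ≤ ‖(X i).1 η - Y.1 η‖ + ‖(X i).1 (ξ - η)‖ + ‖Y.1 (ξ - η)‖ :=
        (norm_sub_le _ _).trans (add_le_add_left (norm_add_le _ _) _)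
    _ ≤ ‖(X i).1 η - Y.1 η‖ + max C 0 * ‖ξ - η‖ + ‖Y‖ * ‖ξ - η‖ := by
        gcongr
        · refine (Op.norm_apply_le _ _).trans ?_
          gcongr
          exact hCi.trans (le_max_left _ _)
        · exact Op.norm_apply_le _ _
    _ ≤ ‖(X i).1 η - Y.1 η‖ + D * ‖ξ - η‖ := by
        rw [hD]; nlinarith [norm_nonneg (ξ - η)]
    _ < ε / 2 + D * (ε / (2 * D)) := by gcongr
    _ = ε := by field_simp; ring

/-- The set of the vectors `π(c) η`. -/
def repRange (π : StarRep B E A) : Set E := {ξ | ∃ (c : A) (η : E), ξ = π.toHom c η}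

/-- On a vector π(c) η the net is π(f_i c) η, and f_i c → a c in norm. Boundedness carries the
convergence to the closed span. -/
theorem StarRep.tendsto_apply (π : StarRep B E A) {ι : Type*} {l : Filter ι} {f : ι → A} {a : A}
    (C : ℝ) (hC : ∀ᶠ i in l, ‖f i‖ ≤ C)
    (hf : StrictTendsto (fun i => ((f i : A) : 𝓜(ℂ, A))) l (a : 𝓜(ℂ, A))) {ξ : E}
    (hξ : ξ ∈ closure (Submodule.span ℂ (repRange π) : Set E)) :
    Tendsto (fun i => π.toHom (f i) ξ) l (𝓝 (π.toHom a ξ)) := by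
  refine tendsto_op_of_mem_closure (B := B) (X := fun i => π.hom (f i)) (Y := π.hom a) C ?_ ?_ hξ
  · exact hC.mono fun i hi => (NonUnitalStarAlgHom.norm_apply_le π.hom (f i)).trans hi
  · rintro _ ⟨c, η, rfl⟩
    simp only [StarRep.hom_apply, ← StarRep.mul_apply]
    exact ((π.continuous_apply η).tendsto _).comp (hf.fst c)

variable {φ : CStarValuedWeight A B} {Λ : φ.cone.N →ₗ[ℂ] Adj B B E} {π : StarRep B E A}

/-- `Implements`, for elements of the C⋆-algebra `Op B E`. -/
def OpImplements (Λ : φ.cone.N →ₗ[ℂ] Adj B B E) (ρ : A →ₗ[ℂ] 𝓜(ℂ, B)) (t : Op B E) : Prop :=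
  0 ≤ t ∧ ∀ (a₁ a₂ : φ.cone.N) (b₁ b₂ : B),
    star b₂ * (ρ (star (a₂ : A) * a₁)).fst b₁ = ip B (t.1 ((Λ a₁).1 b₁)) ((Λ a₂).1 b₂)

theorem opImplements_toOp {ρ : A →ₗ[ℂ] 𝓜(ℂ, B)} {T : Adj B E E} :
    OpImplements Λ ρ (toOp T) ↔ Implements Λ ρ T :=
  and_congr (isPos_iff T).symm Iff.rfl

theorem toOp_ofOp (t : Op B E) : toOp (ofOp t) = t := Subtype.ext (ContinuousLinearMap.ext fun _ => rfl)

/-- For x in the cone, x² = x^{1/2} x x^{1/2} ≤ ‖x‖ x, so x² lies in the cone by heredity. Thus M_φ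
⊆ N_φ. -/
theorem dense_N (hd : φ.IsDenselyDefined) : Dense (φ.cone.N : Set A) := by
  have h : φ.cone.M ≤ φ.cone.N := Submodule.span_le.2 fun x hx => by
    have hx0 := φ.cone.nonneg x hx
    have hsa := IsSelfAdjoint.of_nonneg hx0
    refine φ.cone.hereditary _ (φ.cone.smul_mem ‖x‖ (norm_nonneg _) x hx) _
      (star_mul_self_nonneg _) ?_
    rw [hsa.star_eq]
    have h1 := CStarAlgebra.star_left_conjugate_le_norm_smul (a := CFC.sqrt x) (b := x) hsa
    have hr := (IsSelfAdjoint.of_nonneg (CFC.sqrt_nonneg x)).star_eq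
    have hc : Commute (CFC.sqrt x) x := (Commute.refl x).cfcₙ_nnreal _
    rwa [hr, hc.eq, mul_assoc, CFC.sqrt_mul_sqrt_self x hx0] at h1
  exact hd.mono h

/-- For aᵢ in N_φ the double sum is ⟨t η, η⟩ with η = ∑ Λ(aᵢ) bᵢ. The general case follows by
density of N_φ, since strictness makes a ↦ ρ(a) b norm continuous. -/
theorem isCP_of_opImplements (hd : φ.IsDenselyDefined) {ρ : A →ₗ[ℂ] 𝓜(ℂ, B)} (hρ : IsStrict ρ)
    {t : Op B E} (ht : OpImplements Λ ρ t) : IsCP ρ := by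
  intro n a b
  have hcl : IsClosed {a : Fin n → A |
      0 ≤ ∑ i, ∑ j, star (b j) * (ρ (star (a j) * a i)).fst (b i)} := by
    refine isClosed_le continuous_const ?_
    refine continuous_finsetSum _ fun i _ => continuous_finsetSum _ fun j _ => ?_
    refine continuous_const.mul ((hρ.continuous_fst (b i)).comp ?_)
    fun_prop
  have hden : Dense (Set.pi Set.univ fun _ : Fin n => (φ.cone.N : Set A)) :=
    dense_pi Set.univ fun _ _ => dense_N hd
  refine hcl.closure_subset_iff.2 ?_ (hden a)
  intro a ha
  let a' : Fin n → φ.cone.N := fun i => ⟨a i, ha i (Set.mem_univ i)⟩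
  have h : ∑ i, ∑ j, star (b j) * (ρ (star (a j) * a i)).fst (b i) =
      ip B (t.1 (∑ i, (Λ (a' i)).1 (b i))) (∑ j, (Λ (a' j)).1 (b j)) := by
    rw [map_sum, ip_sum_left]
    refine Finset.sum_congr rfl fun i _ => ?_
    rw [ip_sum_right]
    exact Finset.sum_congr rfl fun j _ => ht.2 (a' i) (a' j) (b i) (b j)
  rw [Set.mem_ofPred_eq, h]
  exact Op.ip_nonneg ht.1 _

/-! ### Commutation with the representation, and the vectors that replace Λ(1) b. -/

section KSGNS

variable (hK : IsKSGNS φ Λ π)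
include hK

/-- Both ⟨π(x) t Λ(a) b, Λ(c) d⟩ and ⟨t π(x) Λ(a) b, Λ(c) d⟩ equal d⋆ ρ(c⋆ x a) b. -/
theorem commute_of_opImplements {ρ : A →ₗ[ℂ] 𝓜(ℂ, B)} {t : Op B E} (ht : OpImplements Λ ρ t)
    (x : A) : Commute t (π.hom x) := by
  have hsa : star t = t := (IsSelfAdjoint.of_nonneg ht.1).star_eq
  have key : ∀ (a : φ.cone.N) (b : B) (η : E),
      ip B ((π.hom x * t).1 ((Λ a).1 b)) η = ip B ((t * π.hom x).1 ((Λ a).1 b)) η := by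
    intro a b
    refine ip_eq_of_dense hK.dense ?_
    rintro _ ⟨c, d, rfl⟩
    have h1 : ip B ((π.hom x * t).1 ((Λ a).1 b)) ((Λ c).1 d) =
        ip B (t.1 ((Λ a).1 b)) (π.toHom (star x) ((Λ c).1 d)) := π.adjoint _ _ _
    have h2 : ip B ((t * π.hom x).1 ((Λ a).1 b)) ((Λ c).1 d) =
        ip B (t.1 (π.toHom x ((Λ a).1 b))) ((Λ c).1 d) := rfl
    rw [h1, h2, hK.rep_apply, hK.rep_apply, ← ht.2, ← ht.2]
    simp [mul_assoc]
  refine Op.ext_ip fun ξ η => ?_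
  have hc : ∀ X : Op B E, Continuous fun ξ => ip B (X.1 ξ) η := fun X =>
    (continuous_ip B).comp (X.1.continuous.prodMk continuous_const)
  refine congrFun (Continuous.ext_on hK.dense (hc _) (hc _) fun ξ hξ => ?_) ξ
  induction hξ using Submodule.span_induction with
  | mem ξ hξ =>
    obtain ⟨a, b, rfl⟩ := hξ
    exact (key a b η).symm
  | zero => simp
  | add ξ ξ' _ _ h h' => simp only [map_add, ip_add_left, h, h']
  | smul c ξ _ h => simp only [map_smul, ip_smul_left, h]

/-- A strict map implemented by `t` has a vector `v b` for every `b`, formally `t^{1/2} Λ(1) b`. -/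
theorem exists_sqrt_vector (hd : φ.IsDenselyDefined) {ρ : A →ₗ[ℂ] 𝓜(ℂ, B)} (hρ : IsStrict ρ)
    {t : Op B E} (ht : OpImplements Λ ρ t) :
    ∃ v : B →ₗ[ℂ] E,
      (∀ (a : φ.cone.N) (b : B), π.toHom a (v b) = (CFC.sqrt t).1 ((Λ a).1 b)) ∧
      (∀ b, v b ∈ closure (Submodule.span ℂ (repRange π) : Set E)) ∧
      (∀ (a : φ.cone.N) (b d : B), ip B (v b) ((CFC.sqrt t).1 ((Λ a).1 d)) =
        star d * (ρ (star (a : A))).fst b) := by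
  obtain ⟨f, hfb, hf1⟩ := exists_bounded_strict_net (dense_N hd)
  set L := CStarAlgebra.approximateUnit A ×ˢ (atTop : Filter ℕ)
  set r := CFC.sqrt t with hr
  have hrr : ∀ x y : E, ip B (r.1 x) (r.1 y) = ip B (t.1 x) y := Op.ip_sqrt_apply ht.1
  have hnorm : ∀ (a : φ.cone.N) (b : B),
      ‖r.1 ((Λ a).1 b)‖ ^ 2 = ‖star b * (ρ (star (a : A) * a)).fst b‖ := fun a b => by
    rw [norm_sq_eq_norm_ip B, hrr, ht.2]
  have hzero : ∀ {ι : Type _} (l : Filter ι) (g : ι → φ.cone.N) (b : B),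
      StrictTendsto (fun i => ρ (star (g i : A) * g i)) l 0 →
      Tendsto (fun i => r.1 ((Λ (g i)).1 b)) l (𝓝 0) := by
    intro ι l g b h
    have h1 := (h.star_mul_fst b b).norm
    simp only [← hnorm] at h1
    have h2 : Tendsto (fun i => √(‖r.1 ((Λ (g i)).1 b)‖ ^ 2)) l (𝓝 (√0)) := by
      refine (Real.continuous_sqrt.tendsto 0).comp ?_
      simpa [DoubleCentralizer.zero_fst] using h1
    rw [tendsto_zero_iff_norm_tendsto_zero]
    simpa using h2
  -- The differences f_p - f_q are bounded by 2 + 2 = 4 and tend strictly to 0, hence so do their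
  -- squares, bounded by 16. Strictness of `ρ` and `hzero` make the net Cauchy.
  have hlim : ∀ b : B, ∃ y, Tendsto (fun i => r.1 ((Λ (f i)).1 b)) L (𝓝 y) := by
    intro b
    refine cauchy_map_iff_exists_tendsto.1 (cauchy_map_iff.2 ⟨inferInstance, ?_⟩)
    rw [tendsto_uniformity_iff_dist_tendsto_zero]
    have hs : StrictTendsto (fun p : (A × ℕ) × (A × ℕ) =>
        (((f p.1 - f p.2 : φ.cone.N) : A) : 𝓜(ℂ, A))) (L ×ˢ L) 0 := by
      have h1 : StrictTendsto (fun p : (A × ℕ) × (A × ℕ) => ((f p.1 : A) : 𝓜(ℂ, A))) (L ×ˢ L) 1 :=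
        Tendsto.comp hf1 tendsto_fst
      have h2 : StrictTendsto (fun p : (A × ℕ) × (A × ℕ) => ((f p.2 : A) : 𝓜(ℂ, A))) (L ×ˢ L) 1 :=
        Tendsto.comp hf1 tendsto_snd
      have h3 := h1.sub h2
      rw [sub_self] at h3
      simpa only [Submodule.coe_sub, coe_sub] using h3
    have hb : ∀ᶠ p : (A × ℕ) × (A × ℕ) in L ×ˢ L, ‖((f p.1 - f p.2 : φ.cone.N) : A)‖ ≤ 4 := by
      filter_upwards [tendsto_fst.eventually hfb, tendsto_snd.eventually hfb] with p h1 h2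
      refine (norm_sub_le _ _).trans ?_
      linarith
    have hb' : ∀ᶠ p : (A × ℕ) × (A × ℕ) in L ×ˢ L,
        ‖star ((f p.1 - f p.2 : φ.cone.N) : A) * ((f p.1 - f p.2 : φ.cone.N) : A)‖ ≤ 16 := by
      filter_upwards [hb] with p hp
      rw [CStarRing.norm_star_mul_self]
      nlinarith [norm_nonneg ((f p.1 - f p.2 : φ.cone.N) : A)]
    have h1 := hzero (L ×ˢ L) (fun p => f p.1 - f p.2) b (by
      have := hρ.strictTendsto 16 hb' (strictTendsto_star_mul_self_zero 4 hb hs)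
      rwa [map_zero] at this)
    rw [tendsto_zero_iff_norm_tendsto_zero] at h1
    refine h1.congr fun p => ?_
    rw [dist_eq_norm, ← map_sub, map_sub Λ]
    rfl
  choose v hv using hlim
  have hrmul : ∀ (x : A) (a : φ.cone.N) (b : B), π.toHom x (r.1 ((Λ a).1 b)) =
      r.1 ((Λ ⟨x * a, φ.cone.mul_mem x a.2⟩).1 b) := fun x a b => by
    rw [← hK.rep_apply]
    have h := commute_sqrt (commute_of_opImplements hK ht x)
    exact (congrArg (fun X : Op B E => X.1 ((Λ a).1 b)) h.eq).symm
  have hpi : ∀ (a : φ.cone.N) (b : B), π.toHom a (v b) = r.1 ((Λ a).1 b) := by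
    intro a b
    have h1 : Tendsto (fun i => π.toHom a (r.1 ((Λ (f i)).1 b))) L (𝓝 (π.toHom a (v b))) :=
      ((π.hom a).1.continuous.tendsto _).comp (hv b)
    refine tendsto_nhds_unique h1 ?_
    -- Continuity of Λ is not available. Instead, a f_i → a in norm gives ρ((a f_i - a)⋆(a f_i - a))
    -- → 0, and `hzero` yields r Λ(a f_i) b → r Λ(a) b.
    have hc : Tendsto (fun i => (a : A) * f i) L (𝓝 a) := (strictTendsto_iff.1 hf1 a).2
    have hc' : Tendsto (fun i => star ((a : A) * f i - a) * ((a : A) * f i - a)) L (𝓝 0) := by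
      have := hc.sub_const (a : A)
      rw [sub_self] at this
      simpa using this.star.mul this
    have h2 := hzero L (fun i => ⟨(a : A) * f i, φ.cone.mul_mem _ (f i).2⟩ - a) b (by
      have := hρ.strictTendsto_of_tendsto hc'
      rwa [map_zero] at this)
    have h3 := h2.add_const (r.1 ((Λ a).1 b))
    rw [zero_add] at h3
    refine h3.congr fun i => ?_
    rw [hrmul, map_sub]
    simp
  refine ⟨{ toFun := v, map_add' := fun b b' => ?_, map_smul' := fun c b => ?_ }, hpi, ?_, ?_⟩
  · refine tendsto_nhds_unique (hv (b + b')) (((hv b).add (hv b')).congr fun i => ?_)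
    simp
  · refine tendsto_nhds_unique (hv (c • b)) (((hv b).const_smul c).congr fun i => ?_)
    simp
  · intro b
    refine mem_closure_of_tendsto (hv b) (Eventually.of_forall fun i => ?_)
    rw [← hpi]
    exact Submodule.subset_span ⟨_, _, rfl⟩
  · intro a b d
    refine tendsto_nhds_unique (tendsto_ip B (hv b) tendsto_const_nhds) ?_
    simp only [hrr, ← ht.2]
    have h1 : Tendsto (fun i => star (a : A) * f i) L (𝓝 (star (a : A))) :=
      (strictTendsto_iff.1 hf1 _).2
    exact (hρ.strictTendsto_of_tendsto h1).star_mul_fst d b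

/-- A strict map implemented by `t` has an adjointable `w : B → E`, formally `t Λ(1)`. -/
theorem exists_implementing_adj (hd : φ.IsDenselyDefined) {ρ : A →ₗ[ℂ] 𝓜(ℂ, B)} (hρ : IsStrict ρ)
    {t : Op B E} (ht : OpImplements Λ ρ t) :
    ∃ w : Adj B B E, (∀ (a : φ.cone.N) (b : B), π.toHom a (w.1 b) = t.1 ((Λ a).1 b)) ∧
      (∀ b, w.1 b ∈ closure (Submodule.span ℂ (repRange π) : Set E)) := by
  obtain ⟨v, hv1, hv2, hv3⟩ := exists_sqrt_vector hK hd hρ ht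
  have hcr : ∀ x ξ, π.toHom x ((CFC.sqrt t).1 ξ) = (CFC.sqrt t).1 (π.toHom x ξ) := fun x ξ =>
    (congrArg (fun X : Op B E => X.1 ξ)
      (commute_sqrt (commute_of_opImplements hK ht x)).eq).symm
  have hsa := (IsSelfAdjoint.of_nonneg (CFC.sqrt_nonneg t)).star_eq
  refine ⟨⟨(CFC.sqrt t).1.toLinearMap ∘ₗ v, mem_Adj_of_dense _ hK.dense ?_⟩, ?_, ?_⟩
  -- The adjoint of w = t^{1/2} v must send Λ(a) d to ρ(a⋆)⋆ d, since ⟨w b, Λ(a) d⟩ = d⋆ ρ(a⋆) b.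
  -- The additional factor t^{1/2} makes the adjoint explicit on vectors Λ(a) d, which span a dense
  -- subspace; v itself is treated in `exists_vec` under nondegeneracy.
  · rintro _ ⟨a, d, rfl⟩
    refine ⟨(star (ρ (star (a : A)))).fst d, fun b => ?_⟩
    have h1 := Op.ip_star_left (CFC.sqrt t) (v b) ((Λ a).1 d)
    rw [hsa] at h1
    rw [ip_self, mult_star_mul_fst, ← hv3, ← h1]
    rfl
  · intro a b
    change π.toHom a ((CFC.sqrt t).1 (v b)) = _
    rw [hcr, hv1]
    conv_rhs => rw [← CFC.sqrt_mul_sqrt_self t ht.1]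
    rfl
  · intro b
    change (CFC.sqrt t).1 (v b) ∈ _
    refine map_mem_closure (CFC.sqrt t).1.continuous (hv2 b) fun ξ hξ => ?_
    induction hξ using Submodule.span_induction with
    | mem ξ hξ =>
      obtain ⟨c, η, rfl⟩ := hξ
      exact Submodule.subset_span ⟨c, (CFC.sqrt t).1 η, (hcr _ _).symm⟩
    | zero => simp
    | add ξ η _ _ h h' => rw [map_add]; exact Submodule.add_mem _ h h'
    | smul c ξ _ h => rw [map_smul]; exact Submodule.smul_mem _ c h

end KSGNS

end Implement

/-! ### The index set `𝓖` is directed -/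

section Directed

variable {A : Type*} [NonUnitalCStarAlgebra A] [PartialOrder A] [StarOrderedRing A]
variable {B : Type*} [NonUnitalCStarAlgebra B] [PartialOrder B] [StarOrderedRing B]
variable {E : Type*} [NormedAddCommGroup E] [NormedSpace ℂ E] [SMul Bᵐᵒᵖ E] [CStarModule Bᵐᵒᵖ E]
variable [CompleteSpace E]
variable {φ : CStarValuedWeight A B} {Λ : φ.cone.N →ₗ[ℂ] Adj B B E} {π : StarRep B E A}

theorem Op.ip_add_apply (s t : Op B E) (x y : E) :
    ip B ((s + t).1 x) y = ip B (s.1 x) y + ip B (t.1 x) y := ip_add_left _ _ _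

theorem Op.ip_sub_apply (s t : Op B E) (x y : E) :
    ip B ((s - t).1 x) y = ip B (s.1 x) y - ip B (t.1 x) y := ip_sub_left _ _ _

theorem Op.ip_smul_apply (c : ℝ) (t : Op B E) (x y : E) :
    ip B ((c • t).1 x) y = (c : ℂ) • ip B (t.1 x) y := ip_smul_left (c : ℂ) _ _

theorem OpImplements.add {ρ σ : A →ₗ[ℂ] 𝓜(ℂ, B)} {s t : Op B E} (hs : OpImplements Λ ρ s)
    (ht : OpImplements Λ σ t) : OpImplements Λ (ρ + σ) (s + t) := by
  refine ⟨add_nonneg hs.1 ht.1, fun a₁ a₂ b₁ b₂ => ?_⟩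
  rw [Op.ip_add_apply, ← hs.2, ← ht.2, ← mul_add]
  rfl

theorem OpImplements.sub {ρ σ : A →ₗ[ℂ] 𝓜(ℂ, B)} {s t : Op B E} (hs : OpImplements Λ ρ s)
    (ht : OpImplements Λ σ t) (hts : t ≤ s) : OpImplements Λ (ρ - σ) (s - t) := by
  refine ⟨sub_nonneg.2 hts, fun a₁ a₂ b₁ b₂ => ?_⟩
  rw [Op.ip_sub_apply, ← hs.2, ← ht.2, ← mul_sub]
  rfl

theorem OpImplements.smul {ρ : A →ₗ[ℂ] 𝓜(ℂ, B)} {t : Op B E} (ht : OpImplements Λ ρ t)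
    {c : ℝ} (hc : 0 ≤ c) : OpImplements Λ ((c : ℂ) • ρ) (c • t) := by
  refine ⟨smul_nonneg hc ht.1, fun a₁ a₂ b₁ b₂ => ?_⟩
  rw [Op.ip_smul_apply, ← ht.2, ← mul_smul_comm]
  rfl

theorem GType.exists_opImplements (g : GType Λ) : IsStrict g.1 ∧ ∃ t : Op B E,
    OpImplements Λ g.1 t ∧ ∃ c : ℝ, c < 1 ∧ t ≤ algebraMap ℝ (Op B E) c := by
  obtain ⟨_, c, hc0, hc1, σ, ⟨⟨-, hσ, -⟩, T, hT, hT1⟩, rfl⟩ := g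
  refine ⟨hσ.smul c, c • toOp T, (opImplements_toOp.2 hT).smul hc0, c, hc1, ?_⟩
  rw [Algebra.algebraMap_eq_smul_one]
  exact smul_le_smul_of_nonneg_left ((leOne_iff T).1 hT1) hc0

/-- The map c⁻¹ ρ is implemented by c⁻¹ t ≤ 1, and its complete positivity is automatic by
`isCP_of_opImplements`. -/
theorem GType.exists_of_opImplements (hd : φ.IsDenselyDefined) {ρ : A →ₗ[ℂ] 𝓜(ℂ, B)}
    (hρ : IsStrict ρ) {t : Op B E} (ht : OpImplements Λ ρ t) {c : ℝ} (hc0 : 0 < c) (hc1 : c < 1)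
    (htc : t ≤ algebraMap ℝ (Op B E) c) :
    ∃ c : ℝ, 0 ≤ c ∧ c < 1 ∧ ∃ σ ∈ setF Λ, ρ = (c : ℂ) • σ := by
  have hi := ht.smul (inv_nonneg.2 hc0.le)
  have hs := hρ.smul ((c⁻¹ : ℝ) : ℂ)
  have him : Implements Λ (((c⁻¹ : ℝ) : ℂ) • ρ) (ofOp (c⁻¹ • t)) := by
    rw [← opImplements_toOp, toOp_ofOp]
    exact hi
  refine ⟨c, hc0.le, hc1, ((c⁻¹ : ℝ) : ℂ) • ρ, ⟨⟨isCP_of_opImplements hd hs hi, hs, _, him⟩,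
    _, him, ?_⟩, ?_⟩
  · rw [leOne_iff, toOp_ofOp]
    have h := smul_le_smul_of_nonneg_left htc (inv_nonneg.2 hc0.le)
    rwa [Algebra.algebraMap_eq_smul_one, smul_smul, inv_mul_cancel₀ hc0.ne', one_smul] at h
  · rw [smul_smul, ← Complex.ofReal_mul, mul_inv_cancel₀ hc0.ne', Complex.ofReal_one, one_smul]

/-- The map `a ↦ w⋆ q π(a) w`. -/
noncomputable def sandwichRep (w : Adj B B E) (q : Op B E) (π : StarRep B E A) :
    A →ₗ[ℂ] 𝓜(ℂ, B) where
  toFun a := sandwich w (q * π.hom a)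
  map_add' a b := by rw [map_add, mul_add, map_add]
  map_smul' c a := by rw [map_smul, mul_smul_comm, map_smul, RingHom.id_apply]

/-- The condition on the values of `w` replaces nondegeneracy of π, which is derived only after
directedness. Commutation gives (q π(a))⋆ = q π(a⋆), so both halves of strict convergence are alike.
-/
theorem isStrict_sandwichRep {w : Adj B B E} {q : Op B E} {π : StarRep B E A}
    (hw : ∀ b, w.1 b ∈ closure (Submodule.span ℂ (repRange π) : Set E))
    (hq : ∀ x, Commute q (π.hom x)) (hsa : IsSelfAdjoint q) : IsStrict (sandwichRep w q π) := by
  refine isStrict_iff.2 fun l a C hC hl => ?_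
  have hsm : ∀ x : A, star (q * π.hom x) = q * π.hom (star x) := fun x => by
    rw [star_mul, ← map_star, hsa.star_eq, (hq _).eq]
  refine strictTendsto_sandwich w (fun b => ?_) (fun b => ?_)
  · exact (q.1.continuous.tendsto _).comp (π.tendsto_apply C hC hl (hw b))
  · simp only [hsm]
    refine (q.1.continuous.tendsto _).comp (π.tendsto_apply (f := fun x => star x) C ?_ ?_ (hw b))
    · simpa only [norm_star] using hC
    · simpa only [coe_star] using hl.star

theorem GType.le_of_op_le (hd : φ.IsDenselyDefined) {g h : GType Λ} {s t : Op B E}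
    (hs : OpImplements Λ g.1 s) (ht : OpImplements Λ h.1 t) (hst : s ≤ t) : g ≤ h :=
  isCP_of_opImplements hd (h.exists_opImplements.1.sub g.exists_opImplements.1) (ht.sub hs hst)

/-- Let t₁, t₂ ≤ c < 1 implement the two maps and put s = (1 - c)⁻¹ (t₁ + t₂), u = 1 + s. Then 1 -
u⁻¹ dominates t₁ and t₂ by `inv_one_add_le_one_sub` and stays below a constant less than 1. It
remains to realize it by a strict map: if τ is implemented by s and w stands for s Λ(1), then τ - w⋆
u⁻¹ π(·) w is implemented by s - s u⁻¹ s = 1 - u⁻¹. The factor λ < 1 in 𝓖 is what makes c < 1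
available. -/
theorem GType.exists_ge (hK : IsKSGNS φ Λ π) (hd : φ.IsDenselyDefined) (g₁ g₂ : GType Λ) :
    ∃ g : GType Λ, g₁ ≤ g ∧ g₂ ≤ g := by
  obtain ⟨hg₁, t₁, ht₁, c₁, hc₁, htc₁⟩ := g₁.exists_opImplements
  obtain ⟨hg₂, t₂, ht₂, c₂, hc₂, htc₂⟩ := g₂.exists_opImplements
  set c := max c₁ c₂
  have hc : c < 1 := max_lt hc₁ hc₂
  have htc₁' := htc₁.trans (algebraMap_mono (Op B E) (le_max_left c₁ c₂))
  have htc₂' := htc₂.trans (algebraMap_mono (Op B E) (le_max_right c₁ c₂))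
  have hk : 0 ≤ (1 - c)⁻¹ := inv_nonneg.2 (by linarith)
  have hτ : IsStrict ((((1 - c)⁻¹ : ℝ) : ℂ) • (g₁.1 + g₂.1)) := (hg₁.add hg₂).smul _
  have hs := (ht₁.add ht₂).smul hk
  set τ := (((1 - c)⁻¹ : ℝ) : ℂ) • (g₁.1 + g₂.1)
  set s := (1 - c)⁻¹ • (t₁ + t₂) with hsdef
  obtain ⟨u, hu, hu1, c', hc0', hc1', huc⟩ := exists_inv_one_add hs.1
  obtain ⟨w, hw, hwc⟩ := exists_implementing_adj hK hd hτ hs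
  have hu0 : (0 : Op B E) ≤ u := by rw [hu]; exact add_nonneg zero_le_one hs.1
  have hq0 : (0 : Op B E) ≤ (↑u⁻¹ : Op B E) := CFC.inv_nonneg_of_nonneg u hu0
  have hq : ∀ x, Commute (↑u⁻¹ : Op B E) (π.hom x) := fun x => by
    refine Commute.units_inv_left ?_
    rw [hu]
    exact (Commute.one_left _).add_left (commute_of_opImplements hK hs x)
  have hstr := isStrict_sandwichRep hwc hq (IsSelfAdjoint.of_nonneg hq0)
  have halg : s - s * (↑u⁻¹ : Op B E) * s = 1 - (↑u⁻¹ : Op B E) := by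
    have h1 : s = u - 1 := by rw [hu]; abel
    rw [h1, sub_mul, Units.mul_inv]
    simp only [mul_sub, sub_mul, one_mul, mul_one, Units.inv_mul]
    abel
  have hsa : star s = s := (IsSelfAdjoint.of_nonneg hs.1).star_eq
  have himp : OpImplements Λ (τ - sandwichRep w (↑u⁻¹ : Op B E) π) (1 - (↑u⁻¹ : Op B E)) := by
    refine ⟨sub_nonneg.2 hu1, fun a₁ a₂ b₁ b₂ => ?_⟩
    have h1 : star b₂ * ((τ - sandwichRep w (↑u⁻¹ : Op B E) π) (star (a₂ : A) * a₁)).fst b₁ =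
        star b₂ * (τ (star (a₂ : A) * a₁)).fst b₁ -
          star b₂ * (sandwich w ((↑u⁻¹ : Op B E) * π.hom (star (a₂ : A) * a₁))).fst b₁ :=
      mul_sub _ _ _
    have h2 : ((↑u⁻¹ : Op B E) * π.hom (star (a₂ : A) * a₁)).1 (w.1 b₁) =
        π.toHom (star (a₂ : A)) ((↑u⁻¹ : Op B E).1 (π.toHom a₁ (w.1 b₁))) := by
      have h3 : (↑u⁻¹ : Op B E) * π.hom (star (a₂ : A) * a₁) =
          π.hom (star (a₂ : A)) * ((↑u⁻¹ : Op B E) * π.hom (a₁ : A)) := by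
        rw [map_mul, ← mul_assoc, (hq _).eq, mul_assoc]
      rw [h3]
      rfl
    rw [h1, hs.2, star_mul_sandwich, h2, π.adjoint, star_star, hw, hw, ← halg]
    have h4 : ip B ((s - s * (↑u⁻¹ : Op B E) * s).1 ((Λ a₁).1 b₁)) ((Λ a₂).1 b₂) =
        ip B (s.1 ((Λ a₁).1 b₁)) ((Λ a₂).1 b₂) -
          ip B (s.1 ((↑u⁻¹ : Op B E).1 (s.1 ((Λ a₁).1 b₁)))) ((Λ a₂).1 b₂) := ip_sub_left _ _ _
    have h5 := Op.ip_star_left s ((↑u⁻¹ : Op B E).1 (s.1 ((Λ a₁).1 b₁))) ((Λ a₂).1 b₂)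
    rw [hsa] at h5
    rw [h4, h5]
  have h1u : ∀ i : Op B E, (1 - c)⁻¹ • i ≤ s → 1 + (1 - c)⁻¹ • i ≤ u := fun i hi => by
    rw [hu]
    gcongr
  have hle₁ : t₁ ≤ 1 - (↑u⁻¹ : Op B E) := by
    have h := inv_one_add_le_one_sub (u := u) hc ht₁.1 htc₁' (h1u _
      (smul_le_smul_of_nonneg_left (le_add_of_nonneg_right ht₂.1) hk))
    rw [le_sub_comm]
    exact h
  have hle₂ : t₂ ≤ 1 - (↑u⁻¹ : Op B E) := by
    have h := inv_one_add_le_one_sub (u := u) hc ht₂.1 htc₂' (h1u _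
      (smul_le_smul_of_nonneg_left (le_add_of_nonneg_left ht₁.1) hk))
    rw [le_sub_comm]
    exact h
  let g : GType Λ := ⟨τ - sandwichRep w (↑u⁻¹ : Op B E) π,
    GType.exists_of_opImplements hd (hτ.sub hstr) himp hc0' hc1' huc⟩
  exact ⟨g, GType.le_of_op_le hd ht₁ (h := g) himp hle₁, GType.le_of_op_le hd ht₂ (h := g) himp hle₂⟩

theorem GType.nonempty (Λ : φ.cone.N →ₗ[ℂ] Adj B B E) : Nonempty (GType Λ) := by
  have hs : IsStrict (0 : A →ₗ[ℂ] 𝓜(ℂ, B)) :=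
    isStrict_iff.2 fun l a C _ _ => strictTendsto_const l 0
  have hi : Implements Λ 0 (0 : Adj B E E) :=
    ⟨fun v => by simp, fun a₁ a₂ b₁ b₂ => by simp⟩
  have hcp : IsCP (0 : A →ₗ[ℂ] 𝓜(ℂ, B)) := fun n a b => by simp
  exact ⟨⟨0, 0, le_rfl, zero_lt_one, 0, ⟨⟨hcp, hs, 0, hi⟩, 0, hi, fun v => by
    simpa using ip_self_nonneg v⟩, by simp⟩⟩

theorem GType.neBot_atTop (hK : IsKSGNS φ Λ π) (hd : φ.IsDenselyDefined) :
    (atTop : Filter (GType Λ)).NeBot := by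
  have := GType.nonempty Λ
  have : IsDirectedOrder (GType Λ) := ⟨GType.exists_ge hK hd⟩
  exact atTop_neBot

end Directed

/-- The approximate limit `z` may depend on ε, so completeness is used without a candidate for the
limit. -/
theorem exists_tendsto_of_eventually_dist_lt {ι X : Type*} [PseudoMetricSpace X] [CompleteSpace X]
    {l : Filter ι} [l.NeBot] {f : ι → X} (h : ∀ ε > 0, ∃ z, ∀ᶠ i in l, dist (f i) z < ε) :
    ∃ y, Tendsto f l (𝓝 y) := by
  refine cauchy_map_iff_exists_tendsto.1 (cauchy_map_iff.2 ⟨inferInstance, ?_⟩)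
  rw [tendsto_uniformity_iff_dist_tendsto_zero, Metric.tendsto_nhds]
  intro ε hε
  obtain ⟨z, hz⟩ := h (ε / 2) (half_pos hε)
  filter_upwards [tendsto_fst.eventually hz, tendsto_snd.eventually hz] with p hp hq
  rw [Real.dist_0_eq_abs, abs_of_nonneg dist_nonneg]
  calc _ ≤ dist (f p.1) z + dist (f p.2) z := dist_triangle_right _ _ _
    _ < ε / 2 + ε / 2 := add_lt_add hp hq
    _ = ε := add_halves ε

/-! ### Extension of a nondegenerate representation to the multiplier algebra -/

section BarRep

variable {A : Type*} [NonUnitalCStarAlgebra A] [PartialOrder A] [StarOrderedRing A]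
variable {B : Type*} [NonUnitalCStarAlgebra B] [PartialOrder B] [StarOrderedRing B]
variable {E : Type*} [NormedAddCommGroup E] [NormedSpace ℂ E] [SMul Bᵐᵒᵖ E] [CStarModule Bᵐᵒᵖ E]
variable [CompleteSpace E]

theorem exists_tendsto_op_of_dense {ι : Type*} {l : Filter ι} [l.NeBot] {X : ι → Op B E} (C : ℝ)
    (hC : ∀ᶠ i in l, ‖X i‖ ≤ C) {S : Set E} (hS : Dense (Submodule.span ℂ S : Set E))
    (h : ∀ ξ ∈ S, ∃ y, Tendsto (fun i => (X i).1 ξ) l (𝓝 y)) (ξ : E) :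
    ∃ y, Tendsto (fun i => (X i).1 ξ) l (𝓝 y) := by
  have h1 : ∀ ξ ∈ Submodule.span ℂ S, ∃ y, Tendsto (fun i => (X i).1 ξ) l (𝓝 y) := by
    intro ξ hξ
    induction hξ using Submodule.span_induction with
    | mem ξ hξ => exact h ξ hξ
    | zero => exact ⟨0, by simp only [map_zero]; exact tendsto_const_nhds⟩
    | add ξ η _ _ h1 h2 =>
      obtain ⟨y, hy⟩ := h1
      obtain ⟨z, hz⟩ := h2
      exact ⟨y + z, by simpa using hy.add hz⟩
    | smul c ξ _ h1 =>
      obtain ⟨y, hy⟩ := h1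
      exact ⟨c • y, by simpa using hy.const_smul c⟩
  refine exists_tendsto_of_eventually_dist_lt fun ε hε => ?_
  set D := max C 0 + 1 with hD
  have hD0 : 0 < D := by positivity
  obtain ⟨η, hη, hd⟩ := Metric.mem_closure_iff.1 (hS ξ) (ε / (2 * D)) (by positivity)
  obtain ⟨y, hy⟩ := h1 η hη
  refine ⟨y, ?_⟩
  filter_upwards [Metric.tendsto_nhds.1 hy (ε / 2) (by positivity), hC] with i hi hCi
  have e : (X i).1 ξ - y = (X i).1 (ξ - η) + ((X i).1 η - y) := by
    simp only [map_sub]; abel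
  rw [dist_eq_norm] at hi hd ⊢
  rw [e]
  calc _ ≤ ‖(X i).1 (ξ - η)‖ + ‖(X i).1 η - y‖ := norm_add_le _ _
    _ ≤ D * ‖ξ - η‖ + ‖(X i).1 η - y‖ := by
        gcongr
        refine (Op.norm_apply_le _ _).trans ?_
        gcongr
        rw [hD]
        exact hCi.trans ((le_max_left _ _).trans (by linarith))
    _ < D * (ε / (2 * D)) + ε / 2 := by gcongr
    _ = ε := by field_simp; ring

theorem Op.ext_of_dense {S : Set E} (hS : Dense (Submodule.span ℂ S : Set E)) {X Y : Op B E}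
    (h : ∀ ξ ∈ S, X.1 ξ = Y.1 ξ) : X = Y :=
  Subtype.ext (ContinuousLinearMap.ext_on hS h)

theorem StarRep.ext_toHom {C : Type*} [NonUnitalCStarAlgebra C] {π π' : StarRep B E C}
    (h : π.toHom = π'.toHom) : π = π' := by
  cases π
  cases π'
  cases h
  rfl

variable {π : StarRep B E A}

/-- The operator is the strong limit of π(x e) along the approximate unit: the net is bounded by
‖x‖, and π(x e) π(c) η → π(x c) η. Since (x e)⋆ c → x⋆ c, the limit has an adjoint on the vectors
π(c) η. -/
theorem exists_barOp (hπ : Dense (Submodule.span ℂ (repRange π) : Set E)) (x : 𝓜(ℂ, A)) :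
    ∃ X : Op B E, (∀ (c : A) (η : E), X.1 (π.toHom c η) = π.toHom (x.fst c) η) ∧
      ∀ (ξ : E) (c : A) (η : E),
        ip B (X.1 ξ) (π.toHom c η) = ip B ξ (π.toHom ((star x).fst c) η) := by
  set u := CStarAlgebra.approximateUnit A
  have hC : ∀ᶠ e in u, ‖π.hom (x.fst e)‖ ≤ ‖x‖ := by
    filter_upwards [approximateUnit_eventually A] with e he
    refine (NonUnitalStarAlgHom.norm_apply_le π.hom _).trans ((norm_fst_apply_le x e).trans ?_)
    exact mul_le_of_le_one_right (norm_nonneg _) he.2.1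
  have hpi : ∀ {f : A → A} {a : A} (η : E), Tendsto f u (𝓝 a) →
      Tendsto (fun e => π.toHom (f e) η) u (𝓝 (π.toHom a η)) := fun η hf =>
    ((π.continuous_apply η).tendsto _).comp hf
  have hrange : ∀ (c : A) (η : E), Tendsto (fun e => (π.hom (x.fst e)).1 (π.toHom c η)) u
      (𝓝 (π.toHom (x.fst c) η)) := fun c η => by
    have h1 : Tendsto (fun e => x.fst e * c) u (𝓝 (x.fst c)) :=
      (strictTendsto_fst_approximateUnit x).fst c
    refine (hpi η h1).congr fun e => ?_
    rw [StarRep.hom_apply, StarRep.mul_apply]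
  have hlim := exists_tendsto_op_of_dense (B := B) ‖x‖ hC hπ (by
    rintro _ ⟨c, η, rfl⟩
    exact ⟨_, hrange c η⟩)
  choose t ht using hlim
  let T : E →ₗ[ℂ] E :=
    { toFun := t
      map_add' := fun ξ η => tendsto_nhds_unique (ht (ξ + η))
        (((ht ξ).add (ht η)).congr fun i => by simp)
      map_smul' := fun c ξ => tendsto_nhds_unique (ht (c • ξ))
        (((ht ξ).const_smul c).congr fun i => by simp) }
  have hweak : ∀ (ξ : E) (c : A) (η : E),
      ip B (t ξ) (π.toHom c η) = ip B ξ (π.toHom ((star x).fst c) η) := by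
    intro ξ c η
    refine tendsto_nhds_unique (tendsto_ip B (ht ξ) tendsto_const_nhds) ?_
    have h1 : Tendsto (fun e => star (x.fst e) * c) u (𝓝 ((star x).fst c)) := by
      refine (tendsto_approximateUnit_mul _).congr' ?_
      filter_upwards [approximateUnit_eventually A] with e he
      have := mult_star_mul_fst (star x) c e
      rw [star_star, he.2.2] at this
      exact this.symm
    refine (tendsto_ip B tendsto_const_nhds (hpi η h1)).congr fun e => ?_
    rw [StarRep.mul_apply, ← π.adjoint]
    rfl
  have hT : T ∈ Adj B E E := mem_Adj_of_dense T hπ (by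
    rintro _ ⟨c, η, rfl⟩
    exact ⟨_, fun ξ => hweak ξ c η⟩)
  exact ⟨toOp ⟨T, hT⟩, fun c η => tendsto_nhds_unique (ht _) (hrange c η), hweak⟩

/-- The operator `π̄(x)` for `x ∈ M(A)`. -/
noncomputable def barOp (hπ : Dense (Submodule.span ℂ (repRange π) : Set E)) (x : 𝓜(ℂ, A)) :
    Op B E := (exists_barOp hπ x).choose

variable (hπ : Dense (Submodule.span ℂ (repRange π) : Set E))

theorem barOp_apply (x : 𝓜(ℂ, A)) (c : A) (η : E) :
    (barOp hπ x).1 (π.toHom c η) = π.toHom (x.fst c) η :=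
  (exists_barOp hπ x).choose_spec.1 c η

theorem ip_barOp (x : 𝓜(ℂ, A)) (ξ : E) (c : A) (η : E) :
    ip B ((barOp hπ x).1 ξ) (π.toHom c η) = ip B ξ (π.toHom ((star x).fst c) η) :=
  (exists_barOp hπ x).choose_spec.2 ξ c η

theorem barOp_eq {x : 𝓜(ℂ, A)} {X : Op B E}
    (h : ∀ (c : A) (η : E), X.1 (π.toHom c η) = π.toHom (x.fst c) η) : barOp hπ x = X :=
  Op.ext_of_dense hπ (by
    rintro _ ⟨c, η, rfl⟩
    rw [barOp_apply, h])

/-- The extension of a nondegenerate representation to the multiplier algebra. -/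
noncomputable def barRep : StarRep B E 𝓜(ℂ, A) where
  toHom :=
    { toFun := fun x => (barOp hπ x).1.toLinearMap
      map_smul' := fun k x => by
        rw [barOp_eq hπ (X := k • barOp hπ x) fun c η => ?_]
        · rfl
        · have h : (k • x).fst c = k • x.fst c := rfl
          rw [h, map_smul]
          exact congrArg (k • ·) (barOp_apply hπ x c η)
      map_zero' := by
        rw [barOp_eq hπ (X := 0) fun c η => ?_]
        · rfl
        · have h : (0 : 𝓜(ℂ, A)).fst c = 0 := rfl
          rw [h, map_zero]
          rfl
      map_add' := fun x y => by
        rw [barOp_eq hπ (X := barOp hπ x + barOp hπ y) fun c η => ?_]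
        · rfl
        · have h : (x + y).fst c = x.fst c + y.fst c := rfl
          rw [h, map_add]
          exact congrArg₂ (· + ·) (barOp_apply hπ x c η) (barOp_apply hπ y c η)
      map_mul' := fun x y => by
        rw [barOp_eq hπ (X := barOp hπ x * barOp hπ y) fun c η => ?_]
        · rfl
        · have h : (x * y).fst c = x.fst (y.fst c) := rfl
          rw [h]
          change (barOp hπ x).1 ((barOp hπ y).1 (π.toHom c η)) = _
          rw [barOp_apply, barOp_apply] }
  adjoint := fun x v w => by
    have h : barOp hπ (star x) = star (barOp hπ x) := barOp_eq hπ fun c η => by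
      refine eq_of_forall_ip (B := B) fun y => ?_
      rw [Op.ip_star_left, ← star_ip, ip_barOp, star_ip]
    change ip B ((barOp hπ x).1 v) w = ip B v ((barOp hπ (star x)).1 w)
    rw [h, Op.ip_star_right]

theorem barRep_apply (x : 𝓜(ℂ, A)) (c : A) (η : E) :
    (barRep hπ).toHom x (π.toHom c η) = π.toHom (x.fst c) η := barOp_apply hπ x c η

theorem ip_barRep (x : 𝓜(ℂ, A)) (ξ : E) (c : A) (η : E) :
    ip B ((barRep hπ).toHom x ξ) (π.toHom c η) = ip B ξ (π.toHom ((star x).fst c) η) :=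
  ip_barOp hπ x ξ c η

theorem barRep_coe (a : A) : (barRep hπ).toHom (a : 𝓜(ℂ, A)) = π.toHom a := by
  have h : barOp hπ (a : 𝓜(ℂ, A)) = π.hom a := barOp_eq hπ fun c η => by
    rw [coe_fst_apply, StarRep.mul_apply]
    rfl
  change (barOp hπ (a : 𝓜(ℂ, A))).1.toLinearMap = _
  rw [h]
  rfl

/-- ⟨π'(x) ξ, π(c) η⟩ = ⟨ξ, π'(x⋆ c) η⟩, and x⋆ c lies in `A`, where π' is prescribed. -/
theorem barRep_unique {π' : StarRep B E 𝓜(ℂ, A)}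
    (h : ∀ a : A, π'.toHom (a : 𝓜(ℂ, A)) = π.toHom a) : π' = barRep hπ := by
  have h1 : π'.toHom = (barRep hπ).toHom := by
    refine NonUnitalAlgHom.ext fun x => LinearMap.ext fun ξ => eq_of_dense B hπ ?_
    rintro _ ⟨c, η, rfl⟩
    rw [ip_barRep, π'.adjoint, ← h, ← StarRep.mul_apply, mul_coe, h]
  exact StarRep.ext_toHom h1

theorem barRep_strictTendsto {ι : Type*} {l : Filter ι} {f : ι → 𝓜(ℂ, A)} {x : 𝓜(ℂ, A)} (C : ℝ)
    (hC : ∀ᶠ i in l, ‖f i‖ ≤ C) (hf : StrictTendsto f l x) (ξ : E) :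
    Tendsto (fun i => (barRep hπ).toHom (f i) ξ) l (𝓝 ((barRep hπ).toHom x ξ)) := by
  refine tendsto_op_of_mem_closure (B := B) (X := fun i => (barRep hπ).hom (f i))
    (Y := (barRep hπ).hom x) C ?_ ?_ (hπ ξ)
  · exact hC.mono fun i hi => (NonUnitalStarAlgHom.norm_apply_le (barRep hπ).hom (f i)).trans hi
  · rintro _ ⟨c, η, rfl⟩
    simp only [StarRep.hom_apply, barRep_apply]
    exact ((π.continuous_apply η).tendsto _).comp (hf.fst c)

/-- The map `w⋆ π̄(·) w` is a strict completely positive extension of its restriction. -/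
theorem isStrictExtension_sandwich (w : Adj B B E) {ρ : A →ₗ[ℂ] 𝓜(ℂ, B)}
    (h : ∀ a, sandwich w (π.hom a) = ρ a) : ∃ ρ' : 𝓜(ℂ, A) →ₗ[ℂ] 𝓜(ℂ, B),
      IsStrictExtension ρ ρ' ∧ ∀ x, ρ' x = sandwich w ((barRep hπ).hom x) := by
  refine ⟨{ toFun := fun x => sandwich w ((barRep hπ).hom x)
            map_add' := fun x y => by rw [map_add, map_add]
            map_smul' := fun c x => by rw [map_smul, map_smul, RingHom.id_apply] },
    ⟨fun a => ?_, fun n a b => ?_, ?_⟩, fun x => rfl⟩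
  · rw [← h]
    change sandwich w ((barRep hπ).hom (a : 𝓜(ℂ, A))) = _
    congr 1
    refine Subtype.ext (ContinuousLinearMap.ext fun ξ => ?_)
    rw [StarRep.hom_apply, barRep_coe]
    rfl
  · have h1 : ∑ i, ∑ j, star (b j) * (sandwich w ((barRep hπ).hom (star (a j) * a i))).fst (b i) =
        ip B (∑ i, (barRep hπ).toHom (a i) (w.1 (b i)))
          (∑ j, (barRep hπ).toHom (a j) (w.1 (b j))) := by
      rw [ip_sum_left]
      refine Finset.sum_congr rfl fun i _ => ?_
      rw [ip_sum_right]
      refine Finset.sum_congr rfl fun j _ => ?_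
      rw [star_mul_sandwich, StarRep.hom_apply, StarRep.mul_apply, (barRep hπ).adjoint, star_star]
    change 0 ≤ ∑ i, ∑ j, star (b j) * (sandwich w ((barRep hπ).hom (star (a j) * a i))).fst (b i)
    rw [h1]
    exact ip_self_nonneg _
  · rw [continuousOn_bounded_iff]
    intro l x C hC hl
    refine strictTendsto_sandwich w (fun b => ?_) (fun b => ?_)
    · exact barRep_strictTendsto hπ C hC hl _
    · simp only [← map_star]
      refine barRep_strictTendsto hπ (f := fun y => star y) C ?_ ?_ _
      · simpa only [norm_star] using hC
      · exact StrictTendsto.star hl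

end BarRep

/-! ### The net `𝓖` for a lower semi-continuous weight -/

section LowerSemicontinuous

variable {A : Type*} [NonUnitalCStarAlgebra A] [PartialOrder A] [StarOrderedRing A]
variable {B : Type*} [NonUnitalCStarAlgebra B] [PartialOrder B] [StarOrderedRing B]
variable {E : Type*} [NormedAddCommGroup E] [NormedSpace ℂ E] [SMul Bᵐᵒᵖ E] [CStarModule Bᵐᵒᵖ E]
variable [CompleteSpace E]
variable {φ : CStarValuedWeight A B} {Λ : φ.cone.N →ₗ[ℂ] Adj B B E} {π : StarRep B E A}

/-- The positive contraction that implements an element of `𝓖`. -/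
noncomputable def GType.op (g : GType Λ) : Op B E := g.exists_opImplements.2.choose

theorem GType.opImplements_op (g : GType Λ) : OpImplements Λ g.1 g.op :=
  g.exists_opImplements.2.choose_spec.1

theorem GType.op_le_one (g : GType Λ) : g.op ≤ 1 := by
  obtain ⟨c, hc, h⟩ := g.exists_opImplements.2.choose_spec.2
  refine h.trans ?_
  rw [← map_one (algebraMap ℝ (Op B E))]
  exact algebraMap_mono _ hc.le

theorem GType.norm_sub_op_apply_sq_le (g : GType Λ) (ξ : E) :
    ‖ξ - g.op.1 ξ‖ ^ 2 ≤ ‖ip B ξ ξ - ip B (g.op.1 ξ) ξ‖ := by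
  have h0 : 0 ≤ 1 - g.op := sub_nonneg.2 g.op_le_one
  have h1 : ‖1 - g.op‖ ≤ 1 := (CStarAlgebra.norm_le_one_iff_of_nonneg _ h0).2
    (sub_le_self _ g.opImplements_op.1)
  refine (Op.norm_apply_sq_le h0 ξ).trans ((mul_le_of_le_one_left (norm_nonneg _) h1).trans ?_)
  rw [Op.ip_sub_apply]
  exact le_rfl

/-- For ξ = Λ(a) b, ‖ξ - T_g ξ‖² ≤ ‖b⋆ (φ(a⋆a) - g(a⋆a)) b‖, which tends to 0 by lower
semi-continuity. Contractivity of T_g extends this to all of E. -/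
theorem tendsto_op (hK : IsKSGNS φ Λ π) (hlsc : IsLowerSemicontinuous φ Λ) (ξ : E) :
    Tendsto (fun g : GType Λ => g.op.1 ξ) atTop (𝓝 ξ) := by
  refine tendsto_op_of_mem_closure (B := B) (X := fun g : GType Λ => g.op) (Y := 1) 1 ?_ ?_
    (hK.dense ξ)
  · exact Eventually.of_forall fun g =>
      (CStarAlgebra.norm_le_one_iff_of_nonneg _ g.opImplements_op.1).2 g.op_le_one
  · rintro _ ⟨a, b, rfl⟩
    have h1 := (hlsc.tendsto ⟨_, φ.cone.star_mul_mem a.2 a.2⟩ a.2).star_mul_fst b b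
    have h2 : Tendsto (fun g : GType Λ => ip B ((Λ a).1 b) ((Λ a).1 b) -
        ip B (g.op.1 ((Λ a).1 b)) ((Λ a).1 b)) atTop (𝓝 0) := by
      have h3 := h1.const_sub (ip B ((Λ a).1 b) ((Λ a).1 b))
      have h4 : ip B ((Λ a).1 b) ((Λ a).1 b) = _ := hK.inner_eq a a b b
      have h5 : star b * (φ.toFun ⟨_, φ.cone.star_mul_mem a.2 a.2⟩).fst b =
        ip B ((Λ a).1 b) ((Λ a).1 b) := h4.symm
      rw [h5, sub_self] at h3
      refine h3.congr fun g => ?_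
      rw [← g.opImplements_op.2]
    have h3 : Tendsto (fun g : GType Λ => √(‖(Λ a).1 b - g.op.1 ((Λ a).1 b)‖ ^ 2)) atTop (𝓝 0) := by
      refine squeeze_zero (fun _ => Real.sqrt_nonneg _)
        (fun g => Real.sqrt_le_sqrt (g.norm_sub_op_apply_sq_le _)) ?_
      simpa [Function.comp_def] using (Real.continuous_sqrt.tendsto _).comp h2.norm
    rw [tendsto_iff_norm_sub_tendsto_zero]
    refine h3.congr fun g => ?_
    rw [Real.sqrt_sq (norm_nonneg _), norm_sub_rev]
    rfl

/-- T_g Λ(a) b = π(a) w b lies in the range of π and converges to Λ(a) b. -/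
theorem dense_repRange (hK : IsKSGNS φ Λ π) (hd : φ.IsDenselyDefined)
    (hlsc : IsLowerSemicontinuous φ Λ) : Dense (Submodule.span ℂ (repRange π) : Set E) := by
  have := GType.neBot_atTop hK hd
  have h : Submodule.span ℂ {v : E | ∃ (a : φ.cone.N) (b : B), v = (Λ a).1 b} ≤
      (Submodule.span ℂ (repRange π)).topologicalClosure := by
    refine Submodule.span_le.2 ?_
    rintro _ ⟨a, b, rfl⟩
    refine mem_closure_of_tendsto (tendsto_op hK hlsc ((Λ a).1 b)) (Eventually.of_forall fun g => ?_)
    obtain ⟨w, hw, -⟩ := exists_implementing_adj hK hd g.exists_opImplements.1 g.opImplements_op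
    rw [← hw]
    exact Submodule.subset_span ⟨_, _, rfl⟩
  have h2 := hK.dense.mono h
  rwa [Submodule.topologicalClosure_coe, dense_closure] at h2

/-- For c⋆ ∈ N_φ, ⟨v b, π(c) Λ(a) d⟩ = ⟨T_g^{1/2} Λ(c⋆) b, Λ(a) d⟩, so v has the adjoint vector
Λ(c⋆)⋆ T_g^{1/2} Λ(a) d there. Nondegeneracy makes such vectors π(c) Λ(a) d total. The identity v⋆
π(x) v = g(x) is checked for x⋆ ∈ N_φ and extends by continuity. -/
theorem exists_vec (hK : IsKSGNS φ Λ π) (hd : φ.IsDenselyDefined)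
    (hπ : Dense (Submodule.span ℂ (repRange π) : Set E)) (g : GType Λ) : ∃ v : Adj B B E,
      (∀ (a : φ.cone.N) (b : B), π.toHom a (v.1 b) = (CFC.sqrt g.op).1 ((Λ a).1 b)) ∧
      ∀ a, sandwich v (π.hom a) = g.1 a := by
  have hρ := g.exists_opImplements.1
  obtain ⟨v, hv1, -, hv3⟩ := exists_sqrt_vector hK hd hρ g.opImplements_op
  have hN := dense_N hd
  let S : Set E := {ξ | ∃ (c : A) (_ : star c ∈ φ.cone.N) (a : φ.cone.N) (d : B),
    ξ = π.toHom c ((Λ a).1 d)}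
  have hS : Dense (Submodule.span ℂ S : Set E) := by
    have h1 : ∀ c : A, star c ∈ φ.cone.N → ∀ η,
        π.toHom c η ∈ closure (Submodule.span ℂ S : Set E) := fun c hc η => by
      refine map_mem_closure (f := (π.hom c).1) (π.hom c).1.continuous (hK.dense η) fun η hη => ?_
      induction hη using Submodule.span_induction with
      | mem η hη =>
        obtain ⟨a, d, rfl⟩ := hη
        exact Submodule.subset_span ⟨c, hc, a, d, rfl⟩
      | zero => simp
      | add ξ η _ _ h h' => rw [map_add]; exact Submodule.add_mem _ h h'
      | smul k ξ _ h => rw [map_smul]; exact Submodule.smul_mem _ k h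
    have h2 : Submodule.span ℂ (repRange π) ≤ (Submodule.span ℂ S).topologicalClosure := by
      refine Submodule.span_le.2 ?_
      rintro _ ⟨c, η, rfl⟩
      have hcont := π.continuous_apply η
      have h3 := map_mem_closure (f := fun c : A => π.toHom (star c) η)
        (t := closure (Submodule.span ℂ S : Set E)) (hcont.comp continuous_star) (hN (star c))
        fun c hc => h1 (star c) (by rwa [star_star]) η
      rw [closure_closure, star_star] at h3
      exact h3
    have h4 := hπ.mono h2
    rwa [Submodule.topologicalClosure_coe, dense_closure] at h4
  have hvadj : v ∈ Adj B B E := mem_Adj_of_dense v hS (by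
    rintro _ ⟨c, hc, a, d, rfl⟩
    refine ⟨(adjoint (Λ ⟨star c, hc⟩)).1 ((CFC.sqrt g.op).1 ((Λ a).1 d)), fun b => ?_⟩
    have hsa := (IsSelfAdjoint.of_nonneg (CFC.sqrt_nonneg g.op)).star_eq
    have h1 := Op.ip_star_left (CFC.sqrt g.op) ((Λ ⟨star c, hc⟩).1 b) ((Λ a).1 d)
    rw [hsa] at h1
    have h2 : π.toHom (star c) (v b) = _ := hv1 ⟨star c, hc⟩ b
    have h3 := π.adjoint (star c) (v b) ((Λ a).1 d)
    rw [star_star] at h3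
    rw [ip_adjoint_right, ← h1, ← h3, h2])
  refine ⟨⟨v, hvadj⟩, hv1, fun x => mult_ext fun b d => ?_⟩
  have hcl : IsClosed {x : A | star d * (sandwich ⟨v, hvadj⟩ (π.hom x)).fst b =
      star d * (g.1 x).fst b} := by
    refine isClosed_eq ?_ (continuous_const.mul (hρ.continuous_fst b))
    simp only [star_mul_sandwich]
    refine (continuous_ip B).comp (Continuous.prodMk ?_ continuous_const)
    exact π.continuous_apply (v b)
  have h1 := map_mem_closure (f := fun c : A => star c) continuous_star (hN (star x))
    (t := {x : A | star d * (sandwich ⟨v, hvadj⟩ (π.hom x)).fst b = star d * (g.1 x).fst b})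
    fun c hc => by
      change star d * (sandwich ⟨v, hvadj⟩ (π.hom (star c))).fst b = star d * (g.1 (star c)).fst b
      rw [star_mul_sandwich, ← hv3 ⟨c, hc⟩, ← hv1, StarRep.hom_apply, π.adjoint, star_star]
  rw [hcl.closure_eq, star_star] at h1
  exact h1

end LowerSemicontinuous

/-! ### The extension of the weight to the multiplier algebra -/

/-- The increments of `f` are positive and dominated by those of `h`, hence also in norm. This gives
heredity of the cone of φ̄. -/
theorem exists_tendsto_of_dominated {B : Type*} [NonUnitalCStarAlgebra B] [PartialOrder B]
    [StarOrderedRing B] {ι : Type*} [Preorder ι] [Nonempty ι] [IsDirectedOrder ι] {f h : ι → B}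
    (hm : ∀ i j, i ≤ j → 0 ≤ f j - f i ∧ f j - f i ≤ h j - h i)
    (hh : ∃ y, Tendsto h atTop (𝓝 y)) : ∃ y, Tendsto f atTop (𝓝 y) := by
  obtain ⟨y, hy⟩ := hh
  refine exists_tendsto_of_eventually_dist_lt fun ε hε => ?_
  obtain ⟨i, hi⟩ := eventually_atTop.1 (Metric.tendsto_nhds.1 hy (ε / 2) (half_pos hε))
  refine ⟨f i, ?_⟩
  filter_upwards [eventually_ge_atTop i] with j hj
  calc dist (f j) (f i) = ‖f j - f i‖ := dist_eq_norm _ _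
    _ ≤ ‖h j - h i‖ :=
      CStarAlgebra.norm_le_norm_of_nonneg_of_le (hm i j hj).1 (hm i j hj).2
    _ = dist (h j) (h i) := (dist_eq_norm _ _).symm
    _ ≤ dist (h j) y + dist (h i) y := dist_triangle_right _ _ _
    _ < ε / 2 + ε / 2 := add_lt_add (hi j hj) (hi i le_rfl)
    _ = ε := add_halves ε

section BarWeight

variable {A : Type*} [NonUnitalCStarAlgebra A] [PartialOrder A] [StarOrderedRing A]
variable {B : Type*} [NonUnitalCStarAlgebra B] [PartialOrder B] [StarOrderedRing B]
variable {E : Type*} [NormedAddCommGroup E] [NormedSpace ℂ E] [SMul Bᵐᵒᵖ E] [CStarModule Bᵐᵒᵖ E]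
variable [CompleteSpace E]
variable {φ : CStarValuedWeight A B} {Λ : φ.cone.N →ₗ[ℂ] Adj B B E} {π : StarRep B E A}

theorem exists_vectors (hK : IsKSGNS φ Λ π) (hd : φ.IsDenselyDefined)
    (hπ : Dense (Submodule.span ℂ (repRange π) : Set E)) : ∃ v : GType Λ → Adj B B E,
      (∀ g (a : φ.cone.N) (b : B), π.toHom a ((v g).1 b) = (CFC.sqrt g.op).1 ((Λ a).1 b)) ∧
      (∀ g : GType Λ, IsStrictExtension g.1 (strictExtension g.1)) ∧
      ∀ (g : GType Λ) (x : 𝓜(ℂ, A)),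
        strictExtension g.1 x = sandwich (v g) ((barRep hπ).hom x) := by
  choose v hv1 hv2 using exists_vec hK hd hπ
  refine ⟨v, hv1, fun g => ?_, fun g x => ?_⟩
  · obtain ⟨ρ', h, -⟩ := isStrictExtension_sandwich hπ (v g) (hv2 g)
    rwa [strictExtension_eq h]
  · obtain ⟨ρ', h, h'⟩ := isStrictExtension_sandwich hπ (v g) (hv2 g)
    rw [strictExtension_eq h, h']

variable {hπ : Dense (Submodule.span ℂ (repRange π) : Set E)} {v : GType Λ → Adj B B E}

theorem star_mul_strictExtension
    (hv : ∀ (g : GType Λ) x, strictExtension g.1 x = sandwich (v g) ((barRep hπ).hom x))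
    (g : GType Λ) (x y : 𝓜(ℂ, A)) (b d : B) :
    star d * (strictExtension g.1 (star y * x)).fst b =
      ip B ((barRep hπ).toHom x ((v g).1 b)) ((barRep hπ).toHom y ((v g).1 d)) := by
  rw [hv, star_mul_sandwich, StarRep.hom_apply, StarRep.mul_apply, (barRep hπ).adjoint, star_star]

/-- The order of 𝓖 compares maps on `A` only. With x = y⋆y, the inequality holds at (y e)⋆(y e) ∈
`A` and passes to the limit along the approximate unit, since π̄(y e) v b → π̄(y) v b in norm. -/
theorem strictExtension_mono (hK : IsKSGNS φ Λ π) (hd : φ.IsDenselyDefined)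
    (hπ : Dense (Submodule.span ℂ (repRange π) : Set E)) {g h : GType Λ} (hgh : g ≤ h)
    {x : 𝓜(ℂ, A)} (hx : 0 ≤ x) (b : B) :
    star b * (strictExtension g.1 x).fst b ≤ star b * (strictExtension h.1 x).fst b := by
  obtain ⟨v, -, hext, hv⟩ := exists_vectors hK hd hπ
  obtain ⟨y, rfl⟩ := CStarAlgebra.nonneg_iff_eq_star_mul_self.1 hx
  have hC : ∀ᶠ e in CStarAlgebra.approximateUnit A, ‖((y.fst e : A) : 𝓜(ℂ, A))‖ ≤ ‖y‖ := by
    filter_upwards [approximateUnit_eventually A] with e he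
    refine (norm_coe_le _).trans ((norm_fst_apply_le y e).trans ?_)
    exact mul_le_of_le_one_right (norm_nonneg _) he.2.1
  have key : ∀ g : GType Λ, Tendsto (fun e : A =>
      star b * (g.1 (star (y.fst e) * y.fst e)).fst b) (CStarAlgebra.approximateUnit A)
      (𝓝 (star b * (strictExtension g.1 (star y * y)).fst b)) := fun g => by
    have h1 := barRep_strictTendsto hπ ‖y‖ hC (strictTendsto_fst_approximateUnit y) ((v g).1 b)
    rw [star_mul_strictExtension hv]
    refine (tendsto_ip B h1 h1).congr fun e => ?_
    rw [← star_mul_strictExtension hv, ← coe_star, ← coe_mul, (hext g).extends_eq]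
  refine le_of_tendsto_of_tendsto' (key g) (key h) fun e => ?_
  have h1 := hgh 1 (fun _ => y.fst e) (fun _ => b)
  simp only [Finset.univ_unique, Finset.sum_singleton] at h1
  have h2 : star b * ((h.1 - g.1) (star (y.fst e) * y.fst e)).fst b =
      star b * (h.1 (star (y.fst e) * y.fst e)).fst b -
        star b * (g.1 (star (y.fst e) * y.fst e)).fst b := mul_sub _ _ _
  rw [h2] at h1
  exact sub_nonneg.1 h1

/-- The cone of the extended weight. -/
def barCone (hK : IsKSGNS φ Λ π) (hd : φ.IsDenselyDefined)
    (hπ : Dense (Submodule.span ℂ (repRange π) : Set E)) : HereditaryCone 𝓜(ℂ, A) where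
  carrier := {x | 0 ≤ x ∧ ∀ b : B, ∃ y : B,
    Tendsto (fun ρ : GType Λ => star b * (strictExtension ρ.1 x).fst b) atTop (𝓝 y)}
  nonneg x hx := hx.1
  zero_mem := ⟨le_rfl, fun b => ⟨0, by
    have h : ∀ ρ : GType Λ, star b * (strictExtension ρ.1 (0 : 𝓜(ℂ, A))).fst b = 0 := fun ρ => by
      rw [map_zero]
      exact mul_zero _
    simp only [h]
    exact tendsto_const_nhds⟩⟩
  add_mem x hx y hy := ⟨add_nonneg hx.1 hy.1, fun b => by
    obtain ⟨z, hz⟩ := hx.2 b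
    obtain ⟨w, hw⟩ := hy.2 b
    refine ⟨z + w, (hz.add hw).congr fun ρ => ?_⟩
    rw [map_add, ← mul_add]
    rfl⟩
  smul_mem r hr x hx := ⟨smul_nonneg hr hx.1, fun b => by
    obtain ⟨z, hz⟩ := hx.2 b
    refine ⟨(r : ℂ) • z, (hz.const_smul (r : ℂ)).congr fun ρ => ?_⟩
    have h : r • x = (r : ℂ) • x := rfl
    rw [h, map_smul, ← mul_smul_comm]
    rfl⟩
  hereditary x hx y hy hyx := ⟨hy, fun b => by
    have := GType.nonempty Λ
    have : IsDirectedOrder (GType Λ) := ⟨GType.exists_ge hK hd⟩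
    refine exists_tendsto_of_dominated (fun g h hgh => ⟨?_, ?_⟩) (hx.2 b)
    · exact sub_nonneg.2 (strictExtension_mono hK hd hπ hgh hy b)
    · have h1 := strictExtension_mono hK hd hπ hgh (sub_nonneg.2 hyx) b
      have h2 : ∀ ρ : GType Λ, star b * (strictExtension ρ.1 (x - y)).fst b =
          star b * (strictExtension ρ.1 x).fst b - star b * (strictExtension ρ.1 y).fst b :=
        fun ρ => by
          rw [map_sub]
          exact mul_sub _ _ _
      rw [h2, h2, ← sub_nonneg] at h1
      rw [← sub_nonneg]
      refine h1.trans (le_of_eq ?_)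
      abel⟩

/-- An element of the multiplier algebra as an operator on the Hilbert module `B`. -/
noncomputable def multOp (m : 𝓜(ℂ, B)) : Op B B :=
  ⟨m.fst, (star m).fst, fun x y => by
    rw [ip_self, ip_self]
    have h := mult_star_mul_fst m x y
    exact h.symm⟩

theorem norm_multOp (m : 𝓜(ℂ, B)) : ‖multOp m‖ = ‖m‖ := by
  have h : ‖multOp m‖ = ‖m.fst‖ := rfl
  rw [h, DoubleCentralizer.norm_fst m]

theorem norm_fst_apply_sq_le {m : 𝓜(ℂ, B)} (hm : ∀ d : B, 0 ≤ star d * m.fst d) (b : B) :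
    ‖m.fst b‖ ^ 2 ≤ ‖m‖ * ‖star b * m.fst b‖ := by
  rw [← norm_multOp]
  exact Op.norm_apply_sq_le (t := multOp m) (Op.nonneg_of_ip_nonneg hm) b

/-- An operator on the Hilbert module `B` as an element of the multiplier algebra. -/
theorem exists_mult_of_adjoint (f f' : B → B) (h : ∀ x y, star y * f x = star (f' y) * x) :
    ∃ m : 𝓜(ℂ, B), (∀ x, m.fst x = f x) ∧ ∀ x, (star m).fst x = f' x := by
  let t : B →ₗ[ℂ] B :=
    { toFun := f
      map_add' := fun x y => eq_of_star_mul fun d => by rw [mul_add, h, h, h, mul_add]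
      map_smul' := fun c x => eq_of_star_mul fun d => by
        rw [RingHom.id_apply, mul_smul_comm, h, h, mul_smul_comm] }
  have ht : t ∈ Adj B B B := ⟨f', fun x y => h x y⟩
  let i : Adj B B B := ⟨LinearMap.id, id, fun x y => rfl⟩
  have hm : ∀ x, (sandwich i (toOp ⟨t, ht⟩)).fst x = f x := fun x => eq_of_star_mul fun d =>
    star_mul_sandwich i (toOp ⟨t, ht⟩) x d
  refine ⟨sandwich i (toOp ⟨t, ht⟩), hm, fun x => ?_⟩
  refine eq_of_star_mul fun d => ?_
  have h1 := mult_star_mul_fst (sandwich i (toOp ⟨t, ht⟩)) d x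
  rw [hm, h] at h1
  rw [← star_inj, star_mul, star_mul, star_star]
  exact h1

/-- A bounded increasing net of self-adjoint multipliers converges strictly if the nets
`b⋆ R b` converge. -/
theorem exists_strictTendsto_of_monotone {ι : Type*} [Preorder ι] [Nonempty ι] [IsDirectedOrder ι]
    {R : ι → 𝓜(ℂ, B)} {K : ℝ} (hK : ∀ i, ‖R i‖ ≤ K) (hsa : ∀ i, star (R i) = R i)
    (hmono : ∀ {i j}, i ≤ j → ∀ b, star b * (R i).fst b ≤ star b * (R j).fst b)
    (hconv : ∀ b, ∃ z, Tendsto (fun i => star b * (R i).fst b) atTop (𝓝 z)) :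
    ∃ m, StrictTendsto R atTop m := by
  have hK0 : 0 ≤ K := (norm_nonneg _).trans (hK (Classical.arbitrary _))
  have hlim : ∀ b, ∃ z, Tendsto (fun i => (R i).fst b) atTop (𝓝 z) := by
    intro b
    obtain ⟨z, hz⟩ := hconv b
    refine exists_tendsto_of_eventually_dist_lt fun ε hε => ?_
    -- ‖(R_j - R_i) b‖² is at most 2K ‖b⋆ (R_j - R_i) b‖ ≤ 2K δ < ε². The summand 1 covers K = 0 and
    -- makes the last inequality strict.
    set δ := ε ^ 2 / (2 * K + 1) with hδ
    have hδ0 : 0 < δ := by positivity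
    obtain ⟨i, hi⟩ := eventually_atTop.1 (Metric.tendsto_nhds.1 hz (δ / 2) (half_pos hδ0))
    refine ⟨(R i).fst b, ?_⟩
    filter_upwards [eventually_ge_atTop i] with j hj
    have hd0 : ∀ d : B, star d * (R j - R i).fst d = star d * (R j).fst d - star d * (R i).fst d :=
      fun d => mul_sub _ _ _
    have h1 := norm_fst_apply_sq_le (m := R j - R i)
      (fun d => by rw [hd0]; exact sub_nonneg.2 (hmono hj d)) b
    have h3 : ‖R j - R i‖ ≤ 2 * K := (norm_sub_le _ _).trans (by linarith [hK j, hK i])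
    have h5 : ‖star b * (R j - R i).fst b‖ < δ := by
      rw [hd0, ← dist_eq_norm]
      calc _ ≤ dist (star b * (R j).fst b) z + dist (star b * (R i).fst b) z :=
            dist_triangle_right _ _ _
        _ < δ / 2 + δ / 2 := add_lt_add (hi j hj) (hi i le_rfl)
        _ = δ := add_halves δ
    have h6 : dist ((R j).fst b) ((R i).fst b) ^ 2 < ε ^ 2 := by
      have h7 : dist ((R j).fst b) ((R i).fst b) = ‖(R j - R i).fst b‖ := dist_eq_norm _ _
      rw [h7]
      refine h1.trans_lt ?_
      calc ‖R j - R i‖ * ‖star b * (R j - R i).fst b‖ ≤ (2 * K) * δ := by gcongr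
        _ < (2 * K + 1) * δ := by gcongr; linarith
        _ = ε ^ 2 := by rw [hδ]; field_simp
    exact lt_of_pow_lt_pow_left₀ 2 hε.le h6
  choose f hf using hlim
  obtain ⟨m, hm, hm'⟩ := exists_mult_of_adjoint f f fun x y => by
    refine tendsto_nhds_unique ((hf x).const_mul (star y)) ?_
    refine ((hf y).star.mul_const x).congr fun g => ?_
    rw [← mult_star_mul_fst, hsa]
  refine ⟨m, strictTendsto_iff_star.2 fun b => ⟨?_, ?_⟩⟩
  · rw [hm]
    exact hf b
  · rw [hm']
    simpa only [hsa] using hf b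

/-- Formally R = F⋆F; taking d = R b gives ‖R b‖² ≤ C² ‖b‖ ‖R b‖. -/
theorem norm_le_of_star_mul_fst {R : 𝓜(ℂ, B)} {F : B →L[ℂ] E} {C : ℝ} (hC : ‖F‖ ≤ C)
    (h : ∀ b d, star d * R.fst b = ip B (F b) (F d)) : ‖R‖ ≤ C ^ 2 := by
  have hC0 : 0 ≤ C := (norm_nonneg _).trans hC
  rw [← DoubleCentralizer.norm_fst]
  refine ContinuousLinearMap.opNorm_le_bound _ (by positivity) fun b => ?_
  have h1 : ‖R.fst b‖ * ‖R.fst b‖ ≤ (C ^ 2 * ‖b‖) * ‖R.fst b‖ := by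
    rw [← CStarRing.norm_star_mul_self, h]
    refine (norm_ip_le B _ _).trans ?_
    calc ‖F b‖ * ‖F (R.fst b)‖ ≤ (C * ‖b‖) * (C * ‖R.fst b‖) := by
          gcongr
          · exact F.le_of_opNorm_le hC b
          · exact F.le_of_opNorm_le hC _
      _ = _ := by ring
  rcases (norm_nonneg (R.fst b)).eq_or_lt with h0 | h0
  · rw [← h0]; positivity
  · exact le_of_mul_le_mul_right h1 h0

/-- With x = y⋆y, the value at x is F_g⋆ F_g for F_g = π̄(y) v_g. An increasing convergent net is
dominated by its limit, so ‖F_g b‖² ≤ ‖lim b⋆ g(x) b‖ for each b, and uniform boundedness applies.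
-/
theorem exists_strictTendsto_of_mem_barCone (hK : IsKSGNS φ Λ π) (hd : φ.IsDenselyDefined)
    (hπ : Dense (Submodule.span ℂ (repRange π) : Set E)) {x : 𝓜(ℂ, A)}
    (hx : x ∈ (barCone hK hd hπ).carrier) :
    ∃ m, StrictTendsto (fun ρ : GType Λ => strictExtension ρ.1 x) atTop m := by
  have := GType.nonempty Λ
  have : IsDirectedOrder (GType Λ) := ⟨GType.exists_ge hK hd⟩
  obtain ⟨v, -, hext, hv⟩ := exists_vectors hK hd hπ
  obtain ⟨hx0, hx1⟩ := hx
  obtain ⟨y, rfl⟩ := CStarAlgebra.nonneg_iff_eq_star_mul_self.1 hx0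
  have hy : star (star y * y) = star y * y := by rw [star_mul, star_star]
  let F : GType Λ → B →L[ℂ] E := fun g =>
    ((barRep hπ).hom y).1.comp ⟨(v g).1, continuous_of_mem_Adj (v g)⟩
  have hform : ∀ g b d, star d * (strictExtension g.1 (star y * y)).fst b =
      ip B (F g b) (F g d) := fun g b d => star_mul_strictExtension hv g y y b d
  obtain ⟨C, hC⟩ : ∃ C, ∀ g, ‖F g‖ ≤ C := by
    refine banach_steinhaus fun b => ?_
    obtain ⟨z, hz⟩ := hx1 b
    refine ⟨√‖z‖, fun g => ?_⟩
    rw [← Real.sqrt_sq (norm_nonneg (F g b)), norm_sq_eq_norm_ip B, ← hform]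
    refine Real.sqrt_le_sqrt (CStarAlgebra.norm_le_norm_of_nonneg_of_le ?_ ?_)
    · rw [hform]
      exact ip_self_nonneg _
    · refine ge_of_tendsto hz ?_
      filter_upwards [eventually_ge_atTop g] with h hgh
      exact strictExtension_mono hK hd hπ hgh hx0 b
  refine exists_strictTendsto_of_monotone (K := C ^ 2)
    (fun g => norm_le_of_star_mul_fst (hC g) (hform g)) (fun g => ?_)
    (fun hgh b => strictExtension_mono hK hd hπ hgh hx0 b) hx1
  rw [hv, star_sandwich, ← map_star (barRep hπ).hom, hy]

theorem exists_strictTendsto_of_mem_span (hK : IsKSGNS φ Λ π) (hd : φ.IsDenselyDefined)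
    (hπ : Dense (Submodule.span ℂ (repRange π) : Set E)) (x : (barCone hK hd hπ).M) :
    ∃ m, StrictTendsto (fun ρ : GType Λ => strictExtension ρ.1 (x : 𝓜(ℂ, A))) atTop m := by
  obtain ⟨x, hx⟩ := x
  induction hx using Submodule.span_induction with
  | mem x hx => exact exists_strictTendsto_of_mem_barCone hK hd hπ hx
  | zero => exact ⟨0, by simpa only [map_zero] using strictTendsto_const _ _⟩
  | add x y _ _ hx hy =>
    obtain ⟨m, hm⟩ := hx
    obtain ⟨n, hn⟩ := hy
    exact ⟨m + n, by simpa only [map_add] using hm.add hn⟩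
  | smul c x _ hx =>
    obtain ⟨m, hm⟩ := hx
    exact ⟨c • m, by simpa only [map_smul] using hm.const_smul c⟩

theorem exists_isMultiplierExtension (hK : IsKSGNS φ Λ π) (hd : φ.IsDenselyDefined)
    (hπ : Dense (Submodule.span ℂ (repRange π) : Set E)) :
    ∃ ψ : CStarValuedWeight 𝓜(ℂ, A) B, IsMultiplierExtension Λ ψ := by
  have := GType.neBot_atTop hK hd
  choose f hf using exists_strictTendsto_of_mem_span hK hd hπ
  obtain ⟨-, -, hext, -⟩ := exists_vectors hK hd hπ
  let F : (barCone hK hd hπ).M →ₗ[ℂ] 𝓜(ℂ, B) :=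
    { toFun := f
      map_add' := fun x y => (hf (x + y)).unique (by
        simpa only [Submodule.coe_add, map_add] using (hf x).add (hf y))
      map_smul' := fun c x => (hf (c • x)).unique (by
        simpa only [Submodule.coe_smul, map_smul, RingHom.id_apply] using (hf x).const_smul c) }
  refine ⟨⟨barCone hK hd hπ, F, fun n a b => ?_⟩, ⟨fun x => Iff.rfl, hf⟩⟩
  have h1 := tendsto_finsetSum Finset.univ fun i _ => tendsto_finsetSum Finset.univ fun j _ =>
    (hf ⟨star (a j : 𝓜(ℂ, A)) * a i, (barCone hK hd hπ).star_mul_mem (a i).2 (a j).2⟩).star_mul_fst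
      (b j) (b i)
  exact ge_of_tendsto h1 (Eventually.of_forall fun g => (hext g).isCP n (fun i => a i) b)

theorem IsMultiplierExtension.unique (hK : IsKSGNS φ Λ π) (hd : φ.IsDenselyDefined)
    {ψ ψ' : CStarValuedWeight 𝓜(ℂ, A) B} (h : IsMultiplierExtension Λ ψ)
    (h' : IsMultiplierExtension Λ ψ') : ψ = ψ' := by
  have := GType.neBot_atTop hK hd
  obtain ⟨⟨P, _, _, _, _, _⟩, F, hF⟩ := ψ
  obtain ⟨⟨P', _, _, _, _, _⟩, F', hF'⟩ := ψ'
  have hP : P = P' := Set.ext fun x => (h.mem_iff x).trans (h'.mem_iff x).symm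
  subst hP
  have hFF : F = F' := LinearMap.ext fun x => (h.tendsto x).unique (h'.tendsto x)
  subst hFF
  rfl

theorem IsMultiplierExtension.extends (hK : IsKSGNS φ Λ π) (hd : φ.IsDenselyDefined)
    (hlsc : IsLowerSemicontinuous φ Λ)
    (hext : ∀ g : GType Λ, IsStrictExtension g.1 (strictExtension g.1))
    {ψ : CStarValuedWeight 𝓜(ℂ, A) B} (h : IsMultiplierExtension Λ ψ) (x : φ.cone.M) :
    ∃ hx : ((x : A) : 𝓜(ℂ, A)) ∈ ψ.cone.M, ψ.toFun ⟨((x : A) : 𝓜(ℂ, A)), hx⟩ = φ.toFun x := by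
  have := GType.neBot_atTop hK hd
  have key : ∀ x : φ.cone.M, ((x : A) : 𝓜(ℂ, A)) ∈ ψ.cone.M ∧
      StrictTendsto (fun ρ : GType Λ => strictExtension ρ.1 ((x : A) : 𝓜(ℂ, A))) atTop
        (φ.toFun x) := by
    rintro ⟨x, hx⟩
    induction hx using Submodule.span_induction with
    | mem x hx =>
      have h1 := hlsc.tendsto ⟨x, Submodule.subset_span hx⟩ hx
      simp only [← fun g : GType Λ => (hext g).extends_eq] at h1
      refine ⟨Submodule.subset_span ((h.mem_iff _).2 ⟨coe_nonneg (φ.cone.nonneg x hx),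
        fun b => ⟨_, h1.star_mul_fst b b⟩⟩), h1⟩
    | zero =>
      have e : (⟨0, φ.cone.M.zero_mem⟩ : φ.cone.M) = 0 := rfl
      simp only [coe_zero, map_zero]
      refine ⟨Submodule.zero_mem _, ?_⟩
      rw [e, map_zero]
      exact strictTendsto_const _ _
    | add x y hx hy h1 h2 =>
      have e : (⟨x + y, φ.cone.M.add_mem hx hy⟩ : φ.cone.M) = ⟨x, hx⟩ + ⟨y, hy⟩ := rfl
      simp only [coe_add, map_add]
      refine ⟨Submodule.add_mem _ h1.1 h2.1, ?_⟩
      rw [e, map_add]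
      exact h1.2.add h2.2
    | smul c x hx h1 =>
      have e : (⟨c • x, φ.cone.M.smul_mem c hx⟩ : φ.cone.M) = c • ⟨x, hx⟩ := rfl
      simp only [coe_smul, map_smul]
      refine ⟨Submodule.smul_mem _ c h1.1, ?_⟩
      rw [e, map_smul]
      exact h1.2.const_smul c
  exact ⟨(key x).1, (h.tendsto ⟨_, (key x).1⟩).unique (key x).2⟩

end BarWeight

/-! ### The extension of `Λ` -/

section BarLambda

variable {A : Type*} [NonUnitalCStarAlgebra A] [PartialOrder A] [StarOrderedRing A]
variable {B : Type*} [NonUnitalCStarAlgebra B] [PartialOrder B] [StarOrderedRing B]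
variable {E : Type*} [NormedAddCommGroup E] [NormedSpace ℂ E] [SMul Bᵐᵒᵖ E] [CStarModule Bᵐᵒᵖ E]

/-- Closure points for the strict-strong topology, in terms of filters. -/
theorem mem_strictStrongClosure_iff {S : Set (𝓜(ℂ, A) × (B →ₗ[ℂ] E))}
    {p : 𝓜(ℂ, A) × (B →ₗ[ℂ] E)} : p ∈ strictStrongClosure S ↔
      ∃ l : Filter (𝓜(ℂ, A) × (B →ₗ[ℂ] E)), l.NeBot ∧ (∀ᶠ q in l, q ∈ S) ∧
        StrictTendsto (fun q => q.1) l p.1 ∧ ∀ b, Tendsto (fun q => q.2 b) l (𝓝 (p.2 b)) := by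
  have hnhds : ∀ l : Filter (𝓜(ℂ, A) × (B →ₗ[ℂ] E)),
      l ≤ @nhds _ (@instTopologicalSpaceProd _ _ (strictTopology A) (strongTopology B E)) p ↔
        StrictTendsto (fun q => q.1) l p.1 ∧ ∀ b, Tendsto (fun q => q.2 b) l (𝓝 (p.2 b)) := by
    intro l
    rw [show p = (p.1, p.2) from rfl, @nhds_prod_eq _ _ (strictTopology A) (strongTopology B E)]
    have h1 : l ≤ @nhds _ (strictTopology A) p.1 ×ˢ @nhds _ (strongTopology B E) p.2 ↔
        Tendsto (fun q => q.1) l (@nhds _ (strictTopology A) p.1) ∧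
        Tendsto (fun q => q.2) l (@nhds _ (strongTopology B E) p.2) := by
      rw [← tendsto_prod_iff']
      exact Iff.rfl
    rw [h1, nhds_induced (T := Pi.topologicalSpace) (fun t : B →ₗ[ℂ] E => (fun b => t b : B → E)),
      tendsto_comap_iff, tendsto_pi_nhds]
    exact Iff.rfl
  unfold strictStrongClosure
  rw [@mem_closure_iff_nhdsWithin_neBot]
  constructor
  · intro h
    exact ⟨_, h,
      @self_mem_nhdsWithin _ (@instTopologicalSpaceProd _ _ (strictTopology A) (strongTopology B E)) p S,
      (hnhds _).1 (@nhdsWithin_le_nhds _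
        (@instTopologicalSpaceProd _ _ (strictTopology A) (strongTopology B E)) p S)⟩
  · rintro ⟨l, hl, hS, h⟩
    exact hl.mono (le_inf ((hnhds l).2 h) (le_principal_iff.2 hS))

variable [CompleteSpace E]
variable {φ : CStarValuedWeight A B} {Λ : φ.cone.N →ₗ[ℂ] Adj B B E} {π : StarRep B E A}
variable {ψ : CStarValuedWeight 𝓜(ℂ, A) B}

/-- Since T_g → 1 strongly, the operators T_g^{1/2} jointly separate the points of E. Identities for
Λ̄ are verified after applying each of them. -/
theorem eq_of_sqrt_op_apply (hK : IsKSGNS φ Λ π) (hd : φ.IsDenselyDefined)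
    (hlsc : IsLowerSemicontinuous φ Λ) {ξ η : E}
    (h : ∀ g : GType Λ, (CFC.sqrt g.op).1 ξ = (CFC.sqrt g.op).1 η) : ξ = η := by
  have := GType.neBot_atTop hK hd
  refine tendsto_nhds_unique (tendsto_op hK hlsc ξ) ((tendsto_op hK hlsc η).congr fun g => ?_)
  have h1 : ∀ ζ, g.op.1 ζ = (CFC.sqrt g.op).1 ((CFC.sqrt g.op).1 ζ) := fun ζ => by
    conv_lhs => rw [← CFC.sqrt_mul_sqrt_self g.op g.opImplements_op.1]
    rfl
  rw [h1, h1, h]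

theorem IsMultiplierExtension.mem_N_of_coe_mem (hlsc : IsLowerSemicontinuous φ Λ)
    (hext : ∀ g : GType Λ, IsStrictExtension g.1 (strictExtension g.1))
    (hψ : IsMultiplierExtension Λ ψ) {c : A} (hc : (c : 𝓜(ℂ, A)) ∈ ψ.cone.N) : c ∈ φ.cone.N := by
  have h1 : star (c : 𝓜(ℂ, A)) * (c : 𝓜(ℂ, A)) ∈ ψ.cone.carrier := hc
  rw [← coe_star, ← coe_mul] at h1
  have h2 := hψ.tendsto ⟨_, Submodule.subset_span h1⟩
  simp only [fun g : GType Λ => (hext g).extends_eq] at h2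
  exact (hlsc.mem_iff _).2 ⟨star_mul_self_nonneg c, _, h2⟩

theorem IsMultiplierExtension.coe_mem_N (hlsc : IsLowerSemicontinuous φ Λ)
    (hext : ∀ g : GType Λ, IsStrictExtension g.1 (strictExtension g.1))
    (hψ : IsMultiplierExtension Λ ψ) (c : φ.cone.N) : ((c : A) : 𝓜(ℂ, A)) ∈ ψ.cone.N := by
  change star ((c : A) : 𝓜(ℂ, A)) * ((c : A) : 𝓜(ℂ, A)) ∈ ψ.cone.carrier
  rw [← coe_star, ← coe_mul]
  refine (hψ.mem_iff _).2 ⟨coe_nonneg (star_mul_self_nonneg _), fun b => ?_⟩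
  have h := hlsc.tendsto ⟨_, φ.cone.star_mul_mem c.2 c.2⟩ c.2
  simp only [← fun g : GType Λ => (hext g).extends_eq] at h
  exact ⟨_, h.star_mul_fst b b⟩

/-- The left ideal N_φ̄ contains e a, and N_φ̄ ∩ `A` ⊆ N_φ by lower semi-continuity. -/
theorem IsMultiplierExtension.snd_mem_N (hlsc : IsLowerSemicontinuous φ Λ)
    (hext : ∀ g : GType Λ, IsStrictExtension g.1 (strictExtension g.1))
    (hψ : IsMultiplierExtension Λ ψ) {a : 𝓜(ℂ, A)} (ha : a ∈ ψ.cone.N) (e : A) :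
    a.snd e ∈ φ.cone.N := by
  refine hψ.mem_N_of_coe_mem hlsc hext ?_
  rw [← coe_mul_mult]
  exact ψ.cone.mul_mem _ ha

/-- For h ≥ g the form of h - g at c⋆c is dominated by its form at x; then h runs to the limit. The
bound depends on x, b and g but not on c, which gives uniformity along Λ(ea) b. -/
theorem IsMultiplierExtension.norm_sub_op_sq_le (hK : IsKSGNS φ Λ π) (hd : φ.IsDenselyDefined)
    (hlsc : IsLowerSemicontinuous φ Λ) (hψ : IsMultiplierExtension Λ ψ)
    (hπ : Dense (Submodule.span ℂ (repRange π) : Set E)) (g : GType Λ) {x : 𝓜(ℂ, A)}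
    (hx : x ∈ ψ.cone.carrier) {c : φ.cone.N} (hc : ((star (c : A) * c : A) : 𝓜(ℂ, A)) ≤ x)
    (b : B) : ‖(Λ c).1 b - g.op.1 ((Λ c).1 b)‖ ^ 2 ≤
      ‖star b * (ψ.toFun ⟨x, Submodule.subset_span hx⟩).fst b -
        star b * (strictExtension g.1 x).fst b‖ := by
  have := GType.nonempty Λ
  have : IsDirectedOrder (GType Λ) := ⟨GType.exists_ge hK hd⟩
  obtain ⟨v, -, hext, -⟩ := exists_vectors hK hd hπ
  refine (g.norm_sub_op_apply_sq_le _).trans ?_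
  have h1 : ip B ((Λ c).1 b) ((Λ c).1 b) =
    star b * (φ.toFun ⟨_, φ.cone.star_mul_mem c.2 c.2⟩).fst b := hK.inner_eq c c b b
  rw [h1, ← g.opImplements_op.2]
  have h2 := (hlsc.tendsto ⟨_, φ.cone.star_mul_mem c.2 c.2⟩ c.2).star_mul_fst b b
  have h3 := (hψ.tendsto ⟨x, Submodule.subset_span hx⟩).star_mul_fst b b
  refine CStarAlgebra.norm_le_norm_of_nonneg_of_le ?_ ?_
  · refine ge_of_tendsto (h2.sub_const _) ?_
    filter_upwards [eventually_ge_atTop g] with h hgh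
    rw [sub_nonneg, ← (hext g).extends_eq, ← (hext h).extends_eq]
    exact strictExtension_mono hK hd hπ hgh (coe_nonneg (star_mul_self_nonneg _)) b
  · refine le_of_tendsto_of_tendsto (h2.sub_const _) (h3.sub_const _) ?_
    filter_upwards [eventually_ge_atTop g] with h hgh
    have h4 := strictExtension_mono hK hd hπ hgh (sub_nonneg.2 hc) b
    have h5 : ∀ ρ : GType Λ, star b * (strictExtension ρ.1
        (x - ((star (c : A) * c : A) : 𝓜(ℂ, A)))).fst b = star b * (strictExtension ρ.1 x).fst b -
          star b * (ρ.1 (star (c : A) * c)).fst b := fun ρ => by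
      rw [map_sub, (hext ρ).extends_eq]
      exact mul_sub _ _ _
    rw [h5, h5, ← sub_nonneg] at h4
    rw [← sub_nonneg]
    refine h4.trans (le_of_eq ?_)
    abel

theorem coe_snd_star_mul_le (a : 𝓜(ℂ, A)) {e : A} (he : ‖e‖ ≤ 1) :
    ((star (a.snd e) * a.snd e : A) : 𝓜(ℂ, A)) ≤ star a * a := by
  rw [coe_mul, coe_star, ← coe_mul_mult]
  have hn : ‖star (e : 𝓜(ℂ, A)) * (e : 𝓜(ℂ, A))‖ ≤ 1 := by
    rw [CStarRing.norm_star_mul_self]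
    exact mul_le_one₀ ((norm_coe_le e).trans he) (norm_nonneg _) ((norm_coe_le e).trans he)
  have h1 := (CStarAlgebra.norm_le_one_iff_of_nonneg _
    (star_mul_self_nonneg (e : 𝓜(ℂ, A)))).1 hn
  have h2 := star_left_conjugate_le_conjugate h1 a
  simpa [mul_assoc] using h2

variable {hπ : Dense (Submodule.span ℂ (repRange π) : Set E)} {v : GType Λ → Adj B B E}

/-- The vectors `Λ(e a) b` converge along the approximate unit. -/
theorem exists_barLambda_apply (hK : IsKSGNS φ Λ π) (hd : φ.IsDenselyDefined)
    (hlsc : IsLowerSemicontinuous φ Λ) (hψ : IsMultiplierExtension Λ ψ)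
    (hv : ∀ g (a : φ.cone.N) (b : B), π.toHom a ((v g).1 b) = (CFC.sqrt g.op).1 ((Λ a).1 b))
    (hext : ∀ g : GType Λ, IsStrictExtension g.1 (strictExtension g.1))
    (a : ψ.cone.N) (b : B) : ∃ ξ : E,
      (∀ g, (CFC.sqrt g.op).1 ξ = (barRep hπ).toHom (a : 𝓜(ℂ, A)) ((v g).1 b)) ∧
      Tendsto (fun e : A => (Λ ⟨(a : 𝓜(ℂ, A)).snd e, hψ.snd_mem_N hlsc hext a.2 e⟩).1 b)
        (CStarAlgebra.approximateUnit A) (𝓝 ξ) := by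
  have := GType.neBot_atTop hK hd
  set u := CStarAlgebra.approximateUnit A
  set f : A → E := fun e => (Λ ⟨(a : 𝓜(ℂ, A)).snd e, hψ.snd_mem_N hlsc hext a.2 e⟩).1 b with hf
  have hC : ∀ᶠ e in u, ‖(((a : 𝓜(ℂ, A)).snd e : A) : 𝓜(ℂ, A))‖ ≤ ‖(a : 𝓜(ℂ, A))‖ := by
    filter_upwards [approximateUnit_eventually A] with e he
    refine (norm_coe_le _).trans ((norm_snd_apply_le _ e).trans ?_)
    exact mul_le_of_le_one_right (norm_nonneg _) he.2.1
  have hsq : ∀ g : GType Λ, Tendsto (fun e => (CFC.sqrt g.op).1 (f e)) u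
      (𝓝 ((barRep hπ).toHom (a : 𝓜(ℂ, A)) ((v g).1 b))) := fun g => by
    refine (barRep_strictTendsto hπ _ hC (strictTendsto_snd_approximateUnit _) _).congr fun e => ?_
    rw [hf, barRep_coe, ← hv]
  have hlim : ∃ ξ, Tendsto f u (𝓝 ξ) := by
    refine exists_tendsto_of_eventually_dist_lt fun ε hε => ?_
    have hx : star (a : 𝓜(ℂ, A)) * a ∈ ψ.cone.carrier := a.2
    have h1 := ((hψ.tendsto ⟨_, Submodule.subset_span hx⟩).star_mul_fst b b).const_sub
      (star b * (ψ.toFun ⟨_, Submodule.subset_span hx⟩).fst b)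
    rw [sub_self] at h1
    have h2 := h1.norm
    rw [norm_zero] at h2
    -- One g serves all e of norm at most 1: ‖Λ(ea) b - T_g Λ(ea) b‖ < ε/2. For this fixed g the net
    -- T_g Λ(ea) b converges, as T_g^{1/2} Λ(ea) b = π̄(ea) v_g b.
    obtain ⟨g, hg⟩ := (h2.eventually (gt_mem_nhds (show 0 < (ε / 2) ^ 2 by positivity))).exists
    have hop : ∀ ζ, (CFC.sqrt g.op).1 ((CFC.sqrt g.op).1 ζ) = g.op.1 ζ := fun ζ => by
      conv_rhs => rw [← CFC.sqrt_mul_sqrt_self g.op g.opImplements_op.1]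
      rfl
    have h3 : Tendsto (fun e => g.op.1 (f e)) u (𝓝 ((CFC.sqrt g.op).1
        ((barRep hπ).toHom (a : 𝓜(ℂ, A)) ((v g).1 b)))) := by
      refine (((CFC.sqrt g.op).1.continuous.tendsto _).comp (hsq g)).congr fun e => ?_
      exact hop _
    refine ⟨(CFC.sqrt g.op).1 ((barRep hπ).toHom (a : 𝓜(ℂ, A)) ((v g).1 b)), ?_⟩
    filter_upwards [Metric.tendsto_nhds.1 h3 (ε / 2) (half_pos hε), approximateUnit_eventually A]
      with e he hu
    have h4 := hψ.norm_sub_op_sq_le hK hd hlsc hπ g hx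
      (c := ⟨(a : 𝓜(ℂ, A)).snd e, hψ.snd_mem_N hlsc hext a.2 e⟩)
      (coe_snd_star_mul_le (a : 𝓜(ℂ, A)) hu.2.1) b
    have h5 : dist (f e) (g.op.1 (f e)) < ε / 2 := by
      rw [dist_eq_norm]
      exact lt_of_pow_lt_pow_left₀ 2 (by positivity) (h4.trans_lt hg)
    refine (dist_triangle _ (g.op.1 (f e)) _).trans_lt ?_
    calc _ < ε / 2 + ε / 2 := add_lt_add h5 he
      _ = ε := add_halves ε
  obtain ⟨ξ, hξ⟩ := hlim
  refine ⟨ξ, fun g => tendsto_nhds_unique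
    (((CFC.sqrt g.op).1.continuous.tendsto _).comp hξ) (hsq g), hξ⟩

/-- Inner products of vectors `ξ = Λ̄(x) b`, `η = Λ̄(y) d`. -/
theorem ip_eq_of_sqrt_op_apply (hK : IsKSGNS φ Λ π) (hd : φ.IsDenselyDefined)
    (hlsc : IsLowerSemicontinuous φ Λ) (hψ : IsMultiplierExtension Λ ψ)
    (hvs : ∀ (g : GType Λ) x, strictExtension g.1 x = sandwich (v g) ((barRep hπ).hom x))
    (x y : ψ.cone.N) (b d : B) {ξ η : E}
    (hξ : ∀ g, (CFC.sqrt g.op).1 ξ = (barRep hπ).toHom (x : 𝓜(ℂ, A)) ((v g).1 b))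
    (hη : ∀ g, (CFC.sqrt g.op).1 η = (barRep hπ).toHom (y : 𝓜(ℂ, A)) ((v g).1 d)) :
    ip B ξ η = star d * (ψ.sesq y x).fst b := by
  have := GType.neBot_atTop hK hd
  refine tendsto_nhds_unique (tendsto_ip B (tendsto_op hK hlsc ξ) tendsto_const_nhds) ?_
  refine ((hψ.tendsto ⟨_, ψ.cone.star_mul_mem x.2 y.2⟩).star_mul_fst d b).congr fun g => ?_
  rw [star_mul_strictExtension hvs, ← hξ, ← hη, Op.ip_sqrt_apply g.opImplements_op.1]

/-- Linearity follows from uniqueness of the vectors. For adjointability, ⟨Λ̄(a) b, Λ(c) d⟩ = d⋆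
φ̄(c⋆a) b for c ∈ N_φ, so the adjoint sends Λ(c) d to φ̄(c⋆a)⋆ d, and such vectors are total. -/
theorem exists_barLambda (hK : IsKSGNS φ Λ π) (hd : φ.IsDenselyDefined)
    (hlsc : IsLowerSemicontinuous φ Λ) (hψ : IsMultiplierExtension Λ ψ)
    (hv : ∀ g (a : φ.cone.N) (b : B), π.toHom a ((v g).1 b) = (CFC.sqrt g.op).1 ((Λ a).1 b))
    (hext : ∀ g : GType Λ, IsStrictExtension g.1 (strictExtension g.1))
    (hvs : ∀ (g : GType Λ) x, strictExtension g.1 x = sandwich (v g) ((barRep hπ).hom x)) :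
    ∃ L : ψ.cone.N →ₗ[ℂ] Adj B B E,
      ∀ (g : GType Λ) (a : ψ.cone.N) (b : B),
        (CFC.sqrt g.op).1 ((L a).1 b) = (barRep hπ).toHom (a : 𝓜(ℂ, A)) ((v g).1 b) := by
  choose ξ hξ _ using exists_barLambda_apply hK hd hlsc hψ hv hext
  have hinj : ∀ {ζ η : E}, (∀ g : GType Λ, (CFC.sqrt g.op).1 ζ = (CFC.sqrt g.op).1 η) → ζ = η :=
    fun h => eq_of_sqrt_op_apply hK hd hlsc h
  let T : ψ.cone.N → B →ₗ[ℂ] E := fun a =>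
    { toFun := ξ a
      map_add' := fun b d => hinj fun g => by rw [map_add, hξ, hξ, hξ, map_add, map_add]
      map_smul' := fun c b => hinj fun g => by
        rw [RingHom.id_apply, map_smul, hξ, hξ, map_smul, map_smul] }
  have hT : ∀ a, T a ∈ Adj B B E := fun a => mem_Adj_of_dense (T a) hK.dense (by
    rintro _ ⟨c, d, rfl⟩
    let c' : ψ.cone.N := ⟨((c : A) : 𝓜(ℂ, A)), hψ.coe_mem_N hlsc hext c⟩
    refine ⟨(star (ψ.sesq c' a)).fst d, fun b => ?_⟩
    rw [ip_self, mult_star_mul_fst]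
    refine ip_eq_of_sqrt_op_apply hK hd hlsc hψ hvs a c' b d (fun g => hξ a b g) fun g => ?_
    rw [← hv, ← barRep_coe hπ])
  refine ⟨{ toFun := fun a => ⟨T a, hT a⟩, map_add' := fun a a' => ?_, map_smul' := fun c a => ?_ },
    fun g a b => hξ a b g⟩
  · refine Subtype.ext (LinearMap.ext fun b => hinj fun g => ?_)
    change (CFC.sqrt g.op).1 (ξ (a + a') b) = (CFC.sqrt g.op).1 (ξ a b + ξ a' b)
    rw [map_add, hξ, hξ, hξ, Submodule.coe_add, map_add]
    rfl
  · refine Subtype.ext (LinearMap.ext fun b => hinj fun g => ?_)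
    change (CFC.sqrt g.op).1 (ξ (c • a) b) = (CFC.sqrt g.op).1 (c • ξ a b)
    rw [map_smul, hξ, hξ, Submodule.coe_smul, map_smul]
    rfl

variable {L : ψ.cone.N →ₗ[ℂ] Adj B B E}

theorem graph_eq_strictStrongClosure (hK : IsKSGNS φ Λ π) (hd : φ.IsDenselyDefined)
    (hlsc : IsLowerSemicontinuous φ Λ) (hψ : IsMultiplierExtension Λ ψ)
    (hv : ∀ g (a : φ.cone.N) (b : B), π.toHom a ((v g).1 b) = (CFC.sqrt g.op).1 ((Λ a).1 b))
    (hext : ∀ g : GType Λ, IsStrictExtension g.1 (strictExtension g.1))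
    (hvs : ∀ (g : GType Λ) x, strictExtension g.1 x = sandwich (v g) ((barRep hπ).hom x))
    (hL : ∀ (g : GType Λ) (a : ψ.cone.N) (b : B),
      (CFC.sqrt g.op).1 ((L a).1 b) = (barRep hπ).toHom (a : 𝓜(ℂ, A)) ((v g).1 b)) :
    graph L = strictStrongClosure (graphInMultiplier Λ) := by
  ext p
  rw [mem_strictStrongClosure_iff]
  constructor
  · rintro ⟨a, rfl⟩
    let F : A → 𝓜(ℂ, A) × (B →ₗ[ℂ] E) := fun e => (((a : 𝓜(ℂ, A)).snd e : A),
      (Λ ⟨(a : 𝓜(ℂ, A)).snd e, hψ.snd_mem_N hlsc hext a.2 e⟩).1)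
    refine ⟨map F (CStarAlgebra.approximateUnit A), inferInstance, ?_, ?_, fun b => ?_⟩
    · rw [eventually_map]
      exact Eventually.of_forall fun e => ⟨⟨_, hψ.snd_mem_N hlsc hext a.2 e⟩, rfl⟩
    · exact strictTendsto_snd_approximateUnit (a : 𝓜(ℂ, A))
    · obtain ⟨ξ, hξ, hlim⟩ := exists_barLambda_apply hK hd hlsc hψ hv hext a b
      have h1 : ξ = (L a).1 b := eq_of_sqrt_op_apply hK hd hlsc fun g => by rw [hξ, hL]
      rw [← h1]
      exact hlim
  · obtain ⟨x, t⟩ := p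
    rintro ⟨l, hl, hS, h1, h2⟩
    -- The filter need not be bounded in `M(A)`, so strong convergence of π̄ is not at hand. Tested
    -- against π(c) η, only the norm convergence a⋆ c → x⋆ c is needed.
    have key : ∀ g b, (CFC.sqrt g.op).1 (t b) = (barRep hπ).toHom x ((v g).1 b) := by
      intro g b
      refine eq_of_dense B hπ ?_
      rintro _ ⟨c, η, rfl⟩
      rw [ip_barRep]
      have h3 := tendsto_ip B (((CFC.sqrt g.op).1.continuous.tendsto _).comp (h2 b))
        (tendsto_const_nhds (x := π.toHom c η))
      refine tendsto_nhds_unique h3 ?_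
      have h4 : Tendsto (fun q : 𝓜(ℂ, A) × (B →ₗ[ℂ] E) => (star q.1).fst c) l
        (𝓝 ((star x).fst c)) := h1.star.fst c
      refine (tendsto_ip B (tendsto_const_nhds (x := (v g).1 b))
        (((π.continuous_apply η).tendsto _).comp h4)).congr' ?_
      filter_upwards [hS] with q hq
      obtain ⟨a, rfl⟩ := hq
      change ip B ((v g).1 b) (π.toHom ((star ((a : A) : 𝓜(ℂ, A))).fst c) η) =
        ip B ((CFC.sqrt g.op).1 ((Λ a).1 b)) (π.toHom c η)
      rw [← hv, π.adjoint, ← coe_star, coe_fst_apply, StarRep.mul_apply]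
    -- By `key`, b⋆ g(x⋆x) b = ⟨T_g t b, t b⟩, which converges because T_g → 1.
    have hx : x ∈ ψ.cone.N := (hψ.mem_iff _).2 ⟨star_mul_self_nonneg x, fun b => ⟨ip B (t b) (t b),
      (tendsto_ip B (tendsto_op hK hlsc (t b)) (tendsto_const_nhds (x := t b))).congr fun g => by
        rw [star_mul_strictExtension hvs, ← key, Op.ip_sqrt_apply g.opImplements_op.1]⟩⟩
    refine ⟨⟨x, hx⟩, Prod.ext rfl (LinearMap.ext fun b => ?_)⟩
    exact eq_of_sqrt_op_apply hK hd hlsc fun g => by rw [hL, key]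

/-- T_g^{1/2} commutes with π(A), hence with π̄(x), so it maps both sides to π̄(x a) v_g b. -/
theorem barRep_barLambda (hK : IsKSGNS φ Λ π) (hd : φ.IsDenselyDefined)
    (hlsc : IsLowerSemicontinuous φ Λ)
    (hL : ∀ (g : GType Λ) (a : ψ.cone.N) (b : B),
      (CFC.sqrt g.op).1 ((L a).1 b) = (barRep hπ).toHom (a : 𝓜(ℂ, A)) ((v g).1 b))
    (x : 𝓜(ℂ, A)) (a : ψ.cone.N) (b : B) :
    (barRep hπ).toHom x ((L a).1 b) = (L ⟨x * a, ψ.cone.mul_mem x a.2⟩).1 b := by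
  refine eq_of_sqrt_op_apply hK hd hlsc fun g => ?_
  have hc : ∀ y, Commute (CFC.sqrt g.op) (π.hom y) := fun y =>
    commute_sqrt (commute_of_opImplements hK g.opImplements_op y)
  have h1 : CFC.sqrt g.op * (barRep hπ).hom x = (barRep hπ).hom x * CFC.sqrt g.op := by
    refine Op.ext_of_dense hπ ?_
    rintro _ ⟨c, η, rfl⟩
    have h2 : ∀ y ζ, (CFC.sqrt g.op).1 (π.toHom y ζ) = π.toHom y ((CFC.sqrt g.op).1 ζ) :=
      fun y ζ => congrArg (fun X : Op B E => X.1 ζ) (hc y).eq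
    change (CFC.sqrt g.op).1 ((barRep hπ).toHom x (π.toHom c η)) =
      (barRep hπ).toHom x ((CFC.sqrt g.op).1 (π.toHom c η))
    rw [barRep_apply, h2, h2, barRep_apply]
  have h2 : (CFC.sqrt g.op).1 ((barRep hπ).toHom x ((L a).1 b)) =
      (barRep hπ).toHom x ((CFC.sqrt g.op).1 ((L a).1 b)) :=
    congrArg (fun X : Op B E => X.1 ((L a).1 b)) h1
  rw [h2, hL, hL, ← StarRep.mul_apply]

end BarLambda

end CStarWeights

/-! ### The main theorem. -/

theorem mainTheorem3
    {A : Type*} [NonUnitalCStarAlgebra A] [PartialOrder A] [StarOrderedRing A]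
    {B : Type*} [NonUnitalCStarAlgebra B] [PartialOrder B] [StarOrderedRing B]
    {E : Type*} [NormedAddCommGroup E] [NormedSpace ℂ E] [SMul Bᵐᵒᵖ E] [CStarModule Bᵐᵒᵖ E]
    [CompleteSpace E]
    (φ : CStarWeights.CStarValuedWeight A B)
    (Λ : φ.cone.N →ₗ[ℂ] CStarWeights.Adj B B E) (π : CStarWeights.StarRep B E A)
    (hKSGNS : CStarWeights.IsKSGNS φ Λ π)
    (hdense : φ.IsDenselyDefined)
    (hlsc : CStarWeights.IsLowerSemicontinuous φ Λ) :
    -- the extension of the weight to the multiplier algebra exists, is unique, and extends it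
    ∃ φbar : CStarWeights.CStarValuedWeight 𝓜(ℂ, A) B,
      CStarWeights.IsMultiplierExtension Λ φbar ∧
      (∀ ψ : CStarWeights.CStarValuedWeight 𝓜(ℂ, A) B,
        CStarWeights.IsMultiplierExtension Λ ψ → ψ = φbar) ∧
      (∀ x : φ.cone.M, ∃ h : ((x : A) : 𝓜(ℂ, A)) ∈ φbar.cone.M,
        φbar.toFun ⟨((x : A) : 𝓜(ℂ, A)), h⟩ = φ.toFun x) ∧
      -- the representation has exactly one extension to the multiplier algebra
      ∃ πbar : CStarWeights.StarRep B E 𝓜(ℂ, A),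
        (∀ a : A, πbar.toHom (a : 𝓜(ℂ, A)) = π.toHom a) ∧
        (∀ π' : CStarWeights.StarRep B E 𝓜(ℂ, A),
          (∀ a : A, π'.toHom (a : 𝓜(ℂ, A)) = π.toHom a) → π' = πbar) ∧
        -- the strict-strong closure is the graph of a linear map on all of `N` of the extension
        ∃ Λbar : φbar.cone.N →ₗ[ℂ] CStarWeights.Adj B B E,
          CStarWeights.graph Λbar =
            CStarWeights.strictStrongClosure (CStarWeights.graphInMultiplier Λ) ∧
          (∀ (x : 𝓜(ℂ, A)) (a : φbar.cone.N) (b : B),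
            πbar.toHom x ((Λbar a).1 b) = (Λbar ⟨x * a, φbar.cone.mul_mem x a.2⟩).1 b) ∧
          (∀ (a₁ a₂ : φbar.cone.N) (b₁ b₂ : B),
            CStarWeights.ip B ((Λbar a₁).1 b₁) ((Λbar a₂).1 b₂) =
              star b₂ * (φbar.sesq a₂ a₁).fst b₁) ∧
          CStarWeights.IsKSGNS φbar Λbar πbar := by
  have hπ := CStarWeights.dense_repRange hKSGNS hdense hlsc
  obtain ⟨v, hv, hext, hvs⟩ := CStarWeights.exists_vectors hKSGNS hdense hπ
  obtain ⟨ψ, hψ⟩ := CStarWeights.exists_isMultiplierExtension hKSGNS hdense hπ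
  obtain ⟨L, hL⟩ := CStarWeights.exists_barLambda hKSGNS hdense hlsc hψ hv hext hvs
  have hrep := CStarWeights.barRep_barLambda hKSGNS hdense hlsc hL
  have hip : ∀ (a₁ a₂ : ψ.cone.N) (b₁ b₂ : B), CStarWeights.ip B ((L a₁).1 b₁) ((L a₂).1 b₂) =
      star b₂ * (ψ.sesq a₂ a₁).fst b₁ := fun a₁ a₂ b₁ b₂ =>
    CStarWeights.ip_eq_of_sqrt_op_apply hKSGNS hdense hlsc hψ hvs a₁ a₂ b₁ b₂
      (fun g => hL g a₁ b₁) (fun g => hL g a₂ b₂)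
  refine ⟨ψ, hψ, fun ψ' hψ' => hψ'.unique hKSGNS hdense hψ,
    hψ.extends hKSGNS hdense hlsc hext, CStarWeights.barRep hπ, CStarWeights.barRep_coe hπ,
    fun π' h => CStarWeights.barRep_unique hπ h, L,
    CStarWeights.graph_eq_strictStrongClosure hKSGNS hdense hlsc hψ hv hext hvs hL,
    hrep, hip, ⟨?_, hip, hrep⟩⟩
  -- Λ̄ extends Λ, so density of the span is inherited from the given construction.
  refine hKSGNS.dense.mono (Submodule.span_mono ?_)
  rintro _ ⟨a, b, rfl⟩
  refine ⟨⟨((a : A) : 𝓜(ℂ, A)), hψ.coe_mem_N hlsc hext a⟩, b, ?_⟩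
  refine CStarWeights.eq_of_sqrt_op_apply hKSGNS hdense hlsc fun g => ?_
  rw [hL, ← hv, ← CStarWeights.barRep_coe hπ]
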